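/- Let $Q=(x-x_1)(x-x_2)(x-x_3)\,(dx)^2$ with $x_1,x_2,x_3\in\mathbb C$ pairwise distinct, $x_1+x_2+x_3=0$, such that all periods of $v=y\,dx$ on the elliptic curve $y^2=(x-x_1)(x-x_2)(x-x_3)$ are real. Label the zeros so that $x_2$ is the central zero, i.e. the zero that is connected to both other zeros by horizontal trajectories of $Q$ (curves along which $Q>0$), and so that $x_2,x_3,x_1$ follow each other counterclockwise around the origin. Let $A>0$ and $B>0$ be the lengths, in the metric $|Q|$, of the horizontal trajectories connecting $x_2$ with $x_3$ and $x_2$ with $x_1$, respectively. Using the symmetry $(x_1,x_2,x_3)\mapsto(\epsilon x_1,\epsilon x_2,\epsilon x_3)$, $\epsilon^5=1$, normalize the argument of the central zero by $0\le\arg x_2<\frac{2\pi}{5}$ if $A\le B$ and, symmetrically, by $-\frac{2\pi}5<\arg x_2\le 0$ if $A>B$. Let $\Delta_1=[(x_1-x_2)(x_3-x_1)(x_3-x_2)]^2$. With the principal values of $\arg(x_i-x_j)$ below, put $$\arg\Delta_1=2\big(\arg(x_3-x_2)+\arg(x_3-x_1)+\arg(x_2-x_1)\big).$$ This is a continuous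 branch of the argument of $\Delta_1$ on the space of all such normalized triples $(x_1,x_2,x_3)$, and the following holds. 1. As $A\to0$ (that is, $A/B\to 0$; for instance $A\to0$ with $B$ fixed, or with $A+B=1$), $$\arg(x_3-x_2)\to\tfrac{13\pi}{20},\quad \arg(x_3-x_1)\to\tfrac{2\pi}{5},\quad \arg(x_2-x_1)\to\tfrac{2\pi}{5};\qquad \arg\Delta_1\to\tfrac{29\pi}{10}.$$ 2. If $A=B$, then $$\arg(x_3-x_2)=\pi-\alpha,\quad \arg(x_3-x_1)=\tfrac{\pi}{2},\quad \arg(x_2-x_1)=\alpha;\qquad \arg\Delta_1=3\pi,$$ where $\alpha\in(0,\frac{\pi}{2})$ is the angle between the line through $x_2$ and $x_3$ and the horizontal direction. 3. As $B\to0$ (that is, $B/A\to 0$), $$\arg(x_3-x_2)\to\tfrac{3\pi}{5},\quad \arg(x_3-x_1)\to\tfrac{3\pi}{5},\quad \arg(x_2-x_1)\to\tfrac{7\pi}{20};\qquad \arg\Delta_1\to\tfrac{31\pi}{10}.$$ -/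

import Mathlib

open Filter Topology

noncomputable section

namespace Boutroux

/-- The coefficient of the quadratic differential `Q = (x - x₁)(x - x₂)(x - x₃) (dx)²`. -/
def cubic (x₁ x₂ x₃ x : ℂ) : ℂ := (x - x₁) * (x - x₂) * (x - x₃)

/-- All periods of the differential `v = y dx` on the elliptic curve `y² = q(x)` are real:
the integral of `v` along every closed path `t ↦ (x t, y t)`, `0 ≤ t ≤ 1`, on the affine curve
(`x` continuously differentiable, `y` continuous) is a real number. (The only pole of `v` is at
infinity and has no residue, so these integrals are exactly the periods of `v`.) -/
def RealPeriods (q : ℂ → ℂ) : Prop :=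
  ∀ x y : ℝ → ℂ, ContDiff ℝ 1 x → Continuous y → (∀ t, y t ^ 2 = q (x t)) →
    x 0 = x 1 → y 0 = y 1 → (∫ t in (0 : ℝ)..1, y t * deriv x t).im = 0

/-- The points `p` and `p'` are connected by a horizontal trajectory of `q(x) (dx)²` of length `L`
in the metric `|q| |dx|²`, written in its natural (arc length) parametrization `γ : [0, L] → ℂ`:
along the trajectory `q(γ) (γ')² = 1`, i.e. `v = √q dx` restricts to `± dt`. In particular the
trajectory meets no zero of `q` between its end points and `L = |∫ v|` along it. -/
def HorizontalTrajectory (q : ℂ → ℂ) (p p' : ℂ) (L : ℝ) : Prop :=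
  0 < L ∧ ∃ γ : ℝ → ℂ, ContinuousOn γ (Set.Icc 0 L) ∧ γ 0 = p ∧ γ L = p' ∧
    ∀ t ∈ Set.Ioo 0 L, ∃ d : ℂ, HasDerivAt γ d t ∧ q (γ t) * d ^ 2 = 1

/-- A nondegenerate cubic quadratic differential with real periods, with labelled zeros:
`x₂` is the central zero, which is connected by horizontal trajectories to the two others, and
`x₂, x₃, x₁` follow each other counterclockwise around the origin. `A` and `B` are the lengths of
the trajectories that connect `x₂` with `x₃` and with `x₁`. -/
structure Curve where
  x₁ : ℂ
  x₂ : ℂ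
  x₃ : ℂ
  A : ℝ
  B : ℝ
  sum_eq_zero : x₁ + x₂ + x₃ = 0
  ne₁₂ : x₁ ≠ x₂
  ne₁₃ : x₁ ≠ x₃
  ne₂₃ : x₂ ≠ x₃
  realPeriods : RealPeriods (cubic x₁ x₂ x₃)
  trajectory_A : HorizontalTrajectory (cubic x₁ x₂ x₃) x₂ x₃ A
  trajectory_B : HorizontalTrajectory (cubic x₁ x₂ x₃) x₂ x₁ B
  counterclockwise : ∃ θ₁ θ₂ θ₃ : ℝ, θ₂ < θ₃ ∧ θ₃ < θ₁ ∧ θ₁ < θ₂ + 2 * Real.pi ∧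
    x₁ = ‖x₁‖ * Complex.exp (θ₁ * Complex.I) ∧
    x₂ = ‖x₂‖ * Complex.exp (θ₂ * Complex.I) ∧
    x₃ = ‖x₃‖ * Complex.exp (θ₃ * Complex.I)

/-- The choice of a representative modulo the rotations of all zeros by fifth roots of unity:
the argument of the central zero lies in `[0, 2π/5)` if `A ≤ B`, and, symmetrically under complex
conjugation (which exchanges `A` and `B`), in `(-2π/5, 0]` if `B < A`. -/
structure NormalizedCurve extends Curve where
  normalized_of_le : A ≤ B → 0 ≤ Complex.arg x₂ ∧ Complex.arg x₂ < 2 * Real.pi / 5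
  normalized_of_lt : B < A → -(2 * Real.pi / 5) < Complex.arg x₂ ∧ Complex.arg x₂ ≤ 0

/-- The topology of the space of normalized curves is that of the triples of zeros in `ℂ³`. -/
instance : TopologicalSpace NormalizedCurve :=
  TopologicalSpace.induced (fun c => (c.x₁, c.x₂, c.x₃)) inferInstance

/-- The modular discriminant `Δ₁`. -/
def Curve.discr (c : Curve) : ℂ :=
  ((c.x₁ - c.x₂) * (c.x₃ - c.x₁) * (c.x₃ - c.x₂)) ^ 2

/-- The branch of `arg Δ₁` given by twice the sum of the (principal) arguments of `x₃ - x₂`,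
`x₃ - x₁` and `x₂ - x₁`. -/
def Curve.argDiscr (c : Curve) : ℝ :=
  2 * (Complex.arg (c.x₃ - c.x₂) + Complex.arg (c.x₃ - c.x₁) + Complex.arg (c.x₂ - c.x₁))

/-- The approach to the boundary `A = 0`: the ratio `A / B` tends to `0`. -/
def toBoundaryA : Filter NormalizedCurve := comap (fun c => c.A / c.B) (𝓝 0)

/-- The approach to the boundary `B = 0`: the ratio `B / A` tends to `0`. -/
def toBoundaryB : Filter NormalizedCurve := comap (fun c => c.B / c.A) (𝓝 0)

end Boutroux

end

noncomputable section

namespace Boutroux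

/-! Write w, v, u for the arguments of x₂ − x₁, x₃ − x₁, x₃ − x₂. Real periods exclude collinear
zeros, so the zeros span a positively oriented triangle and w < v < u < w + π. Along a side ab with
opposite vertex z the half period is (b − a)² ∫ √(s(1−s)) √(z − x(s)) ds (`im_halfPeriod`). The
direction from x(s) to z turns from that at a to that at b, so the argument of this number lies in
an open interval given by w, v, u, and reality puts a multiple of π into the interval
(`exists_int_of_side`). The three integers so obtained leave three configurations
(`int_cases_of_tri`), each carried to one normal form by a cyclic relabelling; a rotation by a fifth
root of unity shifts all integers together and makes them standard. The normal form is the six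
inequalities `Ang`. If v − w → 0 they pinch w and v to 2π/5 and u to 13π/20; if u − v → 0 they pinch
v and u to 3π/5 and w to 7π/20.

It remains to link the normal form with the trajectories. Let Φ be the primitive of √q that vanishes
at x₃. Along a trajectory from x₃ one has Φ² = t², whereas on two rays from x₂ the imaginary part of
Φ starts from 0, a half period being real, and increases strictly. The trajectory is thus trapped in
the sector between the rays, cannot reach x₁, and if it ends at x₂ its length is |Φ(x₂)|
(`trajectory_from_third`). Hence the vertex singled out by the integers is the central zero, and
with a = |x₃ − x₂|, b = |x₂ − x₁| the lengths are A = a² √b S(a/b), B = b² √a S(b/a) for one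
increasing function S, `sideLen`. So A and B compare as a and b do, and (a/b)² ≤ 2A/B when a ≤ b; by
the sine law A/B → 0 forces v − w → 0 (`Central.angle_le`). Reflection gives the other boundary.

Finally, the half period along x₁x₃ shows that in the normal form arg x₂ lies in [0, 2π/5) if a ≤ b
and in (−2π/5, 0] if b ≤ a (`Central.center`). The normalization of a curve confines arg x₂ to the
same interval, so the rotation into normal form is trivial. For A = B both intervals apply, x₂ is
real, and the triangle is symmetric about the real axis. -/

/-- The point of the unit circle with argument `θ`. -/
def cis (θ : ℝ) : ℂ := Complex.exp (θ * Complex.I)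

/-! ### Points of the unit circle and angular sectors -/

lemma cis_add (a b : ℝ) : cis (a + b) = cis a * cis b := by
  simp only [cis, ← Complex.exp_add]; push_cast; ring_nf

lemma cis_zero : cis 0 = 1 := by simp [cis]

lemma cis_ne_zero (a : ℝ) : cis a ≠ 0 := Complex.exp_ne_zero _

lemma cis_re (a : ℝ) : (cis a).re = Real.cos a := by simp [cis, Complex.exp_ofReal_mul_I_re]

lemma cis_im (a : ℝ) : (cis a).im = Real.sin a := by simp [cis, Complex.exp_ofReal_mul_I_im]

lemma norm_cis (a : ℝ) : ‖cis a‖ = 1 := by simp [cis, Complex.norm_exp_ofReal_mul_I]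

lemma cis_mul_cis_neg (a : ℝ) : cis a * cis (-a) = 1 := by
  rw [← cis_add, add_neg_cancel, cis_zero]

lemma cis_neg_mul_cis (a : ℝ) : cis (-a) * cis a = 1 := by
  rw [mul_comm, cis_mul_cis_neg]

lemma cis_pi : cis Real.pi = -1 := by simp [cis, Complex.exp_pi_mul_I]

lemma cis_add_pi (a : ℝ) : cis (a + Real.pi) = -cis a := by rw [cis_add, cis_pi]; ring

lemma cis_sub_pi (a : ℝ) : cis (a - Real.pi) = -cis a := by
  have h := cis_add_pi (a - Real.pi)
  rw [sub_add_cancel] at h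
  rw [h, neg_neg]

lemma cis_add_two_pi (a : ℝ) : cis (a + 2 * Real.pi) = cis a := by
  rw [show a + 2 * Real.pi = a + Real.pi + Real.pi by ring, cis_add_pi, cis_add_pi, neg_neg]

lemma cis_inv (a : ℝ) : (cis a)⁻¹ = cis (-a) :=
  inv_eq_of_mul_eq_one_right (cis_mul_cis_neg a)

lemma cis_pow (a : ℝ) (n : ℕ) : cis a ^ n = cis (n * a) := by
  simp only [cis, ← Complex.exp_nat_mul]; push_cast; ring_nf

lemma conj_cis (a : ℝ) : (starRingEnd ℂ) (cis a) = cis (-a) := by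
  apply Complex.ext <;> simp [cis_re, cis_im]

lemma norm_mul_cis_arg (z : ℂ) : (‖z‖ : ℂ) * cis (Complex.arg z) = z :=
  Complex.norm_mul_exp_arg_mul_I z

lemma arg_mul_cis {ρ θ : ℝ} (hρ : 0 < ρ) (h1 : -Real.pi < θ) (h2 : θ ≤ Real.pi) :
    Complex.arg (ρ * cis θ) = θ := by
  rw [cis, Complex.exp_mul_I]
  exact Complex.arg_mul_cos_add_sin_mul_I hρ ⟨h1, h2⟩

/-- The open sector of nonzero complex numbers with an argument between `a` and `b`. -/
def sector (a b : ℝ) : Set ℂ := {z | ∃ ρ θ : ℝ, 0 < ρ ∧ a < θ ∧ θ < b ∧ z = ρ * cis θ}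

lemma im_mul_cis_mul_cis (ρ θ a : ℝ) : (ρ * cis θ * cis a).im = ρ * Real.sin (θ + a) := by
  rw [mul_assoc, ← cis_add, Complex.im_ofReal_mul, cis_im]

lemma sector_im_pos {a b : ℝ} {z : ℂ} (hab : b ≤ a + Real.pi) (hz : z ∈ sector a b) :
    0 < (z * cis (-a)).im := by
  obtain ⟨ρ, θ, hρ, h1, h2, rfl⟩ := hz
  rw [im_mul_cis_mul_cis]
  exact mul_pos hρ (Real.sin_pos_of_pos_of_lt_pi (by linarith) (by linarith))

lemma sector_im_neg {a b : ℝ} {z : ℂ} (hab : b ≤ a + Real.pi) (hz : z ∈ sector a b) :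
    (z * cis (-b)).im < 0 := by
  obtain ⟨ρ, θ, hρ, h1, h2, rfl⟩ := hz
  rw [im_mul_cis_mul_cis]
  exact mul_neg_of_pos_of_neg hρ (Real.sin_neg_of_neg_of_neg_pi_lt (by linarith) (by linarith))

/-- With an opening of at most π the sector is an intersection of two half planes. This linear
description is what lets sums and integrals inherit membership. -/
lemma mem_sector_of_im {a b : ℝ} {z : ℂ} (hab : a ≤ b) (_hab' : b ≤ a + Real.pi)
    (h1 : 0 < (z * cis (-a)).im) (h2 : (z * cis (-b)).im < 0) : z ∈ sector a b := by
  set y := z * cis (-a) with hy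
  have hzy : z = y * cis a := by rw [hy, mul_assoc, cis_neg_mul_cis, mul_one]
  have hy0 : y ≠ 0 := by rintro h; simp [h] at h1
  have hρ : 0 < ‖y‖ := norm_pos_iff.2 hy0
  have harg : 0 < Complex.arg y := by
    rcases (Complex.arg_nonneg_iff.2 h1.le).lt_or_eq with h | h
    · exact h
    · have := Complex.arg_eq_zero_iff.1 h.symm; linarith [this.2]
  have hpi : Complex.arg y < Real.pi := by
    refine lt_of_le_of_ne (Complex.arg_le_pi y) fun h => ?_
    have := Complex.arg_eq_pi_iff.1 h; linarith [this.2]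
  have hz : z = ‖y‖ * cis (Complex.arg y + a) := by
    rw [cis_add, ← mul_assoc, norm_mul_cis_arg, ← hzy]
  refine ⟨‖y‖, Complex.arg y + a, hρ, by linarith, ?_, hz⟩
  by_contra hcon
  rw [hz, im_mul_cis_mul_cis] at h2
  have := Real.sin_nonneg_of_nonneg_of_le_pi (x := Complex.arg y + a + -b) (by linarith)
    (by linarith)
  nlinarith

lemma ne_zero_of_mem_sector {a b : ℝ} {z : ℂ} (hz : z ∈ sector a b) : z ≠ 0 := by
  obtain ⟨ρ, θ, hρ, -, -, rfl⟩ := hz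
  exact mul_ne_zero (by exact_mod_cast hρ.ne') (cis_ne_zero _)

lemma sector_mono {a b c d : ℝ} (h1 : c ≤ a) (h2 : b ≤ d) : sector a b ⊆ sector c d := by
  rintro z ⟨ρ, θ, hρ, h3, h4, rfl⟩
  exact ⟨ρ, θ, hρ, by linarith, by linarith, rfl⟩

lemma add_mem_sector {a b P Q : ℝ} (hab : a < b) (hab' : b < a + Real.pi) (hP : 0 < P)
    (hQ : 0 < Q) : (P * cis a + Q * cis b : ℂ) ∈ sector a b := by
  refine mem_sector_of_im hab.le hab'.le ?_ ?_
  · rw [add_mul, Complex.add_im, im_mul_cis_mul_cis, im_mul_cis_mul_cis, add_neg_cancel,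
      Real.sin_zero, mul_zero, zero_add]
    exact mul_pos hQ (Real.sin_pos_of_pos_of_lt_pi (by linarith) (by linarith))
  · rw [add_mul, Complex.add_im, im_mul_cis_mul_cis, im_mul_cis_mul_cis, add_neg_cancel,
      Real.sin_zero, mul_zero, add_zero]
    exact mul_neg_of_pos_of_neg hP
      (Real.sin_neg_of_neg_of_neg_pi_lt (by linarith) (by linarith))

lemma mul_mem_sector {a b c d : ℝ} {z y : ℂ} (hz : z ∈ sector a b) (hy : y ∈ sector c d) :
    z * y ∈ sector (a + c) (b + d) := by
  obtain ⟨ρ, θ, hρ, h1, h2, rfl⟩ := hz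
  obtain ⟨σ, φ, hσ, h3, h4, rfl⟩ := hy
  refine ⟨ρ * σ, θ + φ, mul_pos hρ hσ, by linarith, by linarith, ?_⟩
  rw [cis_add]; push_cast; ring

lemma polar_mul_mem_sector {a b ρ θ : ℝ} {z : ℂ} (hρ : 0 < ρ) (hz : z ∈ sector a b) :
    ρ * cis θ * z ∈ sector (θ + a) (θ + b) := by
  obtain ⟨σ, φ, hσ, h3, h4, rfl⟩ := hz
  refine ⟨ρ * σ, θ + φ, mul_pos hρ hσ, by linarith, by linarith, ?_⟩
  rw [cis_add]; push_cast; ring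

lemma ofReal_mul_mem_sector {a b ρ : ℝ} {z : ℂ} (hρ : 0 < ρ) (hz : z ∈ sector a b) :
    (ρ : ℂ) * z ∈ sector a b := by
  have := polar_mul_mem_sector (θ := 0) hρ hz
  simpa [cis_zero] using this

lemma cis_mul_mem_sector {a b θ : ℝ} {z : ℂ} (hz : z ∈ sector a b) :
    cis θ * z ∈ sector (θ + a) (θ + b) := by
  have := polar_mul_mem_sector (θ := θ) one_pos hz
  simpa using this

lemma inv_mem_sector {a b : ℝ} {z : ℂ} (hz : z ∈ sector a b) : z⁻¹ ∈ sector (-b) (-a) := by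
  obtain ⟨σ, φ, hσ, h3, h4, rfl⟩ := hz
  refine ⟨σ⁻¹, -φ, inv_pos.2 hσ, by linarith, by linarith, ?_⟩
  rw [mul_inv, cis_inv]; push_cast; ring

lemma conj_mem_sector {a b : ℝ} {z : ℂ} (hz : z ∈ sector a b) :
    (starRingEnd ℂ) z ∈ sector (-b) (-a) := by
  obtain ⟨σ, φ, hσ, h3, h4, rfl⟩ := hz
  refine ⟨σ, -φ, hσ, by linarith, by linarith, ?_⟩
  rw [map_mul, conj_cis, Complex.conj_ofReal]

lemma sector_add_mem {a b : ℝ} {z y : ℂ} (hab : b ≤ a + Real.pi) (hz : z ∈ sector a b)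
    (hy : y ∈ sector a b) : z + y ∈ sector a b := by
  have hab0 : a ≤ b := by obtain ⟨_, θ, _, h1, h2, _⟩ := hz; linarith
  refine mem_sector_of_im hab0 hab ?_ ?_
  · rw [add_mul, Complex.add_im]
    linarith [sector_im_pos hab hz, sector_im_pos hab hy]
  · rw [add_mul, Complex.add_im]
    linarith [sector_im_neg hab hz, sector_im_neg hab hy]

lemma exists_int_of_mem_sector_of_im_eq_zero {a b : ℝ} {z : ℂ} (hz : z ∈ sector a b)
    (him : z.im = 0) : ∃ k : ℤ, a < k * Real.pi ∧ k * Real.pi < b := by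
  obtain ⟨σ, φ, hσ, h3, h4, rfl⟩ := hz
  have h : σ * Real.sin φ = 0 := by simpa [cis_im] using him
  rcases mul_eq_zero.1 h with h | h
  · exact absurd h hσ.ne'
  · obtain ⟨n, rfl⟩ := Real.sin_eq_zero_iff.1 h
    exact ⟨n, h3, h4⟩

/-! ### Branches of the square root -/

/-- The branch of the square root with arguments between `(κ - π) / 2` and `(κ + π) / 2`. -/
def sq (κ : ℝ) (z : ℂ) : ℂ := cis (κ / 2) * (z * cis (-κ)) ^ (2⁻¹ : ℂ)

lemma sq_sq (κ : ℝ) (z : ℂ) : sq κ z ^ 2 = z := by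
  rw [sq, mul_pow, Complex.cpow_ofNat_inv_pow, cis_pow, mul_left_comm, ← cis_add]
  have : ((2 : ℕ) : ℝ) * (κ / 2) + -κ = 0 := by push_cast; ring
  rw [this, cis_zero, mul_one]

lemma cpow_half_polar {ρ θ : ℝ} (hρ : 0 ≤ ρ) (h1 : -Real.pi < θ) (h2 : θ < Real.pi) :
    (ρ * cis θ) ^ (2⁻¹ : ℂ) = Real.sqrt ρ * cis (θ / 2) := by
  rcases hρ.eq_or_lt with rfl | hρ
  · simp
  · have h0 : (ρ * cis θ : ℂ) ≠ 0 := mul_ne_zero (by exact_mod_cast hρ.ne') (cis_ne_zero _)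
    rw [Complex.cpow_def_of_ne_zero h0, Complex.log, arg_mul_cis hρ h1 h2.le, norm_mul, norm_cis,
      Complex.norm_real, Real.norm_of_nonneg hρ.le, mul_one, add_mul, Complex.exp_add]
    congr 1
    · have : (Real.sqrt ρ : ℝ) = Real.exp (Real.log ρ * 2⁻¹) := by
        rw [Real.sqrt_eq_rpow, Real.rpow_def_of_pos hρ]; norm_num
      rw [this]; push_cast; ring_nf
    · rw [cis]; push_cast; ring_nf

lemma sq_polar {κ ρ θ : ℝ} (hρ : 0 ≤ ρ) (h1 : κ - Real.pi < θ) (h2 : θ < κ + Real.pi) :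
    sq κ (ρ * cis θ) = Real.sqrt ρ * cis (θ / 2) := by
  rw [sq, mul_assoc, ← cis_add, cpow_half_polar hρ (by linarith) (by linarith), mul_left_comm,
    ← cis_add]
  congr 2; ring

lemma sq_mem_sector {κ a b : ℝ} {z : ℂ} (h1 : κ - Real.pi ≤ a) (h2 : b ≤ κ + Real.pi)
    (hz : z ∈ sector a b) : sq κ z ∈ sector (a / 2) (b / 2) := by
  obtain ⟨σ, φ, hσ, h3, h4, rfl⟩ := hz
  rw [sq_polar hσ.le (by linarith) (by linarith)]
  exact ⟨_, _, Real.sqrt_pos.2 hσ, by linarith, by linarith, rfl⟩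

lemma sq_eq_sq {κ κ' a b : ℝ} {z : ℂ} (h1 : κ - Real.pi ≤ a) (h2 : b ≤ κ + Real.pi)
    (h1' : κ' - Real.pi ≤ a) (h2' : b ≤ κ' + Real.pi) (hz : z ∈ sector a b) :
    sq κ z = sq κ' z := by
  obtain ⟨σ, φ, hσ, h3, h4, rfl⟩ := hz
  rw [sq_polar hσ.le (by linarith) (by linarith), sq_polar hσ.le (by linarith) (by linarith)]

lemma norm_sq (κ : ℝ) (z : ℂ) : ‖sq κ z‖ = Real.sqrt ‖z‖ := by
  conv_rhs => rw [← sq_sq κ z, norm_pow]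
  rw [Real.sqrt_sq (norm_nonneg _)]

lemma sq_ofReal_mul {κ ρ : ℝ} (hρ : 0 ≤ ρ) (z : ℂ) : sq κ (ρ * z) = Real.sqrt ρ * sq κ z := by
  have h : ((ρ : ℂ)) ^ (2⁻¹ : ℂ) = Real.sqrt ρ := by
    simpa [cis_zero] using cpow_half_polar (θ := 0) hρ (by linarith [Real.pi_pos]) Real.pi_pos
  rcases hρ.eq_or_lt with rfl | hρ
  · simp [sq]
  rcases eq_or_ne z 0 with rfl | hz
  · simp [sq]
  have hz' : z * cis (-κ) ≠ 0 := mul_ne_zero hz (cis_ne_zero _)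
  have hρ' : (ρ : ℂ) ≠ 0 := by exact_mod_cast hρ.ne'
  rw [sq, sq, mul_assoc, Complex.cpow_def_of_ne_zero (mul_ne_zero hρ' hz'),
    Complex.log_ofReal_mul hρ hz', add_mul, Complex.exp_add, ← Complex.cpow_def_of_ne_zero hz',
    Complex.ofReal_log hρ.le, ← Complex.cpow_def_of_ne_zero hρ', h]
  ring

lemma continuousAt_sq {κ : ℝ} {z : ℂ} (hz : 0 ≤ (z * cis (-κ)).re) :
    ContinuousAt (sq κ) z := by
  have h : ContinuousAt (fun z : ℂ => z * cis (-κ)) z := by fun_prop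
  exact continuousAt_const.mul
    (ContinuousAt.comp (g := fun y : ℂ => y ^ (2⁻¹ : ℂ))
      (Complex.continuousAt_cpow_const_of_re_pos (Or.inl hz) (by norm_num)) h)

lemma hasDerivAt_sq {κ : ℝ} {z : ℂ} (hz : z * cis (-κ) ∈ Complex.slitPlane) :
    HasDerivAt (sq κ) (1 / (2 * sq κ z)) z := by
  have hz0 : z ≠ 0 := by
    rintro rfl
    simp at hz
  have hs0 : sq κ z ≠ 0 := by
    intro h
    have := sq_sq κ z
    rw [h] at this
    exact hz0 (by simpa using this.symm)
  have hd : DifferentiableAt ℂ (sq κ) z := by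
    unfold sq
    refine DifferentiableAt.const_mul ?_ _
    exact (DifferentiableAt.mul_const differentiableAt_id _).cpow_const hz
  have h1 := hd.hasDerivAt
  have h2 := h1.pow 2
  have h3 : HasDerivAt (fun z => z) (1 : ℂ) z := hasDerivAt_id z
  have h4 : (sq κ) ^ 2 = fun z => z := by
    funext y
    exact sq_sq κ y
  rw [h4] at h2
  have h5 := h2.unique h3
  have : deriv (sq κ) z = 1 / (2 * sq κ z) := by
    rw [eq_div_iff (mul_ne_zero two_ne_zero hs0), ← h5]
    push_cast
    ring
  rwa [this] at h1

lemma integral_mem_sector {a b : ℝ} {f : ℝ → ℂ} (hab : a ≤ b) (hab' : b ≤ a + Real.pi)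
    (hf : ContinuousOn f (Set.Icc 0 1)) (h : ∀ s ∈ Set.Ioo (0 : ℝ) 1, f s ∈ sector a b) :
    ∫ s in (0 : ℝ)..1, f s ∈ sector a b := by
  have key : ∀ c : ℂ, ((∫ s in (0 : ℝ)..1, f s) * c).im = ∫ s in (0 : ℝ)..1, (f s * c).im := by
    intro c
    have hi : IntervalIntegrable (fun s => f s * c) MeasureTheory.volume 0 1 :=
      (hf.mul continuousOn_const).intervalIntegrable_of_Icc zero_le_one
    rw [← intervalIntegral.integral_mul_const]
    exact (Complex.imCLM.intervalIntegral_comp_comm hi).symm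
  have hint : ∀ c : ℂ, ContinuousOn (fun s => (f s * c).im) (Set.Icc 0 1) := fun c =>
    Complex.continuous_im.comp_continuousOn (hf.mul continuousOn_const)
  refine mem_sector_of_im hab hab' ?_ ?_
  · rw [key]
    exact intervalIntegral.intervalIntegral_pos_of_pos_on
      ((hint _).intervalIntegrable_of_Icc zero_le_one)
      (fun s hs => sector_im_pos hab' (h s hs)) zero_lt_one
  · rw [key, ← neg_pos, ← intervalIntegral.integral_neg]
    exact intervalIntegral.intervalIntegral_pos_of_pos_on
      ((hint _).neg.intervalIntegrable_of_Icc zero_le_one)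
      (fun s hs => neg_pos.2 (sector_im_neg hab' (h s hs))) zero_lt_one

/-! ### Half periods along the segment between two zeros -/

/-- The weight `√(s (1 - s))`. -/
def wt (s : ℝ) : ℝ := Real.sqrt (s * (1 - s))

lemma continuous_wt : Continuous wt := by unfold wt; fun_prop

lemma wt_pos {s : ℝ} (hs : s ∈ Set.Ioo (0 : ℝ) 1) : 0 < wt s :=
  Real.sqrt_pos.2 (mul_pos hs.1 (by linarith [hs.2]))

lemma wt_nonneg (s : ℝ) : 0 ≤ wt s := Real.sqrt_nonneg _

/-- The integral of `√(s (1 - s)) σ(s)` over the unit interval. -/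
def wint (σ : ℝ → ℂ) : ℂ := ∫ s in (0 : ℝ)..1, (wt s : ℂ) * σ s

/-- A smooth path that runs through the unit interval from `0` to `1` and back. -/
def sweep (t : ℝ) : ℝ := (1 - Real.cos (2 * Real.pi * t)) / 2

lemma sweep_mem (t : ℝ) : sweep t ∈ Set.Icc (0 : ℝ) 1 := by
  have h1 := Real.neg_one_le_cos (2 * Real.pi * t)
  have h2 := Real.cos_le_one (2 * Real.pi * t)
  constructor <;> unfold sweep <;> linarith

lemma hasDerivAt_sweep (t : ℝ) :
    HasDerivAt sweep (Real.pi * Real.sin (2 * Real.pi * t)) t := by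
  have h1 : HasDerivAt (fun t : ℝ => 2 * Real.pi * t) (2 * Real.pi) t := by
    simpa using (hasDerivAt_id t).const_mul (2 * Real.pi)
  have h2 := ((h1.cos).const_sub 1).div_const 2
  exact h2.congr_deriv (by ring)

lemma contDiff_sweep : ContDiff ℝ 1 sweep := by
  unfold sweep
  exact (contDiff_const.sub (Real.contDiff_cos.comp (contDiff_const.mul contDiff_id))).div_const 2

lemma sweep_mul_one_sub (t : ℝ) : sweep t * (1 - sweep t) = (Real.sin (2 * Real.pi * t) / 2) ^ 2 := by
  have := Real.sin_sq_add_cos_sq (2 * Real.pi * t)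
  unfold sweep
  nlinarith

/-- The half period of `√q dx` along the segment between the zeros `a` and `b`. -/
lemma im_halfPeriod {q : ℂ → ℂ} (hq : RealPeriods q) {a b z : ℂ}
    (hqz : ∀ x, q x = (x - a) * (x - b) * (x - z)) {σ : ℝ → ℂ}
    (hσ : ContinuousOn σ (Set.Icc 0 1))
    (hσ2 : ∀ s ∈ Set.Icc (0 : ℝ) 1, σ s ^ 2 = z - (a + s * (b - a))) :
    ((b - a) ^ 2 * wint σ).im = 0 := by
  have hsc : Continuous sweep := contDiff_sweep.continuous
  have hσs : Continuous fun t => σ (sweep t) := hσ.comp_continuous hsc sweep_mem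
  -- The path runs from a to b and back. The sine in y and the derivative of x both change sign at t
  -- = 1/2, so the two halves contribute equally and y is a continuous lift.
  set x : ℝ → ℂ := fun t => a + sweep t * (b - a) with hx
  set y : ℝ → ℂ := fun t => (b - a) * (Real.sin (2 * Real.pi * t) / 2 : ℝ) * σ (sweep t) with hy
  have hdx : ∀ t, deriv x t = (Real.pi * Real.sin (2 * Real.pi * t) : ℝ) * (b - a) := fun t =>
    (((hasDerivAt_sweep t).ofReal_comp.mul_const (b - a)).const_add a).deriv
  have hs0 : sweep 0 = 0 := by simp [sweep]
  have hs1 : sweep 1 = 0 := by simp [sweep]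
  have hs2 : sweep (1 / 2) = 1 := by
    have : 2 * Real.pi * (1 / 2) = Real.pi := by ring
    rw [sweep, this, Real.cos_pi]; norm_num
  have h := hq x y ?_ ?_ ?_ ?_ ?_
  · set F : ℝ → ℂ := fun s => (wt s : ℂ) * σ s with hF
    have hFc : ContinuousOn F (Set.Icc 0 1) :=
      (Complex.continuous_ofReal.comp continuous_wt).continuousOn.mul hσ
    have himg : ∀ S : Set ℝ, ContinuousOn F (sweep '' S) := fun S =>
      hFc.mono (by rintro _ ⟨t, -, rfl⟩; exact sweep_mem t)
    have sub : ∀ c d : ℝ, ∫ t in c..d, (Real.pi * Real.sin (2 * Real.pi * t)) • F (sweep t) =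
        ∫ s in sweep c..sweep d, F s := fun c d =>
      intervalIntegral.integral_deriv_smul_comp'' hsc.continuousOn
        (fun t _ => (hasDerivAt_sweep t).hasDerivWithinAt) (by fun_prop) (himg _)
    have hc : Continuous fun t => y t * deriv x t := by
      simp only [hdx, hy]
      have h1 : Continuous fun t : ℝ => (Real.sin (2 * Real.pi * t) / 2 : ℝ) := by fun_prop
      have h2 : Continuous fun t : ℝ => Real.pi * Real.sin (2 * Real.pi * t) := by fun_prop
      exact ((continuous_const.mul (Complex.continuous_ofReal.comp h1)).mul hσs).mul
        ((Complex.continuous_ofReal.comp h2).mul continuous_const)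
    have hsplit := intervalIntegral.integral_add_adjacent_intervals
      (hc.intervalIntegrable (μ := MeasureTheory.volume) 0 (1 / 2))
      (hc.intervalIntegrable (μ := MeasureTheory.volume) (1 / 2) 1)
    have e1 : ∫ t in (0 : ℝ)..(1 / 2), y t * deriv x t = (b - a) ^ 2 * wint σ := by
      have : wint σ = ∫ s in sweep 0..sweep (1 / 2), F s := by rw [hs0, hs2]; rfl
      rw [this, ← sub, ← intervalIntegral.integral_const_mul]
      refine intervalIntegral.integral_congr fun t ht => ?_
      rw [Set.uIcc_of_le (by norm_num)] at ht
      have hsin : 0 ≤ Real.sin (2 * Real.pi * t) := by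
        apply Real.sin_nonneg_of_nonneg_of_le_pi
        · have := ht.1; positivity
        · nlinarith [ht.2, Real.pi_pos]
      have hw : wt (sweep t) = Real.sin (2 * Real.pi * t) / 2 := by
        rw [wt, sweep_mul_one_sub, Real.sqrt_sq (by linarith)]
      simp only [hdx, hy, hF, hw, Complex.real_smul]
      push_cast
      ring
    have e2 : ∫ t in (1 / 2 : ℝ)..1, y t * deriv x t = (b - a) ^ 2 * wint σ := by
      have : wint σ = -∫ s in sweep (1 / 2)..sweep 1, F s := by
        rw [hs1, hs2, intervalIntegral.integral_symm, neg_neg]; rfl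
      rw [this, ← sub, ← intervalIntegral.integral_neg, ← intervalIntegral.integral_const_mul]
      refine intervalIntegral.integral_congr fun t ht => ?_
      rw [Set.uIcc_of_le (by norm_num)] at ht
      have hsin : Real.sin (2 * Real.pi * t) ≤ 0 := by
        have : 0 ≤ Real.sin (2 * Real.pi * t - Real.pi) :=
          Real.sin_nonneg_of_nonneg_of_le_pi (by nlinarith [ht.1, Real.pi_pos])
            (by nlinarith [ht.2, Real.pi_pos])
        rw [Real.sin_sub_pi] at this
        linarith
      have hw : wt (sweep t) = -(Real.sin (2 * Real.pi * t) / 2) := by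
        rw [wt, sweep_mul_one_sub, ← neg_sq, Real.sqrt_sq (by linarith)]
      simp only [hdx, hy, hF, hw, Complex.real_smul]
      push_cast
      ring
    rw [← hsplit, e1, e2, Complex.add_im] at h
    linarith
  · exact contDiff_const.add ((Complex.ofRealCLM.contDiff.comp contDiff_sweep).mul contDiff_const)
  · exact (continuous_const.mul (by fun_prop)).mul hσs
  · intro t
    have h1 := hσ2 _ (sweep_mem t)
    have h2 := sweep_mul_one_sub t
    have h3 : (sweep t : ℂ) * (1 - sweep t) = ((Real.sin (2 * Real.pi * t) / 2 : ℝ) : ℂ) ^ 2 := by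
      rw [← Complex.ofReal_pow, ← h2]; push_cast; ring
    simp only [hqz, hy, hx]
    rw [mul_pow, mul_pow, h1, ← h3]
    ring
  · simp only [hx, hs0, hs1]
  · simp [hy, hs0, hs1]

/-! ### The primitive of √q at a simple zero, and its square along trajectories -/

/-- If `G² = q(x) / (x - e)`, then `(x - e)^{3/2}` times this integral is a primitive of `√q`. -/
def radialInt (G : ℂ → ℂ) (e x : ℂ) : ℂ :=
  ∫ s in (0 : ℝ)..1, (Real.sqrt s : ℂ) * G (e + s * (x - e))

lemma segment_point_mem {S : Set ℂ} (hS : Convex ℝ S) {e x : ℂ} (he : e ∈ S) (hx : x ∈ S) {s : ℝ}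
    (hs : s ∈ Set.Icc (0 : ℝ) 1) : e + s * (x - e) ∈ S := by
  have h := hS.add_smul_sub_mem he hx hs
  rwa [Complex.real_smul] at h

lemma continuousOn_segment_comp {S : Set ℂ} (hS : Convex ℝ S) {G : ℂ → ℂ}
    (hG : ContinuousOn G S) {e x : ℂ} (he : e ∈ S) (hx : x ∈ S) :
    ContinuousOn (fun s : ℝ => G (e + s * (x - e))) (Set.Icc 0 1) :=
  hG.comp (by fun_prop) fun _ hs => segment_point_mem hS he hx hs

lemma exists_bound_segment {S T : Set ℂ} (hS : Convex ℝ S) {G : ℂ → ℂ} (hG : ContinuousOn G S)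
    {e : ℂ} (he : e ∈ S) (hT : IsCompact T) (hTS : T ⊆ S) :
    ∃ C : ℝ, 0 ≤ C ∧ ∀ x ∈ T, ∀ s ∈ Set.Icc (0 : ℝ) 1, ‖G (e + s * (x - e))‖ ≤ C := by
  have hcomp : IsCompact (T ×ˢ Set.Icc (0 : ℝ) 1) := hT.prod isCompact_Icc
  have hcont : ContinuousOn (fun p : ℂ × ℝ => G (e + p.2 * (p.1 - e))) (T ×ˢ Set.Icc (0 : ℝ) 1) :=
    hG.comp (by fun_prop) fun p hp => segment_point_mem hS he (hTS hp.1) hp.2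
  obtain ⟨C, hC⟩ := hcomp.exists_bound_of_continuousOn hcont
  exact ⟨max C 0, le_max_right _ _, fun x hx s hs => (hC (x, s) ⟨hx, hs⟩).trans (le_max_left _ _)⟩

lemma continuousOn_radialInt_integrand {S : Set ℂ} (hS : Convex ℝ S) {G : ℂ → ℂ}
    (hG : ContinuousOn G S) {e x : ℂ} (he : e ∈ S) (hx : x ∈ S) :
    ContinuousOn (fun s : ℝ => (Real.sqrt s : ℂ) * G (e + s * (x - e))) (Set.Icc 0 1) :=
  (Complex.continuous_ofReal.comp Real.continuous_sqrt).continuousOn.mul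
    (continuousOn_segment_comp hS hG he hx)

lemma aestronglyMeasurable_uIoc_of_continuousOn {f : ℝ → ℂ} (hf : ContinuousOn f (Set.Icc 0 1)) :
    MeasureTheory.AEStronglyMeasurable f
      (MeasureTheory.volume.restrict (Set.uIoc (0 : ℝ) 1)) := by
  rw [Set.uIoc_of_le zero_le_one]
  exact (hf.mono Set.Ioc_subset_Icc_self).aestronglyMeasurable measurableSet_Ioc

lemma continuousOn_radialInt {S : Set ℂ} (hS : Convex ℝ S) (hSc : IsClosed S) {G : ℂ → ℂ}
    (hG : ContinuousOn G S) {e : ℂ} (he : e ∈ S) : ContinuousOn (radialInt G e) S := by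
  intro x hx
  have hT : IsCompact (S ∩ Metric.closedBall x 1) :=
    (isCompact_closedBall x 1).inter_left hSc
  obtain ⟨C, hC0, hC⟩ := exists_bound_segment hS hG he hT Set.inter_subset_left
  refine intervalIntegral.continuousWithinAt_of_dominated_interval (bound := fun _ => C) ?_ ?_
    (by simp) ?_
  · filter_upwards [self_mem_nhdsWithin] with y hy
    exact aestronglyMeasurable_uIoc_of_continuousOn
      (continuousOn_radialInt_integrand hS hG he hy)
  · filter_upwards [self_mem_nhdsWithin,
      mem_nhdsWithin_of_mem_nhds (Metric.closedBall_mem_nhds x one_pos)] with y hy hy'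
    refine Eventually.of_forall fun s hs => ?_
    rw [Set.uIoc_of_le zero_le_one] at hs
    have h1 := hC y ⟨hy, hy'⟩ s ⟨hs.1.le, hs.2⟩
    have h2 : ‖(Real.sqrt s : ℂ)‖ ≤ 1 := by
      rw [Complex.norm_real, Real.norm_of_nonneg (Real.sqrt_nonneg s)]
      exact Real.sqrt_le_one.2 hs.2
    rw [norm_mul]
    calc _ ≤ 1 * C := mul_le_mul h2 h1 (norm_nonneg _) zero_le_one
      _ = C := one_mul C
  · refine Eventually.of_forall fun s hs => ?_
    rw [Set.uIoc_of_le zero_le_one] at hs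
    refine continuousWithinAt_const.mul ?_
    have h1 : ContinuousWithinAt (fun y : ℂ => e + s * (y - e)) S x := by fun_prop
    exact ContinuousWithinAt.comp (t := S) (hG _ (segment_point_mem hS he hx ⟨hs.1.le, hs.2⟩)) h1
      fun y hy => segment_point_mem hS he hy ⟨hs.1.le, hs.2⟩

lemma hasDerivAt_mul_sqrt {s : ℝ} (hs : 0 < s) :
    HasDerivAt (fun s : ℝ => s * Real.sqrt s) (3 / 2 * Real.sqrt s) s := by
  have h := (hasDerivAt_id s).mul (Real.hasDerivAt_sqrt hs.ne')
  refine h.congr_deriv ?_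
  have h0 : Real.sqrt s ≠ 0 := (Real.sqrt_pos.2 hs).ne'
  have h1 : Real.sqrt s * Real.sqrt s = s := Real.mul_self_sqrt hs.le
  simp only [id]
  field_simp
  nlinarith

/-- The relation comes from integrating the s-derivative of s^{3/2} G(e + s(x − e)) over [0, 1]. It
says exactly that (x − e)^{3/2} `radialInt` has derivative (x − e)^{1/2} G. -/
lemma hasDerivAt_radialInt {D : Set ℂ} (hD : Convex ℝ D) (hDo : IsOpen D) {G : ℂ → ℂ}
    (hG : DifferentiableOn ℂ G D) {e x : ℂ} (he : e ∈ D) (hx : x ∈ D) :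
    ∃ K' : ℂ, HasDerivAt (radialInt G e) K' x ∧
      3 / 2 * radialInt G e x + (x - e) * K' = G x := by
  obtain ⟨ε, hε, hball⟩ := Metric.nhds_basis_closedBall.mem_iff.1 (hDo.mem_nhds hx)
  have hG' : ContinuousOn (deriv G) D := (hG.deriv hDo).continuousOn
  obtain ⟨C, hC0, hC⟩ := exists_bound_segment hD hG' he (isCompact_closedBall x ε) hball
  have hGd : ∀ y ∈ D, HasDerivAt G (deriv G y) y := fun y hy =>
    (hG.differentiableAt (hDo.mem_nhds hy)).hasDerivAt
  have hFc := fun y hy => continuousOn_radialInt_integrand hD hG.continuousOn he (x := y) hy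
  have hF'c : ContinuousOn (fun s : ℝ => (Real.sqrt s : ℂ) * (s * deriv G (e + s * (x - e))))
      (Set.Icc 0 1) :=
    (Complex.continuous_ofReal.comp Real.continuous_sqrt).continuousOn.mul
      (Complex.continuous_ofReal.continuousOn.mul (continuousOn_segment_comp hD hG' he hx))
  have key := intervalIntegral.hasDerivAt_integral_of_dominated_loc_of_deriv_le
    (μ := MeasureTheory.volume) (a := 0) (b := 1) (x₀ := x) (s := Metric.closedBall x ε)
    (F := fun y s => (Real.sqrt s : ℂ) * G (e + s * (y - e)))
    (F' := fun y s => (Real.sqrt s : ℂ) * (s * deriv G (e + s * (y - e)))) (bound := fun _ => C)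
    (Metric.closedBall_mem_nhds x hε) ?_ ((hFc x hx).intervalIntegrable_of_Icc zero_le_one)
    (aestronglyMeasurable_uIoc_of_continuousOn hF'c) ?_ (by simp) ?_
  · refine ⟨_, key.2, ?_⟩
    have ftc := intervalIntegral.integral_eq_sub_of_hasDerivAt_of_le (a := (0 : ℝ)) (b := 1)
      (f := fun s : ℝ => ((s * Real.sqrt s : ℝ) : ℂ) * G (e + s * (x - e)))
      (f' := fun s : ℝ => 3 / 2 * ((Real.sqrt s : ℂ) * G (e + s * (x - e))) +
        (x - e) * ((Real.sqrt s : ℂ) * (s * deriv G (e + s * (x - e))))) zero_le_one ?_ ?_ ?_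
    · rw [intervalIntegral.integral_add, intervalIntegral.integral_const_mul,
        intervalIntegral.integral_const_mul] at ftc
      · rw [radialInt, ftc]
        simp
      · exact (continuousOn_const.mul (hFc x hx)).intervalIntegrable_of_Icc zero_le_one
      · exact (continuousOn_const.mul hF'c).intervalIntegrable_of_Icc zero_le_one
    · exact (Complex.continuous_ofReal.comp
        (continuous_id.mul Real.continuous_sqrt)).continuousOn.mul
          (continuousOn_segment_comp hD hG.continuousOn he hx)
    · intro s hs
      have h1 : HasDerivAt (fun s : ℝ => e + s * (x - e)) (x - e) s := by
        simpa using (((hasDerivAt_id s).ofReal_comp).mul_const (x - e)).const_add e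
      have h2 := (hGd _ (segment_point_mem hD he hx ⟨hs.1.le, hs.2.le⟩)).comp_of_eq s h1 rfl
      have h3 := (hasDerivAt_mul_sqrt hs.1).ofReal_comp.mul h2
      refine h3.congr_deriv ?_
      simp only [Function.comp]
      push_cast
      ring
    · exact ((continuousOn_const.mul (hFc x hx)).add
        (continuousOn_const.mul hF'c)).intervalIntegrable_of_Icc zero_le_one
  · filter_upwards [hDo.mem_nhds hx] with y hy
    exact aestronglyMeasurable_uIoc_of_continuousOn (hFc y hy)
  · refine Eventually.of_forall fun s hs y hy => ?_
    rw [Set.uIoc_of_le zero_le_one] at hs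
    have h1 := hC y hy s ⟨hs.1.le, hs.2⟩
    have h2 : ‖(Real.sqrt s : ℂ)‖ ≤ 1 := by
      rw [Complex.norm_real, Real.norm_of_nonneg (Real.sqrt_nonneg s)]
      exact Real.sqrt_le_one.2 hs.2
    have h3 : ‖(s : ℂ)‖ ≤ 1 := by
      rw [Complex.norm_real, Real.norm_of_nonneg hs.1.le]
      exact hs.2
    rw [norm_mul, norm_mul]
    calc _ ≤ 1 * (1 * C) := by gcongr
      _ = C := by ring
  · refine Eventually.of_forall fun s hs y hy => ?_
    rw [Set.uIoc_of_le zero_le_one] at hs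
    have h1 : HasDerivAt (fun y : ℂ => e + s * (y - e)) s y := by
      simpa using (((hasDerivAt_id y).sub_const e).const_mul (s : ℂ)).const_add e
    have h2 := (hGd _ (segment_point_mem hD he (hball hy) ⟨hs.1.le, hs.2⟩)).comp_of_eq y h1 rfl
    refine (h2.const_mul (Real.sqrt s : ℂ)).congr_deriv ?_
    ring

/-- `W = Φ²`, where `Φ` is the primitive of `√q` that vanishes at the zero `e` of `q`. -/
def sqPrim (G : ℂ → ℂ) (e x : ℂ) : ℂ := (x - e) ^ 3 * radialInt G e x ^ 2

lemma hasDerivAt_branch {D : Set ℂ} (hD : Convex ℝ D) (hDo : IsOpen D) {G : ℂ → ℂ}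
    (hG : DifferentiableOn ℂ G D) {e x : ℂ} (he : e ∈ D) (hx : x ∈ D) {κ : ℝ}
    (hκ : (x - e) * cis (-κ) ∈ Complex.slitPlane) :
    HasDerivAt (fun y => sq κ (y - e) ^ 3 * radialInt G e y) (sq κ (x - e) * G x) x := by
  obtain ⟨K', hK', hrel⟩ := hasDerivAt_radialInt hD hDo hG he hx
  have h0 : HasDerivAt (fun y => y - e) 1 x := (hasDerivAt_id x).sub_const e
  have h1 : HasDerivAt (fun y => sq κ (y - e)) (1 / (2 * sq κ (x - e))) x :=
    (HasDerivAt.comp (h₂ := sq κ) x (hasDerivAt_sq hκ) h0).congr_deriv (mul_one _)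
  have h2 := (h1.pow 3).mul hK'
  refine h2.congr_deriv ?_
  have hne : sq κ (x - e) ≠ 0 := by
    intro h
    have h' := sq_sq κ (x - e)
    rw [h] at h'
    rw [← h'] at hκ
    simp at hκ
  have hsq := sq_sq κ (x - e)
  rw [← hrel]
  simp only [Pi.pow_apply]
  set r := sq κ (x - e)
  have h3 : r ^ 2 * (1 / (2 * r)) = r / 2 := by field_simp
  push_cast
  linear_combination (3 * radialInt G e x) * h3 + r * K' * hsq

/-- Each f' s is 1 or −1, and by Darboux a derivative that omits the value 0 keeps its sign.
Continuity of f' is not needed, which matters because a trajectory is only assumed differentiable.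
-/
lemma exists_affine_of_deriv_sq_eq_one {f f' : ℝ → ℂ} {a b : ℝ}
    (hf : ∀ s ∈ Set.Ioo a b, HasDerivAt f (f' s) s) (h1 : ∀ s ∈ Set.Ioo a b, f' s ^ 2 = 1) :
    ∃ ε : ℂ, ε ^ 2 = 1 ∧ ∀ s ∈ Set.Ioo a b, f' s = ε := by
  have hre : ∀ s ∈ Set.Ioo a b, HasDerivWithinAt (fun s => (f s).re) (f' s).re (Set.Ioo a b) s :=
    fun s hs => (Complex.reCLM.hasFDerivAt.comp_hasDerivAt s (hf s hs)).hasDerivWithinAt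
  have hval : ∀ s ∈ Set.Ioo a b, f' s = 1 ∨ f' s = -1 := fun s hs =>
    sq_eq_sq_iff_eq_or_eq_neg.1 (by rw [h1 s hs, one_pow])
  rcases hasDerivWithinAt_forall_lt_or_forall_gt_of_forall_ne (convex_Ioo a b) hre (m := 0)
    (fun s hs => by rcases hval s hs with h | h <;> simp [h]) with h | h
  · refine ⟨-1, by norm_num, fun s hs => (hval s hs).resolve_left fun h' => ?_⟩
    have := h s hs
    rw [h'] at this
    norm_num at this
  · refine ⟨1, by norm_num, fun s hs => (hval s hs).resolve_right fun h' => ?_⟩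
    have := h s hs
    rw [h'] at this
    norm_num at this

lemma sqPrim_eq_sq (G : ℂ → ℂ) (e x : ℂ) (κ : ℝ) :
    sqPrim G e x = (sq κ (x - e) ^ 3 * radialInt G e x) ^ 2 := by
  have h := sq_sq κ (x - e)
  rw [sqPrim]
  nth_rewrite 1 [← h]
  ring

/-- Along a horizontal trajectory that stays in `D`, `W` is locally `(t + c)²`. -/
lemma sqPrim_trajectory_local {D : Set ℂ} (hD : Convex ℝ D) (hDo : IsOpen D) {G q : ℂ → ℂ}
    (hG : DifferentiableOn ℂ G D) {e : ℂ} (he : e ∈ D)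
    (hq : ∀ x ∈ D, q x = (x - e) * G x ^ 2) {γ : ℝ → ℂ} {T : ℝ}
    (hγ : ∀ t ∈ Set.Ioo 0 T, ∃ d : ℂ, HasDerivAt γ d t ∧ q (γ t) * d ^ 2 = 1)
    (hγD : ∀ t ∈ Set.Ioo 0 T, γ t ∈ D) {t : ℝ} (ht : t ∈ Set.Ioo 0 T) :
    ∃ c : ℂ, (fun s => sqPrim G e (γ s)) =ᶠ[𝓝 t] fun s => ((s : ℂ) + c) ^ 2 := by
  choose! γ' hγ' hγq using hγ
  have hne : γ t - e ≠ 0 := by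
    intro h
    have := hγq t ht
    rw [hq _ (hγD t ht), h] at this
    simp at this
  set κ := Complex.arg (γ t - e) with hκ
  have hslit : (γ t - e) * cis (-κ) ∈ Complex.slitPlane := by
    rw [← norm_mul_cis_arg (γ t - e), ← hκ, mul_assoc, cis_mul_cis_neg, mul_one,
      Complex.ofReal_mem_slitPlane]
    exact norm_pos_iff.2 hne
  have hcont : ContinuousAt (fun s => (γ s - e) * cis (-κ)) t :=
    ((hγ' t ht).continuousAt.sub continuousAt_const).mul continuousAt_const
  have hev : ∀ᶠ s in 𝓝 t, (γ s - e) * cis (-κ) ∈ Complex.slitPlane ∧ s ∈ Set.Ioo 0 T :=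
    (hcont.eventually (Complex.isOpen_slitPlane.mem_nhds hslit)).and
      (isOpen_Ioo.mem_nhds ht)
  obtain ⟨ε, hε, hball⟩ := Metric.eventually_nhds_iff_ball.1 hev
  rw [Real.ball_eq_Ioo] at hball
  -- A local branch of Φ along γ; its derivative √q(γ) γ' has square 1.
  set f : ℝ → ℂ := fun s => sq κ (γ s - e) ^ 3 * radialInt G e (γ s) with hf
  have hfd : ∀ s ∈ Set.Ioo (t - ε) (t + ε),
      HasDerivAt f (sq κ (γ s - e) * G (γ s) * γ' s) s := fun s hs =>
    (hasDerivAt_branch hD hDo hG he (hγD s (hball s hs).2) (hball s hs).1).comp s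
      (hγ' s (hball s hs).2)
  obtain ⟨σ, hσ, hσf⟩ := exists_affine_of_deriv_sq_eq_one hfd fun s hs => by
    rw [mul_pow, mul_pow, sq_sq, ← hq _ (hγD s (hball s hs).2), hγq s (hball s hs).2]
  have hmem : t ∈ Set.Ioo (t - ε) (t + ε) := ⟨by linarith, by linarith⟩
  have hlin : ∀ s ∈ Set.Ioo (t - ε) (t + ε), f s - σ * s = f t - σ * t := by
    intro s hs
    have hd : ∀ s ∈ Set.Ioo (t - ε) (t + ε), HasDerivAt (fun s : ℝ => f s - σ * s) 0 s := by
      intro s hs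
      have h1 : HasDerivAt (fun s : ℝ => σ * (s : ℂ)) (σ * 1) s :=
        ((hasDerivAt_id s).ofReal_comp).const_mul σ
      refine ((hfd s hs).sub h1).congr_deriv ?_
      rw [hσf s hs]; ring
    exact isOpen_Ioo.is_const_of_deriv_eq_zero isPreconnected_Ioo
      (fun s hs => (hd s hs).differentiableAt.differentiableWithinAt)
      (fun s hs => (hd s hs).deriv) hs hmem
  refine ⟨σ * (f t - σ * t), ?_⟩
  filter_upwards [Ioo_mem_nhds hmem.1 hmem.2] with s hs
  rw [sqPrim_eq_sq G e (γ s) κ]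
  change f s ^ 2 = _
  have h1 : f s = σ * s + (f t - σ * t) := by linear_combination hlin s hs
  rw [h1]
  linear_combination (s ^ 2 - (f t - σ * t) ^ 2) * hσ

/-- The local constant c in W = (t + c)² cannot change along the interval, and W → 0 at the starting
zero gives c = 0. Working with W = Φ² avoids following a branch of Φ along the whole trajectory. -/
lemma sqPrim_trajectory {D : Set ℂ} (hD : Convex ℝ D) (hDo : IsOpen D) {G q : ℂ → ℂ}
    (hG : DifferentiableOn ℂ G D) {e : ℂ} (he : e ∈ D)
    (hq : ∀ x ∈ D, q x = (x - e) * G x ^ 2) {γ : ℝ → ℂ} {T : ℝ}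
    (hγ0 : γ 0 = e) (hγc : ContinuousWithinAt γ (Set.Ioi 0) 0)
    (hγ : ∀ t ∈ Set.Ioo 0 T, ∃ d : ℂ, HasDerivAt γ d t ∧ q (γ t) * d ^ 2 = 1)
    (hγD : ∀ t ∈ Set.Ioo 0 T, γ t ∈ D) {t : ℝ} (ht : t ∈ Set.Ioo 0 T) :
    sqPrim G e (γ t) = (t : ℂ) ^ 2 := by
  set Z : ℝ → ℂ := fun s => sqPrim G e (γ s) with hZ
  have hloc : ∀ s ∈ Set.Ioo 0 T, ∃ c : ℂ, Z =ᶠ[𝓝 s] fun s => ((s : ℂ) + c) ^ 2 := fun s hs =>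
    sqPrim_trajectory_local hD hDo hG he hq hγ hγD hs
  have hsq : ∀ (c : ℂ) (s : ℝ),
      HasDerivAt (fun s : ℝ => ((s : ℂ) + c) ^ 2) (2 * ((s : ℂ) + c)) s := by
    intro c s
    have h1 : HasDerivAt (fun s : ℝ => (s : ℂ) + c) 1 s := (hasDerivAt_id s).ofReal_comp.add_const c
    refine (h1.pow 2).congr_deriv ?_
    push_cast; ring
  -- Where Z = (s + c)² this quantity equals c, so it reads off the local constant.
  set N : ℝ → ℂ := fun s => deriv Z s / 2 - s with hN
  have hNloc : ∀ s ∈ Set.Ioo 0 T, ∃ c : ℂ, N =ᶠ[𝓝 s] (fun _ => c) ∧ Z s = (s + c) ^ 2 := by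
    intro s hs
    obtain ⟨c, hc⟩ := hloc s hs
    refine ⟨c, ?_, hc.self_of_nhds⟩
    filter_upwards [hc.deriv] with r hr
    simp only [hN, hr, (hsq c r).deriv]
    ring
  have hconst : ∀ s ∈ Set.Ioo 0 T, N s = N t := by
    intro s hs
    refine isOpen_Ioo.is_const_of_deriv_eq_zero (𝕜 := ℝ) isPreconnected_Ioo ?_ ?_ hs ht
    · intro r hr
      obtain ⟨c, hc, -⟩ := hNloc r hr
      exact ((differentiableAt_const c).congr_of_eventuallyEq hc).differentiableWithinAt
    · intro r hr
      obtain ⟨c, hc, -⟩ := hNloc r hr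
      rw [hc.deriv_eq]
      simp
  have hval : ∀ s ∈ Set.Ioo 0 T, Z s = (s + N t) ^ 2 := by
    intro s hs
    obtain ⟨c, hc, hz⟩ := hNloc s hs
    rw [hz, ← hconst s hs, hc.self_of_nhds]
  have hW0 : ContinuousAt (sqPrim G e) e := by
    obtain ⟨K', hK', -⟩ := hasDerivAt_radialInt hD hDo hG he he
    exact ((continuousAt_id.sub continuousAt_const).pow 3).mul (hK'.continuousAt.pow 2)
  have hlim1 : Tendsto Z (𝓝[>] 0) (𝓝 0) := by
    have h1 : Tendsto γ (𝓝[>] 0) (𝓝 e) := by rw [← hγ0]; exact hγc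
    have h2 : sqPrim G e e = 0 := by simp [sqPrim]
    have h3 : Tendsto (sqPrim G e) (𝓝 e) (𝓝 (sqPrim G e e)) := hW0
    rw [h2] at h3
    exact h3.comp h1
  have hlim2 : Tendsto Z (𝓝[>] 0) (𝓝 ((((0 : ℝ) : ℂ) + N t) ^ 2)) := by
    have h1 : Tendsto (fun s : ℝ => ((s : ℂ) + N t) ^ 2) (𝓝[>] 0)
        (𝓝 ((((0 : ℝ) : ℂ) + N t) ^ 2)) :=
      ((hsq (N t) 0).continuousAt.tendsto).mono_left nhdsWithin_le_nhds
    refine h1.congr' ?_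
    filter_upwards [Ioo_mem_nhdsGT (ht.1.trans ht.2)] with s hs
    exact (hval s hs).symm
  have h0 := tendsto_nhds_unique hlim1 hlim2
  have hNt : N t = 0 := by simpa using h0.symm
  have := hval t ht
  rw [hNt, add_zero] at this
  exact this

/-! ### The triangle of zeros and its reflection -/

/-- A positively oriented triangle with the arguments of its sides. -/
structure Tri (x₁ x₂ x₃ : ℂ) (w v u : ℝ) : Prop where
  wv : w < v
  vu : v < u
  uw : u < w + Real.pi
  side₁₂ : ∃ ρ : ℝ, 0 < ρ ∧ x₂ - x₁ = ρ * cis w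
  side₁₃ : ∃ ρ : ℝ, 0 < ρ ∧ x₃ - x₁ = ρ * cis v
  side₂₃ : ∃ ρ : ℝ, 0 < ρ ∧ x₃ - x₂ = ρ * cis u

/-- The inequalities between the arguments of the sides when `x₂` is the central zero and the
rotation is normalized. -/
structure Ang (w v u : ℝ) : Prop where
  h₁ : 2 * w + v / 2 < Real.pi
  h₂ : Real.pi < 2 * w + u / 2
  h₃ : 2 * v + u / 2 < 3 * Real.pi / 2
  h₄ : Real.pi < 2 * v + w / 2
  h₅ : 2 * u + w / 2 < 3 * Real.pi / 2
  h₆ : 3 * Real.pi / 2 < 2 * u + v / 2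

namespace Ang

variable {w v u : ℝ}

lemma lt_w (h : Ang w v u) : Real.pi / 3 < w := by linarith [h.h₂, h.h₅, Real.pi_pos]

lemma u_lt (h : Ang w v u) : u < 2 * Real.pi / 3 := by linarith [h.h₂, h.h₅, Real.pi_pos]

lemma w_lt (h : Ang w v u) (hwv : w < v) : w < 2 * Real.pi / 5 := by linarith [h.h₁]

lemma lt_u (h : Ang w v u) (hvu : v < u) : 3 * Real.pi / 5 < u := by linarith [h.h₆]

lemma lt_v (h : Ang w v u) (hwv : w < v) : 2 * Real.pi / 5 < v := by linarith [h.h₄]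

lemma v_lt (h : Ang w v u) (hvu : v < u) : v < 3 * Real.pi / 5 := by linarith [h.h₃]

end Ang

/-- Conjugation reverses the orientation and exchanging x₁ and x₃ restores it. This symmetry turns
every statement about the trajectory x₂x₃ into one about x₂x₁. -/
lemma Tri.conj {x₁ x₂ x₃ : ℂ} {w v u : ℝ} (T : Tri x₁ x₂ x₃ w v u) :
    Tri (starRingEnd ℂ x₃) (starRingEnd ℂ x₂) (starRingEnd ℂ x₁)
      (Real.pi - u) (Real.pi - v) (Real.pi - w) := by
  have key : ∀ {a b : ℂ} {θ : ℝ}, (∃ ρ : ℝ, 0 < ρ ∧ b - a = ρ * cis θ) →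
      ∃ ρ : ℝ, 0 < ρ ∧ starRingEnd ℂ a - starRingEnd ℂ b = ρ * cis (Real.pi - θ) := by
    rintro a b θ ⟨ρ, hρ, h⟩
    refine ⟨ρ, hρ, ?_⟩
    rw [show Real.pi - θ = -θ + Real.pi by ring, cis_add_pi, ← conj_cis, ← map_sub,
      show a - b = -(b - a) by ring, h, map_neg, map_mul, Complex.conj_ofReal]
    ring
  exact ⟨by linarith [T.vu], by linarith [T.wv], by linarith [T.uw], key T.side₂₃, key T.side₁₃,
    key T.side₁₂⟩

lemma Ang.conj {w v u : ℝ} (h : Ang w v u) : Ang (Real.pi - u) (Real.pi - v) (Real.pi - w) :=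
  ⟨by linarith [h.h₆], by linarith [h.h₅], by linarith [h.h₄], by linarith [h.h₃],
    by linarith [h.h₂], by linarith [h.h₁]⟩

lemma realPeriods_conj {x₁ x₂ x₃ : ℂ} (h : RealPeriods (cubic x₁ x₂ x₃)) :
    RealPeriods (cubic (starRingEnd ℂ x₃) (starRingEnd ℂ x₂) (starRingEnd ℂ x₁)) := by
  intro x y hx hy hxy h0 h1
  have hxd : ∀ t, HasDerivAt x (deriv x t) t := fun t =>
    (hx.differentiable one_ne_zero t).hasDerivAt
  have hd : ∀ t, deriv (fun t => starRingEnd ℂ (x t)) t = starRingEnd ℂ (deriv x t) := fun t =>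
    (Complex.conjCLE.toContinuousLinearMap.hasFDerivAt.comp_hasDerivAt t (hxd t)).deriv
  have hint := h (fun t => starRingEnd ℂ (x t)) (fun t => starRingEnd ℂ (y t))
    (Complex.conjCLE.contDiff.comp hx) (Complex.continuous_conj.comp hy) ?_ (by rw [h0])
    (by rw [h1])
  · simp only [hd, ← map_mul] at hint
    have hc : Continuous fun t => y t * deriv x t := hy.mul (hx.continuous_deriv le_rfl)
    have h2 := Complex.conjCLE.toContinuousLinearMap.intervalIntegral_comp_comm
      (hc.intervalIntegrable (μ := MeasureTheory.volume) 0 1)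
    have h3 : ∫ t in (0 : ℝ)..1, starRingEnd ℂ (y t * deriv x t) =
        starRingEnd ℂ (∫ t in (0 : ℝ)..1, y t * deriv x t) := h2
    rw [h3, Complex.conj_im] at hint
    linarith
  · intro t
    rw [← map_pow, hxy t]
    simp only [cubic, map_mul, map_sub, Complex.conj_conj]
    ring

lemma horizontalTrajectory_conj {x₁ x₂ x₃ p p' : ℂ} {L : ℝ}
    (h : HorizontalTrajectory (cubic x₁ x₂ x₃) p p' L) :
    HorizontalTrajectory (cubic (starRingEnd ℂ x₃) (starRingEnd ℂ x₂) (starRingEnd ℂ x₁))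
      (starRingEnd ℂ p) (starRingEnd ℂ p') L := by
  obtain ⟨hL, γ, hγc, h0, h1, hγ⟩ := h
  refine ⟨hL, fun t => starRingEnd ℂ (γ t), Complex.continuous_conj.comp_continuousOn hγc,
    congrArg _ h0, congrArg _ h1, fun t ht => ?_⟩
  obtain ⟨d, hd, hq⟩ := hγ t ht
  refine ⟨starRingEnd ℂ d,
    Complex.conjCLE.toContinuousLinearMap.hasFDerivAt.comp_hasDerivAt t hd, ?_⟩
  have := congrArg (starRingEnd ℂ) hq
  rw [map_one] at this
  rw [← this]
  simp only [cubic, map_mul, map_sub, map_pow]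
  ring

lemma horizontalTrajectory_symm {q : ℂ → ℂ} {p p' : ℂ} {L : ℝ}
    (h : HorizontalTrajectory q p p' L) : HorizontalTrajectory q p' p L := by
  obtain ⟨hL, γ, hγc, h0, h1, hγ⟩ := h
  refine ⟨hL, fun t => γ (L - t), ?_, by simpa using h1, by simpa using h0, fun t ht => ?_⟩
  · exact hγc.comp (by fun_prop) fun t ht => ⟨by linarith [ht.2], by linarith [ht.1]⟩
  · obtain ⟨d, hd, hq⟩ := hγ (L - t) ⟨by linarith [ht.2], by linarith [ht.1]⟩
    refine ⟨-d, ?_, by rw [neg_sq]; exact hq⟩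
    have h1 : HasDerivAt (fun t : ℝ => L - t) (-1) t := by
      simpa using (hasDerivAt_id t).const_sub L
    exact (HasDerivAt.scomp (g₁ := γ) t hd h1).congr_deriv (by simp)

/-! ### Trajectories from the third zero are trapped in a sector at the central zero -/

/-- The branch of `√((x - c) (x - e'))` that is used on the half plane with boundary point `c` and
inner normal `e^{2πi/3}`. -/
def outer (c e' x : ℂ) : ℂ := sq (2 * Real.pi / 3) (x - c) * sq (2 * Real.pi / 3) (x - e')

/-- The closed half plane with boundary point `c` and inner normal `e^{2πi/3}`. -/
def halfPlane (c : ℂ) : Set ℂ := {x | 0 ≤ ((x - c) * cis (-(2 * Real.pi / 3))).re}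

/-- The open half plane with boundary point `c` and inner normal `e^{2πi/3}`. -/
def openHalfPlane (c : ℂ) : Set ℂ := {x | 0 < ((x - c) * cis (-(2 * Real.pi / 3))).re}

lemma polar_mul_cis_re (ρ θ a : ℝ) : (ρ * cis θ * cis a).re = ρ * Real.cos (θ + a) := by
  rw [mul_assoc, ← cis_add, Complex.re_ofReal_mul, cis_re]

lemma isLinearMap_re_mul (d : ℂ) : IsLinearMap ℝ fun x : ℂ => (x * d).re :=
  ⟨fun x y => by simp only [add_mul, Complex.add_re], fun r x => by
    simp only [Complex.real_smul, mul_assoc, Complex.re_ofReal_mul, smul_eq_mul]⟩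

lemma convex_halfPlane (c : ℂ) : Convex ℝ (halfPlane c) := by
  have : halfPlane c = {x : ℂ | (c * cis (-(2 * Real.pi / 3))).re ≤
      (x * cis (-(2 * Real.pi / 3))).re} := by
    ext x
    simp only [halfPlane, Set.mem_ofPred_eq, sub_mul, Complex.sub_re, sub_nonneg]
  rw [this]
  exact convex_halfSpace_ge (isLinearMap_re_mul _) _

lemma convex_openHalfPlane (c : ℂ) : Convex ℝ (openHalfPlane c) := by
  have : openHalfPlane c = {x : ℂ | (c * cis (-(2 * Real.pi / 3))).re <
      (x * cis (-(2 * Real.pi / 3))).re} := by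
    ext x
    simp only [openHalfPlane, Set.mem_ofPred_eq, sub_mul, Complex.sub_re, sub_pos]
  rw [this]
  exact convex_halfSpace_gt (isLinearMap_re_mul _) _

lemma isClosed_halfPlane (c : ℂ) : IsClosed (halfPlane c) :=
  isClosed_le continuous_const (Complex.continuous_re.comp (by fun_prop))

lemma isOpen_openHalfPlane (c : ℂ) : IsOpen (openHalfPlane c) :=
  isOpen_lt continuous_const (Complex.continuous_re.comp (by fun_prop))

lemma openHalfPlane_subset (c : ℂ) : openHalfPlane c ⊆ halfPlane c := by
  intro x hx
  have h : 0 < ((x - c) * cis (-(2 * Real.pi / 3))).re := hx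
  exact h.le

section

variable {x₁ x₂ x₃ : ℂ} {w v u : ℝ}

/-- The direction w differs from 2π/3 by less than π/2, so x₁ lies strictly behind the boundary line
through x₂. Hence √(x − x₁) is holomorphic up to the boundary. -/
lemma re_pos_of_mem_halfPlane (T : Tri x₁ x₂ x₃ w v u) (A : Ang w v u) {x : ℂ}
    (hx : x ∈ halfPlane x₂) : 0 < ((x - x₁) * cis (-(2 * Real.pi / 3))).re := by
  obtain ⟨ρ, hρ, h⟩ := T.side₁₂
  have h1 : x - x₁ = (x - x₂) + ρ * cis w := by rw [← h]; ring
  rw [h1, add_mul, Complex.add_re, polar_mul_cis_re]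
  have h2 : 0 < Real.cos (w + -(2 * Real.pi / 3)) :=
    Real.cos_pos_of_mem_Ioo ⟨by linarith [A.lt_w, Real.pi_pos],
      by linarith [A.w_lt T.wv, Real.pi_pos]⟩
  have h3 : 0 ≤ ((x - x₂) * cis (-(2 * Real.pi / 3))).re := hx
  have := mul_pos hρ h2
  linarith

lemma continuousOn_outer (T : Tri x₁ x₂ x₃ w v u) (A : Ang w v u) :
    ContinuousOn (outer x₂ x₁) (halfPlane x₂) := by
  intro x hx
  refine ContinuousAt.continuousWithinAt ?_
  have h1 := continuousAt_sq (κ := 2 * Real.pi / 3) (z := x - x₂) hx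
  have h2 := continuousAt_sq (κ := 2 * Real.pi / 3) (z := x - x₁)
    (re_pos_of_mem_halfPlane T A hx).le
  exact (ContinuousAt.comp (f := fun x => x - x₂) h1 (by fun_prop)).mul
    (ContinuousAt.comp (f := fun x => x - x₁) h2 (by fun_prop))

lemma differentiableOn_outer (T : Tri x₁ x₂ x₃ w v u) (A : Ang w v u) :
    DifferentiableOn ℂ (outer x₂ x₁) (openHalfPlane x₂) := by
  intro x hx
  refine DifferentiableAt.differentiableWithinAt ?_
  have h1 := (hasDerivAt_sq (κ := 2 * Real.pi / 3) (z := x - x₂) (Or.inl hx)).differentiableAt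
  have h2 := (hasDerivAt_sq (κ := 2 * Real.pi / 3) (z := x - x₁)
    (Or.inl (re_pos_of_mem_halfPlane T A (openHalfPlane_subset _ hx)))).differentiableAt
  exact (DifferentiableAt.comp (f := fun x => x - x₂) x h1 (by fun_prop)).mul
    (DifferentiableAt.comp (f := fun x => x - x₁) x h2 (by fun_prop))

lemma cubic_eq_outer (x : ℂ) : cubic x₁ x₂ x₃ x = (x - x₃) * outer x₂ x₁ x ^ 2 := by
  rw [outer, mul_pow, sq_sq, sq_sq, cubic]; ring

lemma third_mem (T : Tri x₁ x₂ x₃ w v u) (A : Ang w v u) : x₃ ∈ openHalfPlane x₂ := by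
  obtain ⟨ρ, hρ, h⟩ := T.side₂₃
  rw [openHalfPlane, Set.mem_ofPred_eq, h, polar_mul_cis_re]
  exact mul_pos hρ (Real.cos_pos_of_mem_Ioo ⟨by linarith [A.lt_u T.vu, Real.pi_pos],
    by linarith [A.u_lt, Real.pi_pos]⟩)

/-- On the segment from x₃ to x₂ the factor √(x − x₂) contributes √(1 − s), which joins √s to form
the weight of a half period. -/
lemma radialInt_outer :
    radialInt (outer x₂ x₁) x₃ x₂ = sq (2 * Real.pi / 3) (x₃ - x₂) *
      wint fun s => sq (2 * Real.pi / 3) (x₃ + s * (x₂ - x₃) - x₁) := by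
  rw [radialInt, wint, ← intervalIntegral.integral_const_mul]
  refine intervalIntegral.integral_congr fun s hs => ?_
  rw [Set.uIcc_of_le zero_le_one] at hs
  have h1 : x₃ + s * (x₂ - x₃) - x₂ = ((1 - s : ℝ) : ℂ) * (x₃ - x₂) := by push_cast; ring
  have h2 : wt s = Real.sqrt s * Real.sqrt (1 - s) := by rw [wt, Real.sqrt_mul hs.1]
  simp only [outer, h1, sq_ofReal_mul (sub_nonneg.2 hs.2), h2]
  push_cast
  ring

lemma continuousOn_side (T : Tri x₁ x₂ x₃ w v u) (A : Ang w v u) :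
    ContinuousOn (fun s : ℝ => sq (2 * Real.pi / 3) (x₃ + s * (x₂ - x₃) - x₁))
      (Set.Icc 0 1) := by
  intro s hs
  refine ContinuousAt.continuousWithinAt ?_
  have hc : x₂ ∈ halfPlane x₂ := by simp [halfPlane]
  have h1 := re_pos_of_mem_halfPlane T A (segment_point_mem (convex_halfPlane x₂)
    (openHalfPlane_subset _ (third_mem T A)) hc hs)
  exact ContinuousAt.comp (f := fun s : ℝ => x₃ + s * (x₂ - x₃) - x₁) (continuousAt_sq h1.le)
    (by fun_prop)

/-- Up to sign, which depends on κ, the value Φ(x₂) is the half period along the side x₂x₃. -/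
lemma im_branch_center (T : Tri x₁ x₂ x₃ w v u) (A : Ang w v u)
    (hq : RealPeriods (cubic x₁ x₂ x₃)) (κ : ℝ) :
    (sq κ (x₂ - x₃) ^ 3 * radialInt (outer x₂ x₁) x₃ x₂).im = 0 := by
  set σ : ℝ → ℂ := fun s => sq (2 * Real.pi / 3) (x₃ + s * (x₂ - x₃) - x₁) with hσ
  have h1 := im_halfPeriod hq (a := x₃) (b := x₂) (z := x₁) (σ := fun s => Complex.I * σ s)
    (fun x => by rw [cubic]; ring) (continuousOn_const.mul (continuousOn_side T A))
    (fun s _ => by rw [mul_pow, Complex.I_sq, hσ, sq_sq]; ring)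
  have h2 : wint (fun s => Complex.I * σ s) = Complex.I * wint σ := by
    rw [wint, wint, ← intervalIntegral.integral_const_mul]
    congr 1; ext s; ring
  rw [h2] at h1
  -- A product of square roots of two opposite numbers, hence ± i (x₂ − x₃); the factor i matches
  -- the one in the half period, whose integrand is √(x₁ − x) rather than √(x − x₁).
  set m := sq κ (x₂ - x₃) * sq (2 * Real.pi / 3) (x₃ - x₂) with hm
  have hm2 : m ^ 2 = (Complex.I * (x₂ - x₃)) ^ 2 := by
    rw [hm, mul_pow, sq_sq, sq_sq, mul_pow, Complex.I_sq]; ring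
  have h3 : sq κ (x₂ - x₃) ^ 3 * radialInt (outer x₂ x₁) x₃ x₂ = (x₂ - x₃) * m * wint σ := by
    rw [radialInt_outer]
    linear_combination (m * wint σ) * sq_sq κ (x₂ - x₃)
  rw [h3]
  rcases sq_eq_sq_iff_eq_or_eq_neg.1 hm2 with h | h
  · rw [h, ← h1]; congr 1; ring
  · rw [h, ← neg_eq_zero, ← Complex.neg_im, ← h1]; congr 1; ring

lemma norm_sqPrim_center :
    ‖sqPrim (outer x₂ x₁) x₃ x₂‖ = (‖x₃ - x₂‖ ^ 2 *
      ‖wint fun s => sq (2 * Real.pi / 3) (x₃ + s * (x₂ - x₃) - x₁)‖) ^ 2 := by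
  rw [sqPrim, radialInt_outer, mul_pow, sq_sq, norm_mul, norm_mul, norm_pow, norm_pow,
    norm_sub_rev x₂ x₃]
  ring

/-- Along the ray Im Φ starts at 0 in x₂ and has positive derivative, so Φ is not real at later
points and Φ² is not the square of a real number. -/
lemma sqPrim_ne_sq_on_ray (T : Tri x₁ x₂ x₃ w v u) (A : Ang w v u)
    (hq : RealPeriods (cubic x₁ x₂ x₃)) {κ η : ℝ}
    (hη : 0 < Real.cos (η + -(2 * Real.pi / 3)))
    (hκ : ∀ ρ : ℝ, 0 ≤ ρ → 0 < ((x₂ + ρ * cis η - x₃) * cis (-κ)).re)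
    (him : ∀ ρ : ℝ, 0 < ρ →
      0 < (sq κ (x₂ + ρ * cis η - x₃) * outer x₂ x₁ (x₂ + ρ * cis η) * cis η).im)
    {ρ : ℝ} (hρ : 0 < ρ) (t : ℝ) : sqPrim (outer x₂ x₁) x₃ (x₂ + ρ * cis η) ≠ (t : ℂ) ^ 2 := by
  intro hcon
  set ray : ℝ → ℂ := fun r => x₂ + r * cis η with hray
  have hmem : ∀ r : ℝ, 0 < r → ray r ∈ openHalfPlane x₂ := by
    intro r hr
    rw [openHalfPlane, Set.mem_ofPred_eq, hray, add_sub_cancel_left, polar_mul_cis_re]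
    exact mul_pos hr hη
  have hmem' : ∀ r : ℝ, 0 ≤ r → ray r ∈ halfPlane x₂ := by
    intro r hr
    rw [halfPlane, Set.mem_ofPred_eq, hray, add_sub_cancel_left, polar_mul_cis_re]
    exact mul_nonneg hr hη.le
  set f : ℝ → ℂ := fun r => sq κ (ray r - x₃) ^ 3 * radialInt (outer x₂ x₁) x₃ (ray r) with hf
  have hrayd : ∀ r : ℝ, HasDerivAt ray (cis η) r := fun r =>
    (((hasDerivAt_id r).ofReal_comp.mul_const (cis η)).const_add x₂).congr_deriv (by simp)
  have hrayc : Continuous ray := by fun_prop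
  have hfd : ∀ r : ℝ, 0 < r →
      HasDerivAt f (sq κ (ray r - x₃) * outer x₂ x₁ (ray r) * cis η) r := fun r hr =>
    (hasDerivAt_branch (convex_openHalfPlane x₂) (isOpen_openHalfPlane x₂)
      (differentiableOn_outer T A) (third_mem T A) (hmem r hr) (Or.inl (hκ r hr.le))).comp r
      (hrayd r)
  have hfc : ContinuousOn f (Set.Icc 0 ρ) := by
    refine ContinuousOn.mul ?_ ?_
    · intro r hr
      refine ContinuousAt.continuousWithinAt (ContinuousAt.pow ?_ 3)
      exact ContinuousAt.comp (f := fun r => ray r - x₃) (continuousAt_sq (hκ r hr.1).le)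
        (by fun_prop)
    · exact (continuousOn_radialInt (convex_halfPlane x₂) (isClosed_halfPlane x₂)
        (continuousOn_outer T A) (openHalfPlane_subset _ (third_mem T A))).comp
        hrayc.continuousOn fun r hr => hmem' r hr.1
  have hmono : StrictMonoOn (fun r => (f r).im) (Set.Icc 0 ρ) := by
    refine strictMonoOn_of_deriv_pos (convex_Icc 0 ρ) (Complex.continuous_im.comp_continuousOn hfc)
      fun r hr => ?_
    rw [interior_Icc] at hr
    have h1 : HasDerivAt (fun r => (f r).im)
        (sq κ (ray r - x₃) * outer x₂ x₁ (ray r) * cis η).im r :=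
      Complex.imCLM.hasFDerivAt.comp_hasDerivAt r (hfd r hr.1)
    rw [h1.deriv]
    exact him r hr.1
  have h0 : (f 0).im = 0 := by
    have := im_branch_center T A hq κ
    simpa [hf, hray] using this
  have hpos := hmono ⟨le_rfl, hρ.le⟩ ⟨hρ.le, le_rfl⟩ hρ
  simp only [h0] at hpos
  have h2 : f ρ ^ 2 = (t : ℂ) ^ 2 := by
    rw [← hcon, sqPrim_eq_sq _ _ _ κ]
  rcases sq_eq_sq_iff_eq_or_eq_neg.1 h2 with h | h
  · rw [h] at hpos; simp at hpos
  · rw [h] at hpos; simp at hpos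

lemma im_pos_of_mem_sector {a b : ℝ} {z : ℂ} (ha : 0 ≤ a) (hb : b ≤ Real.pi)
    (hz : z ∈ sector a b) : 0 < z.im := by
  have := sector_im_pos (a := 0) (b := Real.pi) (by simp) (sector_mono ha hb hz)
  simpa [cis_zero] using this

lemma re_pos_of_mem_sector {a b κ : ℝ} {z : ℂ} (ha : κ - Real.pi / 2 ≤ a)
    (hb : b ≤ κ + Real.pi / 2) (hz : z ∈ sector a b) : 0 < (z * cis (-κ)).re := by
  obtain ⟨ρ, θ, hρ, h1, h2, rfl⟩ := hz
  rw [polar_mul_cis_re]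
  exact mul_pos hρ (Real.cos_pos_of_mem_Ioo ⟨by linarith, by linarith⟩)

lemma sector_sub_two_pi {a b : ℝ} {z : ℂ} (hz : z ∈ sector a b) :
    z ∈ sector (a - 2 * Real.pi) (b - 2 * Real.pi) := by
  obtain ⟨ρ, θ, hρ, h1, h2, rfl⟩ := hz
  refine ⟨ρ, θ - 2 * Real.pi, hρ, by linarith, by linarith, ?_⟩
  rw [← cis_add_two_pi (θ - 2 * Real.pi), sub_add_cancel]

/-- The arguments of the three square roots and of the direction π add up, modulo 2π, to an angle
between w/2 and (π + u)/2, hence between 0 and π. The branch angle κ = π + u/2 bisects the range [π,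
π + u] of directions from x₃. -/
lemma sqPrim_ne_sq_left (T : Tri x₁ x₂ x₃ w v u) (A : Ang w v u)
    (hq : RealPeriods (cubic x₁ x₂ x₃)) {ρ : ℝ} (hρ : 0 < ρ) (t : ℝ) :
    sqPrim (outer x₂ x₁) x₃ (x₂ + ρ * cis Real.pi) ≠ (t : ℂ) ^ 2 := by
  have hpi := Real.pi_pos
  have b1 := A.lt_w
  have b2 := A.w_lt T.wv
  have b3 := A.lt_u T.vu
  have b4 := A.u_lt
  obtain ⟨ρ₁, hρ₁, e1⟩ := T.side₁₂
  obtain ⟨ρ₃, hρ₃, e3⟩ := T.side₂₃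
  have s3 : ∀ r : ℝ, x₂ + r * cis Real.pi - x₃ = r * cis Real.pi + ρ₃ * cis (Real.pi + u) := by
    intro r
    rw [add_comm Real.pi u, cis_add_pi]
    linear_combination -e3
  have s1 : ∀ r : ℝ, x₂ + r * cis Real.pi - x₁ = ρ₁ * cis w + r * cis Real.pi := by
    intro r
    linear_combination e1
  refine sqPrim_ne_sq_on_ray T A hq (κ := Real.pi + u / 2) ?_ ?_ ?_ hρ t
  · exact Real.cos_pos_of_mem_Ioo ⟨by linarith, by linarith⟩
  · intro r hr
    rw [s3, add_mul, Complex.add_re, polar_mul_cis_re, polar_mul_cis_re]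
    have h1 : 0 < Real.cos (Real.pi + -(Real.pi + u / 2)) :=
      Real.cos_pos_of_mem_Ioo ⟨by linarith, by linarith⟩
    have h2 : 0 < Real.cos (Real.pi + u + -(Real.pi + u / 2)) :=
      Real.cos_pos_of_mem_Ioo ⟨by linarith, by linarith⟩
    have := mul_nonneg hr h1.le
    have := mul_pos hρ₃ h2
    linarith
  · intro r hr
    have m3 : sq (Real.pi + u / 2) (x₂ + r * cis Real.pi - x₃) ∈
        sector (Real.pi / 2) ((Real.pi + u) / 2) := by
      rw [s3]
      exact sq_mem_sector (by linarith) (by linarith)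
        (add_mem_sector (by linarith) (by linarith) hr hρ₃)
    have m1 : sq (2 * Real.pi / 3) (x₂ + r * cis Real.pi - x₁) ∈
        sector (w / 2) (Real.pi / 2) := by
      rw [s1]
      exact sq_mem_sector (by linarith) (by linarith)
        (add_mem_sector (by linarith) (by linarith) hρ₁ hr)
    have m2 : sq (2 * Real.pi / 3) (x₂ + r * cis Real.pi - x₂) =
        Real.sqrt r * cis (Real.pi / 2) := by
      rw [add_sub_cancel_left]
      exact sq_polar hr.le (by linarith) (by linarith)
    have m4 := polar_mul_mem_sector (θ := Real.pi / 2) (Real.sqrt_pos.2 hr) m1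
    have m5 := cis_mul_mem_sector (θ := Real.pi) (mul_mem_sector m3 m4)
    rw [outer, m2, mul_comm]
    exact im_pos_of_mem_sector (by linarith) (by linarith) (sector_sub_two_pi m5)

/-- Here the arguments add up to an angle between u/2 + π/6 and w/2 + 2π/3; the bound π/3 < w places
x − x₁ between the directions π/3 and w. The branch angle κ = u/2 − π/3 bisects u − π and π/3. -/
lemma sqPrim_ne_sq_right (T : Tri x₁ x₂ x₃ w v u) (A : Ang w v u)
    (hq : RealPeriods (cubic x₁ x₂ x₃)) {ρ : ℝ} (hρ : 0 < ρ) (t : ℝ) :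
    sqPrim (outer x₂ x₁) x₃ (x₂ + ρ * cis (Real.pi / 3)) ≠ (t : ℂ) ^ 2 := by
  have hpi := Real.pi_pos
  have b1 := A.lt_w
  have b2 := A.w_lt T.wv
  have b3 := A.lt_u T.vu
  have b4 := A.u_lt
  obtain ⟨ρ₁, hρ₁, e1⟩ := T.side₁₂
  obtain ⟨ρ₃, hρ₃, e3⟩ := T.side₂₃
  have s3 : ∀ r : ℝ, x₂ + r * cis (Real.pi / 3) - x₃ =
      ρ₃ * cis (u - Real.pi) + r * cis (Real.pi / 3) := by
    intro r
    rw [cis_sub_pi]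
    linear_combination -e3
  have s1 : ∀ r : ℝ, x₂ + r * cis (Real.pi / 3) - x₁ = r * cis (Real.pi / 3) + ρ₁ * cis w := by
    intro r
    linear_combination e1
  refine sqPrim_ne_sq_on_ray T A hq (κ := u / 2 - Real.pi / 3) ?_ ?_ ?_ hρ t
  · exact Real.cos_pos_of_mem_Ioo ⟨by linarith, by linarith⟩
  · intro r hr
    rw [s3, add_mul, Complex.add_re, polar_mul_cis_re, polar_mul_cis_re]
    have h1 : 0 < Real.cos (u - Real.pi + -(u / 2 - Real.pi / 3)) :=
      Real.cos_pos_of_mem_Ioo ⟨by linarith, by linarith⟩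
    have h2 : 0 < Real.cos (Real.pi / 3 + -(u / 2 - Real.pi / 3)) :=
      Real.cos_pos_of_mem_Ioo ⟨by linarith, by linarith⟩
    have := mul_nonneg hr h2.le
    have := mul_pos hρ₃ h1
    linarith
  · intro r hr
    have m3 : sq (u / 2 - Real.pi / 3) (x₂ + r * cis (Real.pi / 3) - x₃) ∈
        sector ((u - Real.pi) / 2) (Real.pi / 3 / 2) := by
      rw [s3]
      exact sq_mem_sector (by linarith) (by linarith)
        (add_mem_sector (by linarith) (by linarith) hρ₃ hr)
    have m1 : sq (2 * Real.pi / 3) (x₂ + r * cis (Real.pi / 3) - x₁) ∈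
        sector (Real.pi / 3 / 2) (w / 2) := by
      rw [s1]
      exact sq_mem_sector (by linarith) (by linarith)
        (add_mem_sector (by linarith) (by linarith) hr hρ₁)
    have m2 : sq (2 * Real.pi / 3) (x₂ + r * cis (Real.pi / 3) - x₂) =
        Real.sqrt r * cis (Real.pi / 3 / 2) := by
      rw [add_sub_cancel_left]
      exact sq_polar hr.le (by linarith) (by linarith)
    have m4 := polar_mul_mem_sector (θ := Real.pi / 3 / 2) (Real.sqrt_pos.2 hr) m1
    have m5 := cis_mul_mem_sector (θ := Real.pi / 3) (mul_mem_sector m3 m4)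
    rw [outer, m2, mul_comm]
    exact im_pos_of_mem_sector (by linarith) (by linarith) m5

end

section

variable {x₁ x₂ x₃ : ℂ} {w v u : ℝ}

/-- The open sector at `c` between the directions `e^{πi/3}` and `-1`. -/
def cone (c : ℂ) : Set ℂ := {x | 0 < (x - c).im ∧ 0 < ((x - c) * cis (-(Real.pi / 3))).im}

lemma isOpen_cone (c : ℂ) : IsOpen (cone c) :=
  (isOpen_lt continuous_const (Complex.continuous_im.comp (by fun_prop))).inter
    (isOpen_lt continuous_const (Complex.continuous_im.comp (by fun_prop)))

lemma cone_subset (c : ℂ) : cone c ⊆ openHalfPlane c := by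
  intro x hx
  have hx' : 0 < (x - c).im ∧ 0 < ((x - c) * cis (-(Real.pi / 3))).im := hx
  have hpi := Real.pi_pos
  have h : x - c ∈ sector (Real.pi / 3) Real.pi := by
    refine mem_sector_of_im (by linarith) (by linarith) hx'.2 ?_
    have : cis (-Real.pi) = -1 := by
      rw [← cis_pi, ← cis_add_two_pi (-Real.pi)]; congr 1; ring
    rw [this]
    simpa using hx'.1
  exact re_pos_of_mem_sector (by linarith) (by linarith) h

lemma third_mem_cone (T : Tri x₁ x₂ x₃ w v u) (A : Ang w v u) : x₃ ∈ cone x₂ := by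
  obtain ⟨ρ, hρ, h⟩ := T.side₂₃
  have hpi := Real.pi_pos
  have b3 := A.lt_u T.vu
  have b4 := A.u_lt
  refine ⟨?_, ?_⟩
  · rw [h, Complex.im_ofReal_mul, cis_im]
    exact mul_pos hρ (Real.sin_pos_of_pos_of_lt_pi (by linarith) (by linarith))
  · rw [h, im_mul_cis_mul_cis]
    exact mul_pos hρ (Real.sin_pos_of_pos_of_lt_pi (by linarith) (by linarith))

lemma mem_closure_of_left {S : Set ℂ} {γ : ℝ → ℂ} {L T : ℝ} (hT : 0 < T) (hTL : T ≤ L)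
    (hγ : ContinuousOn γ (Set.Icc 0 L)) (h : ∀ t ∈ Set.Ioo 0 T, γ t ∈ S) : γ T ∈ closure S := by
  have h1 : Tendsto γ (𝓝[Set.Ioo 0 T] T) (𝓝 (γ T)) :=
    (hγ T ⟨hT.le, hTL⟩).mono fun t ht => ⟨ht.1.le, ht.2.le.trans hTL⟩
  have : (𝓝[Set.Ioo 0 T] T).NeBot := right_nhdsWithin_Ioo_neBot hT
  exact mem_closure_of_tendsto h1 (by filter_upwards [self_mem_nhdsWithin] with t ht using h t ht)

lemma closure_cone_subset (c : ℂ) : closure (cone c) ⊆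
    {x | 0 ≤ (x - c).im ∧ 0 ≤ ((x - c) * cis (-(Real.pi / 3))).im} := by
  refine closure_minimal (fun x hx => ⟨?_, ?_⟩) ?_
  · exact le_of_lt (show 0 < _ from hx.1)
  · exact le_of_lt (show 0 < _ from hx.2)
  · exact (isClosed_le continuous_const (Complex.continuous_im.comp (by fun_prop))).inter
      (isClosed_le continuous_const (Complex.continuous_im.comp (by fun_prop)))

/-- W is continuous on the closed half plane, so the identity W = t² passes to the limit point. This
covers both a first exit from the sector and arrival at x₂, where the branch is not holomorphic. -/
lemma sqPrim_at_end (T : Tri x₁ x₂ x₃ w v u) (A : Ang w v u) {γ : ℝ → ℂ} {L t₀ : ℝ}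
    (hγc : ContinuousOn γ (Set.Icc 0 L)) (hγ0 : γ 0 = x₃)
    (hγ : ∀ t ∈ Set.Ioo 0 L, ∃ d : ℂ, HasDerivAt γ d t ∧ cubic x₁ x₂ x₃ (γ t) * d ^ 2 = 1)
    (ht₀ : 0 < t₀) (htL : t₀ ≤ L) (hcone : ∀ t ∈ Set.Ioo 0 t₀, γ t ∈ cone x₂) :
    sqPrim (outer x₂ x₁) x₃ (γ t₀) = (t₀ : ℂ) ^ 2 := by
  have hmem : γ t₀ ∈ halfPlane x₂ :=
    closure_minimal ((cone_subset x₂).trans (openHalfPlane_subset x₂)) (isClosed_halfPlane x₂)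
      (mem_closure_of_left ht₀ htL hγc hcone)
  have hval : ∀ t ∈ Set.Ioo 0 t₀, sqPrim (outer x₂ x₁) x₃ (γ t) = (t : ℂ) ^ 2 := fun t ht =>
    sqPrim_trajectory (convex_openHalfPlane x₂) (isOpen_openHalfPlane x₂)
      (differentiableOn_outer T A) (third_mem T A) (fun x _ => cubic_eq_outer x) hγ0
      ((hγc 0 ⟨le_rfl, ht₀.le.trans htL⟩).mono_of_mem_nhdsWithin
        (Icc_mem_nhdsGT (ht₀.trans_le htL)))
      (fun s hs => hγ s ⟨hs.1, hs.2.trans_le htL⟩) (fun s hs => cone_subset x₂ (hcone s hs)) ht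
  have hW : ContinuousOn (sqPrim (outer x₂ x₁) x₃) (halfPlane x₂) := by
    unfold sqPrim
    exact ContinuousOn.mul (by fun_prop) ((continuousOn_radialInt (convex_halfPlane x₂)
      (isClosed_halfPlane x₂) (continuousOn_outer T A)
      (openHalfPlane_subset _ (third_mem T A))).pow 2)
  have h1 : Tendsto γ (𝓝[Set.Ioo 0 t₀] t₀) (𝓝[halfPlane x₂] (γ t₀)) := by
    refine tendsto_nhdsWithin_iff.2 ⟨?_, ?_⟩
    · exact (hγc t₀ ⟨ht₀.le, htL⟩).mono fun t ht => ⟨ht.1.le, ht.2.le.trans htL⟩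
    · filter_upwards [self_mem_nhdsWithin] with t ht
      exact openHalfPlane_subset _ (cone_subset x₂ (hcone t ht))
  have h2 := (hW _ hmem).tendsto.comp h1
  have h3 : Tendsto (fun t : ℝ => (t : ℂ) ^ 2) (𝓝[Set.Ioo 0 t₀] t₀) (𝓝 ((t₀ : ℂ) ^ 2)) :=
    ((Complex.continuous_ofReal.pow 2).tendsto t₀).mono_left nhdsWithin_le_nhds
  have : (𝓝[Set.Ioo 0 t₀] t₀).NeBot := right_nhdsWithin_Ioo_neBot ht₀
  refine tendsto_nhds_unique h2 (h3.congr' ?_)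
  filter_upwards [self_mem_nhdsWithin] with t ht
  exact (hval t ht).symm

/-- At a first exit time the point lies on one of the two bounding rays, where W is never the square
of a real number. -/
lemma trajectory_mem_cone (T : Tri x₁ x₂ x₃ w v u) (A : Ang w v u)
    (hq : RealPeriods (cubic x₁ x₂ x₃)) {γ : ℝ → ℂ} {L : ℝ}
    (hγc : ContinuousOn γ (Set.Icc 0 L)) (hγ0 : γ 0 = x₃)
    (hγ : ∀ t ∈ Set.Ioo 0 L, ∃ d : ℂ, HasDerivAt γ d t ∧ cubic x₁ x₂ x₃ (γ t) * d ^ 2 = 1) :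
    ∀ t ∈ Set.Ioo 0 L, γ t ∈ cone x₂ := by
  intro t₁ ht₁
  by_contra hcon
  set B : Set ℝ := Set.Icc 0 t₁ ∩ γ ⁻¹' (cone x₂)ᶜ with hB
  have hBc : IsClosed B :=
    (hγc.mono (Set.Icc_subset_Icc_right ht₁.2.le)).preimage_isClosed_of_isClosed isClosed_Icc
      (isOpen_cone x₂).isClosed_compl
  have hBne : B.Nonempty := ⟨t₁, ⟨ht₁.1.le, le_rfl⟩, hcon⟩
  have hBb : BddBelow B := ⟨0, fun t ht => ht.1.1⟩
  set t₀ := sInf B with ht₀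
  have hmem : t₀ ∈ B := hBc.csInf_mem hBne hBb
  have hlt : ∀ t ∈ Set.Ioo 0 t₀, γ t ∈ cone x₂ := by
    intro t ht
    by_contra h
    exact absurd (csInf_le hBb ⟨⟨ht.1.le, ht.2.le.trans hmem.1.2⟩, h⟩) (not_le.2 ht.2)
  have hpos : 0 < t₀ := by
    refine lt_of_le_of_ne hmem.1.1 fun h => hmem.2 ?_
    rw [← h, hγ0]
    exact third_mem_cone T A
  have htL : t₀ < L := hmem.1.2.trans_lt ht₁.2
  have hend := sqPrim_at_end T A hγc hγ0 hγ hpos htL.le hlt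
  have hcl := closure_cone_subset _ (mem_closure_of_left hpos htL.le hγc hlt)
  obtain ⟨hi1, hi2⟩ : 0 ≤ (γ t₀ - x₂).im ∧ 0 ≤ ((γ t₀ - x₂) * cis (-(Real.pi / 3))).im := hcl
  -- The apex is excluded because q vanishes there, against q(γ) γ'² = 1.
  have hne : γ t₀ - x₂ ≠ 0 := by
    intro h
    obtain ⟨d, -, hd⟩ := hγ t₀ ⟨hpos, htL⟩
    rw [cubic, h] at hd
    simp at hd
  have hs3 : 0 < Real.sin (Real.pi / 3) :=
    Real.sin_pos_of_pos_of_lt_pi (by linarith [Real.pi_pos]) (by linarith [Real.pi_pos])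
  rcases hi1.eq_or_lt with h1 | h1
  · set X := (γ t₀ - x₂).re with hX
    have hXe : γ t₀ - x₂ = (X : ℂ) := Complex.ext (by simp [hX]) (by simp [← h1])
    rw [hXe, Complex.im_ofReal_mul, cis_im, Real.sin_neg] at hi2
    have hX0 : X ≠ 0 := by
      intro h
      rw [h] at hXe
      exact hne (by simpa using hXe)
    have hXn : X < 0 := lt_of_le_of_ne (by nlinarith) hX0
    refine sqPrim_ne_sq_left T A hq (ρ := -X) (by linarith) t₀ ?_
    rw [← hend]
    congr 1
    rw [cis_pi]
    push_cast
    linear_combination -hXe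
  · rcases hi2.eq_or_lt with h2 | h2
    · set Y := ((γ t₀ - x₂) * cis (-(Real.pi / 3))).re with hY
      have hYe : (γ t₀ - x₂) * cis (-(Real.pi / 3)) = (Y : ℂ) :=
        Complex.ext (by simp [hY]) (by simp [← h2])
      have hYe' : γ t₀ - x₂ = Y * cis (Real.pi / 3) := by
        rw [← hYe, mul_assoc, cis_neg_mul_cis, mul_one]
      rw [hYe', Complex.im_ofReal_mul, cis_im] at h1
      refine sqPrim_ne_sq_right T A hq (ρ := Y) (by nlinarith) t₀ ?_
      rw [← hend, ← hYe']
      congr 1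
      ring
    · exact hmem.2 ⟨h1, h2⟩

/-- A trajectory that leaves the zero `x₃` and ends at another zero ends at the central zero. -/
theorem trajectory_from_third (T : Tri x₁ x₂ x₃ w v u) (A : Ang w v u)
    (hq : RealPeriods (cubic x₁ x₂ x₃)) {p : ℂ} {L : ℝ} (hp : p = x₁ ∨ p = x₂)
    (h : HorizontalTrajectory (cubic x₁ x₂ x₃) x₃ p L) :
    p = x₂ ∧ L = ‖x₃ - x₂‖ ^ 2 *
      ‖wint fun s => sq (2 * Real.pi / 3) (x₃ + s * (x₂ - x₃) - x₁)‖ := by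
  obtain ⟨hL, γ, hγc, hγ0, hγL, hγ⟩ := h
  have hcone := trajectory_mem_cone T A hq hγc hγ0 hγ
  have hpe : p = x₂ := by
    refine hp.resolve_left fun h1 => ?_
    -- The closed sector lies in the half plane above x₂, whereas x₁ lies strictly below x₂ because
    -- sin w > 0.
    have hcl := closure_cone_subset _ (mem_closure_of_left hL le_rfl hγc hcone)
    obtain ⟨hi, -⟩ : 0 ≤ (γ L - x₂).im ∧ 0 ≤ ((γ L - x₂) * cis (-(Real.pi / 3))).im := hcl
    obtain ⟨ρ, hρ, hw⟩ := T.side₁₂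
    rw [hγL, h1, ← neg_sub, hw, Complex.neg_im, Complex.im_ofReal_mul, cis_im] at hi
    have hsin : 0 < Real.sin w := Real.sin_pos_of_pos_of_lt_pi
      (by linarith [A.lt_w, Real.pi_pos]) (by linarith [A.w_lt T.wv, Real.pi_pos])
    nlinarith [mul_pos hρ hsin]
  refine ⟨hpe, ?_⟩
  have hend := sqPrim_at_end T A hγc hγ0 hγ hL le_rfl hcone
  rw [hγL, hpe] at hend
  have hn := norm_sqPrim_center (x₁ := x₁) (x₂ := x₂) (x₃ := x₃)
  rw [hend, norm_pow, Complex.norm_real, Real.norm_of_nonneg hL.le] at hn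
  exact (sq_eq_sq₀ hL.le (by positivity)).1 hn

end

/-! ### Real half periods, the integers attached to the sides, and the normal form -/

lemma continuousOn_sq_segment {κ : ℝ} {P Q : ℂ} (hP : 0 ≤ (P * cis (-κ)).re)
    (hQ : 0 ≤ (Q * cis (-κ)).re) :
    ContinuousOn (fun s : ℝ => sq κ ((1 - s : ℝ) * P + (s : ℝ) * Q)) (Set.Icc 0 1) := by
  intro s hs
  refine ContinuousAt.continuousWithinAt ?_
  refine ContinuousAt.comp (f := fun s : ℝ => ((1 - s : ℝ) : ℂ) * P + (s : ℝ) * Q)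
    (continuousAt_sq ?_) (by fun_prop)
  rw [add_mul, Complex.add_re, mul_assoc, mul_assoc, Complex.re_ofReal_mul, Complex.re_ofReal_mul]
  exact add_nonneg (mul_nonneg (by linarith [hs.2]) hP) (mul_nonneg hs.1 hQ)

lemma wint_mem_sector {a b : ℝ} {σ : ℝ → ℂ} (hab : a ≤ b) (hab' : b ≤ a + Real.pi)
    (hσ : ContinuousOn σ (Set.Icc 0 1)) (h : ∀ s ∈ Set.Ioo (0 : ℝ) 1, σ s ∈ sector a b) :
    wint σ ∈ sector a b :=
  integral_mem_sector hab hab'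
    ((Complex.continuous_ofReal.comp continuous_wt).continuousOn.mul hσ)
    fun s hs => ofReal_mul_mem_sector (wt_pos hs) (h s hs)

/-- The half period along the side `a b` is real only if its direction is compatible with the
directions from the end points of the side to the third vertex. -/
lemma exists_int_of_side {q : ℂ → ℂ} (hq : RealPeriods q) {a b z : ℂ}
    (hqz : ∀ x, q x = (x - a) * (x - b) * (x - z)) {θ α β : ℝ}
    (hab : ∃ ρ : ℝ, 0 < ρ ∧ b - a = ρ * cis θ) (hza : ∃ ρ : ℝ, 0 < ρ ∧ z - a = ρ * cis α)
    (hzb : ∃ ρ : ℝ, 0 < ρ ∧ z - b = ρ * cis β) (h1 : α < β) (h2 : β < α + Real.pi) :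
    ∃ k : ℤ, 2 * θ + α / 2 < k * Real.pi ∧ k * Real.pi < 2 * θ + β / 2 := by
  obtain ⟨ρ, hρ, e⟩ := hab
  obtain ⟨P, hP, eP⟩ := hza
  obtain ⟨Q, hQ, eQ⟩ := hzb
  set κ := (α + β) / 2 with hκ
  set σ : ℝ → ℂ := fun s => sq κ ((1 - s : ℝ) * (z - a) + (s : ℝ) * (z - b)) with hσ
  have hpos : ∀ r φ : ℝ, 0 < r → α ≤ φ → φ ≤ β → 0 ≤ ((r * cis φ : ℂ) * cis (-κ)).re := by
    intro r φ hr ha hb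
    rw [polar_mul_cis_re]
    exact mul_nonneg hr.le (Real.cos_nonneg_of_mem_Icc ⟨by linarith, by linarith⟩)
  have hσc : ContinuousOn σ (Set.Icc 0 1) := by
    refine continuousOn_sq_segment ?_ ?_
    · rw [eP]; exact hpos P α hP le_rfl h1.le
    · rw [eQ]; exact hpos Q β hQ h1.le le_rfl
  have hreal := im_halfPeriod hq hqz hσc (fun s _ => by
    rw [hσ, sq_sq]; push_cast; ring)
  -- The vector from the side to z is a positive combination of its two end values, so its root has
  -- argument between α/2 and β/2, and so has the weighted integral.
  have hsec : wint σ ∈ sector (α / 2) (β / 2) := by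
    refine wint_mem_sector (by linarith) (by linarith) hσc fun s hs => ?_
    refine sq_mem_sector (by linarith) (by linarith) ?_
    rw [eP, eQ, ← mul_assoc, ← mul_assoc, ← Complex.ofReal_mul, ← Complex.ofReal_mul]
    exact add_mem_sector h1 h2 (mul_pos (by linarith [hs.2]) hP) (mul_pos hs.1 hQ)
  have hba : (b - a) ^ 2 = ((ρ ^ 2 : ℝ) : ℂ) * cis (2 * θ) := by
    rw [e, mul_pow, cis_pow]; push_cast; ring
  rw [hba] at hreal
  exact exists_int_of_mem_sector_of_im_eq_zero
    (polar_mul_mem_sector (pow_pos hρ 2) hsec) hreal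

lemma polar_neg {a b : ℂ} {θ : ℝ} (h : ∃ ρ : ℝ, 0 < ρ ∧ b - a = ρ * cis θ) :
    ∃ ρ : ℝ, 0 < ρ ∧ a - b = ρ * cis (θ + Real.pi) := by
  obtain ⟨ρ, hρ, e⟩ := h
  exact ⟨ρ, hρ, by rw [cis_add_pi]; linear_combination -e⟩

lemma polar_neg' {a b : ℂ} {θ : ℝ} (h : ∃ ρ : ℝ, 0 < ρ ∧ b - a = ρ * cis θ) :
    ∃ ρ : ℝ, 0 < ρ ∧ a - b = ρ * cis (θ - Real.pi) := by
  obtain ⟨ρ, hρ, e⟩ := h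
  exact ⟨ρ, hρ, by rw [cis_sub_pi]; linear_combination -e⟩

section

variable {x₁ x₂ x₃ : ℂ} {w v u : ℝ}

lemma Tri.cycle (T : Tri x₁ x₂ x₃ w v u) : Tri x₂ x₃ x₁ u (w + Real.pi) (v + Real.pi) :=
  ⟨T.uw, by linarith [T.wv], by linarith [T.vu], T.side₂₃, polar_neg T.side₁₂, polar_neg T.side₁₃⟩

lemma cubic_cycle (x₁ x₂ x₃ : ℂ) : cubic x₂ x₃ x₁ = cubic x₁ x₂ x₃ := by
  funext x; rw [cubic, cubic]; ring

lemma Tri.rotate (T : Tri x₁ x₂ x₃ w v u) (φ : ℝ) :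
    Tri (cis φ * x₁) (cis φ * x₂) (cis φ * x₃) (w + φ) (v + φ) (u + φ) := by
  have key : ∀ {a b : ℂ} {θ : ℝ}, (∃ ρ : ℝ, 0 < ρ ∧ b - a = ρ * cis θ) →
      ∃ ρ : ℝ, 0 < ρ ∧ cis φ * b - cis φ * a = ρ * cis (θ + φ) := by
    rintro a b θ ⟨ρ, hρ, e⟩
    exact ⟨ρ, hρ, by rw [cis_add]; linear_combination cis φ * e⟩
  exact ⟨by linarith [T.wv], by linarith [T.vu], by linarith [T.uw], key T.side₁₂, key T.side₁₃,
    key T.side₂₃⟩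

lemma cubic_rotate (ε x : ℂ) :
    cubic (ε * x₁) (ε * x₂) (ε * x₃) (ε * x) = ε ^ 3 * cubic x₁ x₂ x₃ x := by
  rw [cubic, cubic]; ring

/-- The map (x, y) ↦ (ε⁻¹x, εy) carries the rotated curve to the original one, since ε² = ε⁻³, and
it preserves y dx. -/
lemma realPeriods_rotate {ε : ℂ} (hε : ε ^ 5 = 1) (h : RealPeriods (cubic x₁ x₂ x₃)) :
    RealPeriods (cubic (ε * x₁) (ε * x₂) (ε * x₃)) := by
  intro x y hx hy hxy h0 h1
  have hε0 : ε ≠ 0 := by rintro rfl; norm_num at hε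
  have hd : ∀ t, deriv (fun t => ε⁻¹ * x t) t = ε⁻¹ * deriv x t := fun t =>
    ((hx.differentiable one_ne_zero t).hasDerivAt.const_mul ε⁻¹).deriv
  have hx' : ContDiff ℝ 1 fun t => ε⁻¹ * x t := contDiff_const.mul hx
  have := h (fun t => ε⁻¹ * x t) (fun t => ε * y t) hx'
    (continuous_const.mul hy) ?_ (by rw [h0]) (by rw [h1])
  · refine (congrArg Complex.im (intervalIntegral.integral_congr fun t _ => ?_)).trans this
    simp only [hd]
    field_simp
  · intro t
    have e := cubic_rotate (x₁ := x₁) (x₂ := x₂) (x₃ := x₃) ε (ε⁻¹ * x t)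
    rw [mul_inv_cancel_left₀ hε0] at e
    rw [mul_pow, hxy, e, ← mul_assoc, ← pow_add, hε, one_mul]

lemma horizontalTrajectory_rotate {ε : ℂ} (hε : ε ^ 5 = 1) {p p' : ℂ} {L : ℝ}
    (h : HorizontalTrajectory (cubic x₁ x₂ x₃) p p' L) :
    HorizontalTrajectory (cubic (ε * x₁) (ε * x₂) (ε * x₃)) (ε * p) (ε * p') L := by
  obtain ⟨hL, γ, hγc, h0, h1, hγ⟩ := h
  refine ⟨hL, fun t => ε * γ t, continuousOn_const.mul hγc, congrArg _ h0, congrArg _ h1,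
    fun t ht => ?_⟩
  obtain ⟨d, hd, hq⟩ := hγ t ht
  refine ⟨ε * d, hd.const_mul ε, ?_⟩
  rw [cubic_rotate, ← hq]
  linear_combination (cubic x₁ x₂ x₃ (γ t) * d ^ 2) * hε

lemma exists_int_of_tri (T : Tri x₁ x₂ x₃ w v u) (hq : RealPeriods (cubic x₁ x₂ x₃)) :
    ∃ k₁ k₂ k₃ : ℤ, (2 * w + v / 2 < k₁ * Real.pi ∧ k₁ * Real.pi < 2 * w + u / 2) ∧
      (2 * v + (u - Real.pi) / 2 < k₂ * Real.pi ∧ k₂ * Real.pi < 2 * v + w / 2) ∧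
      (2 * u + (w + Real.pi) / 2 < k₃ * Real.pi ∧ k₃ * Real.pi < 2 * u + (v + Real.pi) / 2) := by
  have hpi := Real.pi_pos
  have h1 := T.wv
  have h2 := T.vu
  have h3 := T.uw
  obtain ⟨k₁, hk₁⟩ := exists_int_of_side hq (a := x₁) (b := x₂) (z := x₃) (fun x => rfl)
    T.side₁₂ T.side₁₃ T.side₂₃ h2 (by linarith)
  obtain ⟨k₂, hk₂⟩ := exists_int_of_side hq (a := x₃) (b := x₁) (z := x₂)
    (fun x => by rw [cubic]; ring) (polar_neg T.side₁₃) (polar_neg' T.side₂₃) T.side₁₂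
    (by linarith) (by linarith)
  obtain ⟨k₃, hk₃⟩ := exists_int_of_side hq (a := x₂) (b := x₃) (z := x₁)
    (fun x => by rw [cubic]; ring) T.side₂₃ (polar_neg T.side₁₂) (polar_neg T.side₁₃)
    (by linarith) (by linarith)
  -- The side from x₃ to x₁ has direction v + π, and its double contributes the extra 2π.
  refine ⟨k₁, k₂ - 2, k₃, hk₁, ?_, hk₃⟩
  push_cast
  constructor <;> linarith [hk₂.1, hk₂.2]

lemma int_lt_of_mul_pi_lt {m n : ℤ} (h : (m : ℝ) * Real.pi < n * Real.pi) : m < n := by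
  exact_mod_cast lt_of_mul_lt_mul_right h Real.pi_pos.le

/-- Comparing the intervals gives k₂ − k₁ ∈ {0, 1} and k₃ − k₁ ∈ {1, 2}. The fourth combination
would give 2u + (w + π)/2 < 2v + w/2, against v < u. -/
lemma int_cases_of_tri (T : Tri x₁ x₂ x₃ w v u) {k₁ k₂ k₃ : ℤ}
    (h₁ : 2 * w + v / 2 < k₁ * Real.pi ∧ k₁ * Real.pi < 2 * w + u / 2)
    (h₂ : 2 * v + (u - Real.pi) / 2 < k₂ * Real.pi ∧ k₂ * Real.pi < 2 * v + w / 2)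
    (h₃ : 2 * u + (w + Real.pi) / 2 < k₃ * Real.pi ∧ k₃ * Real.pi < 2 * u + (v + Real.pi) / 2) :
    (k₂ = k₁ ∧ k₃ = k₁ + 1) ∨ (k₂ = k₁ ∧ k₃ = k₁ + 2) ∨ (k₂ = k₁ + 1 ∧ k₃ = k₁ + 2) := by
  have hpi := Real.pi_pos
  have g1 := T.wv
  have g2 := T.vu
  have g3 := T.uw
  obtain ⟨h11, h12⟩ := h₁
  obtain ⟨h21, h22⟩ := h₂
  obtain ⟨h31, h32⟩ := h₃
  have a1 : k₂ < k₁ + 2 := int_lt_of_mul_pi_lt (by push_cast; linarith)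
  have a2 : k₁ - 1 < k₂ := int_lt_of_mul_pi_lt (by push_cast; linarith)
  have a3 : k₃ < k₁ + 3 := int_lt_of_mul_pi_lt (by push_cast; linarith)
  have a4 : k₁ < k₃ := int_lt_of_mul_pi_lt (by linarith)
  have a5 : ¬(k₂ = k₁ + 1 ∧ k₃ = k₁ + 1) := by
    rintro ⟨rfl, rfl⟩
    push_cast at *
    linarith
  omega

/-- The three zeros have real periods, a common rotation has been carried out, and `x₂` is the
central zero. -/
structure Central (x₁ x₂ x₃ : ℂ) (w v u : ℝ) : Prop where
  tri : Tri x₁ x₂ x₃ w v u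
  ang : Ang w v u
  real : RealPeriods (cubic x₁ x₂ x₃)

lemma cis_fifth_pow (n : ℤ) : cis (2 * Real.pi * n / 5) ^ 5 = 1 := by
  rw [cis_pow, cis, Complex.exp_eq_one_iff]
  exact ⟨n, by push_cast; ring⟩

lemma central_of_int (T : Tri x₁ x₂ x₃ w v u) (hq : RealPeriods (cubic x₁ x₂ x₃)) {k : ℤ}
    (h₁ : 2 * w + v / 2 < k * Real.pi ∧ k * Real.pi < 2 * w + u / 2)
    (h₂ : 2 * v + (u - Real.pi) / 2 < k * Real.pi ∧ k * Real.pi < 2 * v + w / 2)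
    (h₃ : 2 * u + (w + Real.pi) / 2 < (k + 1 : ℤ) * Real.pi ∧
      (k + 1 : ℤ) * Real.pi < 2 * u + (v + Real.pi) / 2) :
    ∃ (n : ℤ) (w' v' u' : ℝ), Central (cis (2 * Real.pi * n / 5) * x₁)
      (cis (2 * Real.pi * n / 5) * x₂) (cis (2 * Real.pi * n / 5) * x₃) w' v' u' := by
  -- A rotation by 2πn/5 adds (2 + 1/2) · 2πn/5 = nπ to each bound; n = 1 − k turns the multiple kπ
  -- into π.
  refine ⟨1 - k, _, _, _, T.rotate _, ?_, realPeriods_rotate (cis_fifth_pow _) hq⟩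
  push_cast at h₃
  obtain ⟨h11, h12⟩ := h₁
  obtain ⟨h21, h22⟩ := h₂
  obtain ⟨h31, h32⟩ := h₃
  constructor <;> push_cast <;> linarith

/-- Up to a rotation by a fifth root of unity, one of the vertices of the triangle is central. -/
lemma exists_central (T : Tri x₁ x₂ x₃ w v u) (hq : RealPeriods (cubic x₁ x₂ x₃)) :
    ∃ (n : ℤ) (w' v' u' : ℝ), ∀ ε : ℂ, ε = cis (2 * Real.pi * n / 5) →
      Central (ε * x₁) (ε * x₂) (ε * x₃) w' v' u' ∨ Central (ε * x₂) (ε * x₃) (ε * x₁) w' v' u' ∨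
        Central (ε * x₃) (ε * x₁) (ε * x₂) w' v' u' := by
  have hpi := Real.pi_pos
  obtain ⟨k₁, k₂, k₃, h₁, h₂, h₃⟩ := exists_int_of_tri T hq
  rcases int_cases_of_tri T h₁ h₂ h₃ with ⟨rfl, rfl⟩ | ⟨rfl, rfl⟩ | ⟨rfl, rfl⟩
  · obtain ⟨n, w', v', u', h⟩ := central_of_int T hq h₁ h₂ h₃
    exact ⟨n, w', v', u', by rintro ε rfl; exact Or.inl h⟩
  -- The cyclic relabelling replaces (w, v, u) by (u, w + π, v + π); the added π's account for the
  -- shift of k, by 2 here and by 4 after two steps.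
  · obtain ⟨n, w', v', u', h⟩ := central_of_int T.cycle (by rwa [cubic_cycle]) (k := k₂ + 2)
      (by push_cast at *; constructor <;> linarith [h₃.1, h₃.2])
      (by push_cast at *; constructor <;> linarith [h₁.1, h₁.2])
      (by push_cast at *; constructor <;> linarith [h₂.1, h₂.2])
    exact ⟨n, w', v', u', by rintro ε rfl; exact Or.inr (Or.inl h)⟩
  · obtain ⟨n, w', v', u', h⟩ := central_of_int T.cycle.cycle
      (by rwa [cubic_cycle, cubic_cycle]) (k := k₁ + 4)
      (by push_cast at *; constructor <;> linarith [h₂.1, h₂.2])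
      (by push_cast at *; constructor <;> linarith [h₃.1, h₃.2])
      (by push_cast at *; constructor <;> linarith [h₁.1, h₁.2])
    exact ⟨n, w', v', u', by rintro ε rfl; exact Or.inr (Or.inr h)⟩

end

/-! ### Lengths of the two trajectories and identification of the central zero -/

section

variable {x₁ x₂ x₃ : ℂ} {w v u : ℝ}

lemma wint_comp_one_sub (σ : ℝ → ℂ) : wint (fun s => σ (1 - s)) = wint σ := by
  have h := intervalIntegral.integral_comp_sub_left (fun s => (wt s : ℂ) * σ s) (1 : ℝ)
    (a := 0) (b := 1)
  rw [sub_self, sub_zero] at h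
  rw [wint, wint, ← h]
  refine intervalIntegral.integral_congr fun s _ => ?_
  have : wt (1 - s) = wt s := by rw [wt, wt]; ring_nf
  simp only [this]

lemma wint_const_mul (c : ℂ) (σ : ℝ → ℂ) : wint (fun s => c * σ s) = c * wint σ := by
  rw [wint, wint, ← intervalIntegral.integral_const_mul]
  refine intervalIntegral.integral_congr fun s _ => ?_
  ring

lemma wint_congr {σ τ : ℝ → ℂ} (h : ∀ s ∈ Set.Icc (0 : ℝ) 1, σ s = τ s) : wint σ = wint τ := by
  refine intervalIntegral.integral_congr fun s hs => ?_
  rw [Set.uIcc_of_le zero_le_one] at hs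
  simp only [h s hs]

lemma wint_sub {σ τ : ℝ → ℂ} (hσ : ContinuousOn σ (Set.Icc 0 1))
    (hτ : ContinuousOn τ (Set.Icc 0 1)) : wint (fun s => σ s - τ s) = wint σ - wint τ := by
  have hw : ContinuousOn (fun s => (wt s : ℂ)) (Set.Icc 0 1) :=
    (Complex.continuous_ofReal.comp continuous_wt).continuousOn
  refine Eq.trans ?_ (intervalIntegral.integral_sub
    ((hw.mul hσ).intervalIntegrable_of_Icc zero_le_one)
    ((hw.mul hτ).intervalIntegrable_of_Icc zero_le_one))
  refine intervalIntegral.integral_congr fun s _ => ?_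
  simp only
  ring

lemma wint_add {σ τ : ℝ → ℂ} (hσ : ContinuousOn σ (Set.Icc 0 1))
    (hτ : ContinuousOn τ (Set.Icc 0 1)) : wint (fun s => σ s + τ s) = wint σ + wint τ := by
  have hw : ContinuousOn (fun s => (wt s : ℂ)) (Set.Icc 0 1) :=
    (Complex.continuous_ofReal.comp continuous_wt).continuousOn
  refine Eq.trans ?_ (intervalIntegral.integral_add
    ((hw.mul hσ).intervalIntegrable_of_Icc zero_le_one)
    ((hw.mul hτ).intervalIntegrable_of_Icc zero_le_one))
  refine intervalIntegral.integral_congr fun s _ => ?_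
  simp only
  ring

lemma sq_cis_mul (κ θ : ℝ) (z : ℂ) : sq κ (cis θ * z) = cis (θ / 2) * sq (κ - θ) z := by
  rw [sq, sq, ← mul_assoc, ← cis_add, mul_comm (cis θ), mul_assoc, ← cis_add]
  congr 2
  · ring
  · congr 2; ring

/-- The integrand of the normalized half period. -/
def shape (β r s : ℝ) : ℂ := sq 0 (1 + (s * r : ℝ) * cis β)

/-- The normalized length of a side, as a function of the ratio `r` of two sides. -/
def sideLen (β r : ℝ) : ℝ := ‖wint (shape β r)‖

lemma shape_zero_right (β r : ℝ) : shape β r 0 = 1 := by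
  have := sq_polar (κ := 0) (ρ := 1) (θ := 0) zero_le_one (by linarith [Real.pi_pos])
    (by linarith [Real.pi_pos])
  simpa [shape, cis_zero] using this

lemma one_add_mem_sector {β r s : ℝ} (hβ : 0 < β) (hβ' : β < Real.pi) (hr : 0 < r) (hs : 0 < s) :
    (1 + (s * r : ℝ) * cis β : ℂ) ∈ sector 0 β := by
  have := add_mem_sector (a := 0) (b := β) (P := 1) (Q := s * r) hβ (by linarith) one_pos
    (mul_pos hs hr)
  simpa [cis_zero] using this

lemma continuousOn_shape {β r : ℝ} (hβ : 0 < β) (hβ' : β < Real.pi / 2) (hr : 0 < r) :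
    ContinuousOn (shape β r) (Set.Icc 0 1) := by
  intro s hs
  refine ContinuousAt.continuousWithinAt ?_
  refine ContinuousAt.comp (f := fun s : ℝ => (1 + (s * r : ℝ) * cis β : ℂ)) (continuousAt_sq ?_)
    (by fun_prop)
  have : 0 ≤ Real.cos β := Real.cos_nonneg_of_mem_Icc ⟨by linarith, hβ'.le⟩
  rw [neg_zero, cis_zero, mul_one, Complex.add_re, Complex.re_ofReal_mul, cis_re, Complex.one_re]
  have := mul_nonneg (mul_nonneg hs.1 hr.le) this
  linarith

lemma angle_bounds (T : Tri x₁ x₂ x₃ w v u) (A : Ang w v u) :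
    Real.pi / 5 < u - w ∧ u - w < Real.pi / 3 :=
  ⟨by linarith [A.lt_u T.vu, A.w_lt T.wv], by linarith [A.lt_w, A.u_lt]⟩

/-- The length of the side `x₂ x₃`. -/
lemma side_eq_sideLen (T : Tri x₁ x₂ x₃ w v u) (A : Ang w v u) :
    ‖x₃ - x₂‖ ^ 2 * ‖wint fun s => sq (2 * Real.pi / 3) (x₃ + s * (x₂ - x₃) - x₁)‖ =
      ‖x₃ - x₂‖ ^ 2 * Real.sqrt ‖x₂ - x₁‖ * sideLen (u - w) (‖x₃ - x₂‖ / ‖x₂ - x₁‖) := by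
  have hpi := Real.pi_pos
  obtain ⟨hb1, hb2⟩ := angle_bounds T A
  have hw1 := A.lt_w
  have hw2 := A.w_lt T.wv
  obtain ⟨b, hb, eb⟩ := T.side₁₂
  obtain ⟨a, ha, ea⟩ := T.side₂₃
  have na : ‖x₃ - x₂‖ = a := by
    rw [ea, norm_mul, norm_cis, Complex.norm_real, Real.norm_of_nonneg ha.le, mul_one]
  have nb : ‖x₂ - x₁‖ = b := by
    rw [eb, norm_mul, norm_cis, Complex.norm_real, Real.norm_of_nonneg hb.le, mul_one]
  rw [na, nb]
  have h1 : wint (fun s => sq (2 * Real.pi / 3) (x₃ + s * (x₂ - x₃) - x₁)) =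
      (Real.sqrt b * cis (w / 2)) * wint (shape (u - w) (a / b)) := by
    rw [← wint_comp_one_sub, ← wint_const_mul]
    refine wint_congr fun s hs => ?_
    -- Traversed from x₂ to x₃, the vector from x₁ equals x₂ − x₁ times 1 + s (a/b) e^{i(u−w)}; only
    -- the ratio of the sides and their angle matter.
    have e : x₃ + ((1 - s : ℝ) : ℂ) * (x₂ - x₃) - x₁ =
        (b : ℂ) * (cis w * (1 + (s * (a / b) : ℝ) * cis (u - w))) := by
      have e1 : cis w * cis (u - w) = cis u := by rw [← cis_add]; congr 1; ring
      have hb0 : (b : ℂ) ≠ 0 := by exact_mod_cast hb.ne'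
      have e2 : (b : ℂ) * (cis w * (1 + (s * (a / b) : ℝ) * cis (u - w))) =
          b * cis w + s * (a * (cis w * cis (u - w))) := by
        push_cast
        field_simp
      rw [e2, e1, ← ea, ← eb]
      push_cast
      ring
    rw [e, sq_ofReal_mul hb.le, sq_cis_mul, ← mul_assoc]
    congr 1
    rcases hs.1.eq_or_lt with h0 | h0
    · rw [← h0, shape_zero_right]
      have := sq_polar (κ := 2 * Real.pi / 3 - w) (ρ := 1) (θ := 0) zero_le_one (by linarith)
        (by linarith)
      simpa [cis_zero] using this
    · exact sq_eq_sq (by linarith) (by linarith) (by linarith) (by linarith)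
        (one_add_mem_sector (by linarith) (by linarith) (div_pos ha hb) h0)
  rw [h1, norm_mul, norm_mul, norm_cis, Complex.norm_real,
    Real.norm_of_nonneg (Real.sqrt_nonneg b), mul_one, sideLen, mul_assoc]

/-- The lengths of the two finite trajectories. -/
lemma Central.length_third (h : Central x₁ x₂ x₃ w v u) {L : ℝ}
    (hL : HorizontalTrajectory (cubic x₁ x₂ x₃) x₂ x₃ L) :
    L = ‖x₃ - x₂‖ ^ 2 * Real.sqrt ‖x₂ - x₁‖ * sideLen (u - w) (‖x₃ - x₂‖ / ‖x₂ - x₁‖) := by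
  rw [← side_eq_sideLen h.tri h.ang]
  exact (trajectory_from_third h.tri h.ang h.real (Or.inr rfl)
    (horizontalTrajectory_symm hL)).2

lemma Central.conj (h : Central x₁ x₂ x₃ w v u) :
    Central (starRingEnd ℂ x₃) (starRingEnd ℂ x₂) (starRingEnd ℂ x₁)
      (Real.pi - u) (Real.pi - v) (Real.pi - w) :=
  ⟨h.tri.conj, h.ang.conj, realPeriods_conj h.real⟩

lemma Central.length_first (h : Central x₁ x₂ x₃ w v u) {L : ℝ}
    (hL : HorizontalTrajectory (cubic x₁ x₂ x₃) x₂ x₁ L) :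
    L = ‖x₂ - x₁‖ ^ 2 * Real.sqrt ‖x₃ - x₂‖ * sideLen (u - w) (‖x₂ - x₁‖ / ‖x₃ - x₂‖) := by
  have := h.conj.length_third (horizontalTrajectory_conj hL)
  rw [← map_sub, ← map_sub, Complex.norm_conj, Complex.norm_conj, norm_sub_rev x₁,
    norm_sub_rev x₂ x₃, show Real.pi - w - (Real.pi - u) = u - w by ring] at this
  exact this

lemma Central.not_trajectory (h : Central x₁ x₂ x₃ w v u) {L : ℝ} :
    ¬ HorizontalTrajectory (cubic x₁ x₂ x₃) x₃ x₁ L := by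
  intro hL
  have h1 := (trajectory_from_third h.tri h.ang h.real (Or.inl rfl) hL).1
  obtain ⟨ρ, hρ, e⟩ := h.tri.side₁₂
  rw [h1, sub_self] at e
  exact mul_ne_zero (by exact_mod_cast hρ.ne') (cis_ne_zero w) e.symm

/-- If the integers singled out another vertex, one of the given trajectories would join the two
vertices that are not singled out, which `Central.not_trajectory` forbids. -/
lemma exists_central_of_trajectories (T : Tri x₁ x₂ x₃ w v u)
    (hq : RealPeriods (cubic x₁ x₂ x₃)) {A B : ℝ}
    (hA : HorizontalTrajectory (cubic x₁ x₂ x₃) x₂ x₃ A)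
    (hB : HorizontalTrajectory (cubic x₁ x₂ x₃) x₂ x₁ B) :
    ∃ (n : ℤ) (w' v' u' : ℝ), ∀ ε : ℂ, ε = cis (2 * Real.pi * n / 5) →
      Central (ε * x₁) (ε * x₂) (ε * x₃) w' v' u' ∧
        HorizontalTrajectory (cubic (ε * x₁) (ε * x₂) (ε * x₃)) (ε * x₂) (ε * x₃) A ∧
        HorizontalTrajectory (cubic (ε * x₁) (ε * x₂) (ε * x₃)) (ε * x₂) (ε * x₁) B := by
  obtain ⟨n, w', v', u', h⟩ := exists_central T hq
  refine ⟨n, w', v', u', fun ε hε => ?_⟩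
  have hε5 : ε ^ 5 = 1 := by rw [hε]; exact cis_fifth_pow n
  have hA' := horizontalTrajectory_rotate hε5 hA
  have hB' := horizontalTrajectory_rotate hε5 hB
  rcases h ε hε with h | h | h
  · exact ⟨h, hA', hB'⟩
  · refine absurd (horizontalTrajectory_symm hB') ?_
    have := h.not_trajectory (L := B)
    rw [cubic_cycle] at this
    exact this
  · have := h.not_trajectory (L := A)
    rw [cubic_cycle, cubic_cycle] at this
    exact absurd hA' this

end

/-! ### The zeros form a positively oriented triangle -/

lemma wint_ofReal_mul_const (r : ℝ → ℝ) (c : ℂ) :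
    wint (fun s => (r s : ℂ) * c) = ((∫ s in (0 : ℝ)..1, wt s * r s : ℝ) : ℂ) * c := by
  rw [wint, ← intervalIntegral.integral_ofReal, ← intervalIntegral.integral_mul_const]
  refine intervalIntegral.integral_congr fun s _ => ?_
  push_cast
  ring

lemma integral_wt_mul_pos {r : ℝ → ℝ} (hr : ContinuousOn r (Set.Icc 0 1))
    (h : ∀ s ∈ Set.Ioo (0 : ℝ) 1, 0 < r s) : 0 < ∫ s in (0 : ℝ)..1, wt s * r s :=
  intervalIntegral.intervalIntegral_pos_of_pos_on
    ((continuous_wt.continuousOn.mul hr).intervalIntegrable_of_Icc zero_le_one)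
    (fun s hs => mul_pos (wt_pos hs) (h s hs)) zero_lt_one

/-- The zeros of a cubic with real periods are not collinear. -/
lemma not_collinear {q : ℂ → ℂ} (hq : RealPeriods q) {a b m : ℂ} {τ : ℝ} (hτ : 0 < τ)
    (hτ' : τ < 1) (hab : b ≠ a) (hm : m = a + τ * (b - a))
    (hqz : ∀ x, q x = (x - a) * (x - b) * (x - m)) : False := by
  set c := sq 0 (b - a) with hc
  have hc2 : c ^ 2 = b - a := sq_sq _ _
  have hsqrt : ∀ r : ℝ, 0 ≤ r → ((Real.sqrt r : ℝ) : ℂ) ^ 2 = r := by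
    intro r hr
    rw [← Complex.ofReal_pow, Real.sq_sqrt hr]
  have h1 := im_halfPeriod hq (a := a) (b := m) (z := b)
    (σ := fun s => ((Real.sqrt (1 - s * τ) : ℝ) : ℂ) * c) (fun x => by rw [hqz]; ring)
    (by fun_prop) (fun s hs => by
      rw [mul_pow, hc2, hsqrt _ (by nlinarith [hs.1, hs.2]), hm]; push_cast; ring)
  have h2 := im_halfPeriod hq (a := m) (b := b) (z := a)
    (σ := fun s => ((Real.sqrt (τ + s * (1 - τ)) : ℝ) : ℂ) * (Complex.I * c))
    (fun x => by rw [hqz]; ring) (by fun_prop) (fun s hs => by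
      rw [mul_pow, mul_pow, hc2, Complex.I_sq, hsqrt _ (by nlinarith [hs.1, hs.2]), hm]
      push_cast; ring)
  rw [wint_ofReal_mul_const] at h1 h2
  have p1 := integral_wt_mul_pos (r := fun s => Real.sqrt (1 - s * τ)) (by fun_prop)
    (fun s hs => Real.sqrt_pos.2 (by nlinarith [hs.1, hs.2]))
  have p2 := integral_wt_mul_pos (r := fun s => Real.sqrt (τ + s * (1 - τ))) (by fun_prop)
    (fun s hs => Real.sqrt_pos.2 (by nlinarith [hs.1, hs.2]))
  set P := ∫ s in (0 : ℝ)..1, wt s * Real.sqrt (1 - s * τ)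
  set Q := ∫ s in (0 : ℝ)..1, wt s * Real.sqrt (τ + s * (1 - τ))
  have e1 : (m - a) ^ 2 * ((P : ℂ) * c) = ((τ ^ 2 * P : ℝ) : ℂ) * ((b - a) ^ 2 * c) := by
    rw [hm]; push_cast; ring
  have e2 : (b - m) ^ 2 * ((Q : ℂ) * (Complex.I * c)) =
      (((1 - τ) ^ 2 * Q : ℝ) : ℂ) * (Complex.I * ((b - a) ^ 2 * c)) := by
    rw [hm]; push_cast; ring
  -- Up to positive factors the two half periods are (b − a)² c and i (b − a)² c. Both can be real
  -- only if (b − a)² c = 0.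
  rw [e1, Complex.im_ofReal_mul] at h1
  rw [e2, Complex.im_ofReal_mul, Complex.I_mul_im] at h2
  have hi := (mul_eq_zero.1 h1).resolve_left (by positivity)
  have hr := (mul_eq_zero.1 h2).resolve_left
    (mul_pos (pow_pos (by linarith) 2) p2).ne'
  have hz : (b - a) ^ 2 * c = 0 := Complex.ext hr hi
  have hne : b - a ≠ 0 := sub_ne_zero.2 hab
  have hc0 : c ≠ 0 := by
    intro h
    rw [h] at hc2
    exact hne (by simpa using hc2.symm)
  exact mul_ne_zero (pow_ne_zero 2 hne) hc0 hz

lemma exists_tri_of_im_pos {x₁ x₂ x₃ : ℂ} (h21 : x₂ ≠ x₁)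
    (h : 0 < ((x₃ - x₁) / (x₂ - x₁)).im) : ∃ w v u : ℝ, Tri x₁ x₂ x₃ w v u := by
  have hne : x₂ - x₁ ≠ 0 := sub_ne_zero.2 h21
  set y := (x₃ - x₁) / (x₂ - x₁) with hy
  have hx3 : x₃ - x₁ = (x₂ - x₁) * y := by rw [hy]; field_simp
  have hpi := Real.pi_pos
  have hmpi : cis (-Real.pi) = -1 := by
    rw [← cis_pi, ← cis_add_two_pi (-Real.pi)]; congr 1; ring
  have hs : y - 1 ∈ sector 0 Real.pi :=
    mem_sector_of_im hpi.le (by linarith) (by simpa [cis_zero] using h) (by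
      rw [hmpi]; simpa using h)
  obtain ⟨ρ', θ', hρ', h1, h2, e'⟩ := hs
  have hs' : y ∈ sector 0 θ' := by
    have := add_mem_sector (a := 0) (b := θ') (P := 1) (Q := ρ') h1 (by linarith) one_pos hρ'
    rw [← e', cis_zero] at this
    simpa using this
  obtain ⟨ρ, θ, hρ, h3, h4, e⟩ := hs'
  set w := Complex.arg (x₂ - x₁) with hw
  have hxw : x₂ - x₁ = ‖x₂ - x₁‖ * cis w := (norm_mul_cis_arg _).symm
  have hn : 0 < ‖x₂ - x₁‖ := norm_pos_iff.2 hne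
  refine ⟨w, w + θ, w + θ', by linarith, by linarith, by linarith, ⟨_, hn, hxw⟩,
    ⟨‖x₂ - x₁‖ * ρ, mul_pos hn hρ, ?_⟩, ⟨‖x₂ - x₁‖ * ρ', mul_pos hn hρ', ?_⟩⟩
  · rw [hx3, e, cis_add]
    nth_rewrite 1 [hxw]
    push_cast; ring
  · have : x₃ - x₂ = (x₂ - x₁) * (y - 1) := by linear_combination hx3
    rw [this, e', cis_add]
    nth_rewrite 1 [hxw]
    push_cast; ring

lemma im_div_eq (z y : ℂ) :
    (z / y).im = (z * starRingEnd ℂ y).im * (Complex.normSq y)⁻¹ := by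
  rw [div_eq_mul_inv, Complex.inv_def, ← mul_assoc, Complex.im_mul_ofReal]

lemma cross_polar (r θ r' θ' : ℝ) :
    ((r' * Complex.exp (θ' * Complex.I)) * starRingEnd ℂ (r * Complex.exp (θ * Complex.I))).im =
      r * r' * Real.sin (θ' - θ) := by
  change ((r' * cis θ') * starRingEnd ℂ (r * cis θ)).im = _
  rw [map_mul, conj_cis, Complex.conj_ofReal]
  have : (r' : ℂ) * cis θ' * (r * cis (-θ)) = ((r * r' : ℝ) : ℂ) * cis (θ' - θ) := by
    rw [sub_eq_add_neg, cis_add]; push_cast; ring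
  rw [this, Complex.im_ofReal_mul, cis_im]

lemma pi_lt_of_cross_neg {r r' θ : ℝ} (hr : 0 ≤ r) (hr' : 0 ≤ r') (hθ : 0 < θ)
    (h : r * r' * Real.sin θ < 0) : Real.pi < θ := by
  by_contra hcon
  have := Real.sin_nonneg_of_nonneg_of_le_pi hθ.le (not_lt.1 hcon)
  have := mul_nonneg (mul_nonneg hr hr') this
  linarith

/-- As the zeros sum to 0, the three consecutive cross products are equal. If they were negative,
each of the three angular gaps would exceed π, although the gaps add up to 2π; if they were 0, the
zeros would be collinear. -/
lemma Curve.exists_tri (c : Curve) : ∃ w v u : ℝ, Tri c.x₁ c.x₂ c.x₃ w v u := by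
  have hx1 : c.x₁ = -c.x₂ - c.x₃ := by linear_combination c.sum_eq_zero
  have hn12 := sub_ne_zero.2 c.ne₁₂.symm
  refine exists_tri_of_im_pos c.ne₁₂.symm ?_
  obtain ⟨θ₁, θ₂, θ₃, h23, h31, h12, e1, e2, e3⟩ := c.counterclockwise
  set d := (c.x₃ * starRingEnd ℂ c.x₂).im with hd
  have d1 : d = (c.x₁ * starRingEnd ℂ c.x₃).im := by
    rw [hd, hx1]; simp; ring
  have d2 : d = (c.x₂ * starRingEnd ℂ c.x₁).im := by
    rw [hd, hx1]; simp; ring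
  have d3 : ((c.x₃ - c.x₁) * starRingEnd ℂ (c.x₂ - c.x₁)).im = 3 * d := by
    rw [hd, hx1]; simp; ring
  have hnorm : 0 < (Complex.normSq (c.x₂ - c.x₁))⁻¹ := inv_pos.2 (Complex.normSq_pos.2 hn12)
  rw [im_div_eq, d3]
  refine mul_pos (mul_pos three_pos ?_) hnorm
  rcases lt_trichotomy d 0 with hneg | hzero | hpos
  · exfalso
    have s1 : d = ‖c.x₂‖ * ‖c.x₃‖ * Real.sin (θ₃ - θ₂) := by
      rw [← cross_polar, ← e2, ← e3]
    have s2 : d = ‖c.x₃‖ * ‖c.x₁‖ * Real.sin (θ₁ - θ₃) := by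
      rw [← cross_polar, ← e1, ← e3, d1]
    have s3 : d = ‖c.x₁‖ * ‖c.x₂‖ * Real.sin (θ₂ + 2 * Real.pi - θ₁) := by
      rw [show θ₂ + 2 * Real.pi - θ₁ = θ₂ - θ₁ + 2 * Real.pi by ring, Real.sin_add_two_pi,
        ← cross_polar, ← e1, ← e2, d2]
    have g1 := pi_lt_of_cross_neg (norm_nonneg c.x₂) (norm_nonneg c.x₃) (θ := θ₃ - θ₂)
      (by linarith) (by linarith)
    have g2 := pi_lt_of_cross_neg (norm_nonneg c.x₃) (norm_nonneg c.x₁) (θ := θ₁ - θ₃)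
      (by linarith) (by linarith)
    have g3 := pi_lt_of_cross_neg (norm_nonneg c.x₁) (norm_nonneg c.x₂)
      (θ := θ₂ + 2 * Real.pi - θ₁) (by linarith) (by linarith)
    linarith [Real.pi_pos]
  · exfalso
    have him : ((c.x₃ - c.x₁) / (c.x₂ - c.x₁)).im = 0 := by
      rw [im_div_eq, d3, hzero]; simp
    set t := ((c.x₃ - c.x₁) / (c.x₂ - c.x₁)).re with ht
    have e : c.x₃ - c.x₁ = t * (c.x₂ - c.x₁) := by
      rw [← div_eq_iff hn12]
      exact Complex.ext (by simp [ht]) (by simpa using him)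
    have t0 : t ≠ 0 := by
      intro h
      rw [h, Complex.ofReal_zero, zero_mul] at e
      exact c.ne₁₃ (by linear_combination -e)
    have t1 : t ≠ 1 := by
      intro h
      rw [h] at e
      exact c.ne₂₃ (by push_cast at e; linear_combination -e)
    -- The position of t relative to 0 and 1 decides which zero lies between the other two.
    rcases lt_or_gt_of_ne t0 with h | h
    · have h1t : 0 < 1 - t := by linarith
      have hc : ((1 - t : ℝ) : ℂ) ≠ 0 := by exact_mod_cast h1t.ne'
      refine not_collinear c.realPeriods (a := c.x₂) (b := c.x₃) (m := c.x₁) (τ := 1 / (1 - t))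
        (by positivity) (by rw [div_lt_one h1t]; linarith) c.ne₂₃.symm ?_
        (fun x => by rw [cubic]; ring)
      push_cast at hc ⊢
      field_simp
      linear_combination -e
    · rcases lt_or_gt_of_ne t1 with h' | h'
      · exact not_collinear c.realPeriods (a := c.x₁) (b := c.x₂) (m := c.x₃) h h'
          c.ne₁₂.symm (by linear_combination e) (fun x => by rw [cubic])
      · have hc : (t : ℂ) ≠ 0 := by exact_mod_cast t0
        refine not_collinear c.realPeriods (a := c.x₁) (b := c.x₃) (m := c.x₂) (τ := 1 / t)
          (by positivity) (by rw [div_lt_one h]; exact h') c.ne₁₃.symm ?_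
          (fun x => by rw [cubic]; ring)
        push_cast
        field_simp
        linear_combination -e
  · exact hpos

/-! ### Comparison of the lengths with the sides -/

lemma shape_mem_sector {β r s : ℝ} (hβ : 0 < β) (hβ' : β < Real.pi / 2) (hr : 0 < r)
    (hs : 0 < s) : shape β r s ∈ sector 0 (β / 2) := by
  have hpi := Real.pi_pos
  have := sq_mem_sector (κ := 0) (by linarith) (by linarith)
    (one_add_mem_sector hβ (by linarith) hr hs)
  rwa [zero_div] at this

/-- The square of the root has real part at least 1 as cos β ≥ 0, and (Re)² = Re(square) + (Im)². -/
lemma one_le_shape_re {β r s : ℝ} (hβ : 0 < β) (hβ' : β < Real.pi / 2) (hr : 0 < r)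
    (hs : 0 < s) : 1 ≤ (shape β r s).re := by
  have hpi := Real.pi_pos
  have h0 := re_pos_of_mem_sector (κ := 0) (by linarith) (by linarith)
    (shape_mem_sector hβ hβ' hr hs)
  rw [neg_zero, cis_zero, mul_one] at h0
  have h1 := congrArg Complex.re (sq_sq 0 (1 + (s * r : ℝ) * cis β))
  change (shape β r s ^ 2).re = _ at h1
  rw [pow_two, Complex.mul_re, Complex.add_re, Complex.re_ofReal_mul, cis_re, Complex.one_re] at h1
  have h2 : 0 ≤ Real.cos β := Real.cos_nonneg_of_mem_Icc ⟨by linarith, hβ'.le⟩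
  have h3 : 0 ≤ s * r * Real.cos β := by positivity
  nlinarith [sq_nonneg (shape β r s).im]

lemma wint_re {σ : ℝ → ℂ} (hσ : ContinuousOn σ (Set.Icc 0 1)) :
    (wint σ).re = ∫ s in (0 : ℝ)..1, wt s * (σ s).re := by
  have hi : IntervalIntegrable (fun s => (wt s : ℂ) * σ s) MeasureTheory.volume 0 1 :=
    ((Complex.continuous_ofReal.comp continuous_wt).continuousOn.mul
      hσ).intervalIntegrable_of_Icc zero_le_one
  have h := Complex.reCLM.intervalIntegral_comp_comm hi
  have h' : (wint σ).re = ∫ s in (0 : ℝ)..1, ((wt s : ℂ) * σ s).re := h.symm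
  simp only [Complex.re_ofReal_mul] at h'
  exact h'

lemma wint_im {σ : ℝ → ℂ} (hσ : ContinuousOn σ (Set.Icc 0 1)) :
    (wint σ).im = ∫ s in (0 : ℝ)..1, wt s * (σ s).im := by
  have hi : IntervalIntegrable (fun s => (wt s : ℂ) * σ s) MeasureTheory.volume 0 1 :=
    ((Complex.continuous_ofReal.comp continuous_wt).continuousOn.mul
      hσ).intervalIntegrable_of_Icc zero_le_one
  have h := Complex.imCLM.intervalIntegral_comp_comm hi
  have h' : (wint σ).im = ∫ s in (0 : ℝ)..1, ((wt s : ℂ) * σ s).im := h.symm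
  simp only [Complex.im_ofReal_mul] at h'
  exact h'

/-- The total weight. -/
def totalWt : ℝ := ∫ s in (0 : ℝ)..1, wt s

lemma totalWt_pos : 0 < totalWt :=
  intervalIntegral.intervalIntegral_pos_of_pos_on (continuous_wt.intervalIntegrable 0 1)
    (fun _ hs => wt_pos hs) zero_lt_one

lemma totalWt_le_sideLen {β r : ℝ} (hβ : 0 < β) (hβ' : β < Real.pi / 2) (hr : 0 < r) :
    totalWt ≤ sideLen β r := by
  have hc := continuousOn_shape hβ hβ' hr
  refine le_trans ?_ (Complex.re_le_norm _)
  rw [wint_re hc]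
  refine intervalIntegral.integral_mono_on zero_le_one (continuous_wt.intervalIntegrable 0 1)
    ((continuous_wt.continuousOn.mul
      (Complex.continuous_re.comp_continuousOn hc)).intervalIntegrable_of_Icc zero_le_one)
    fun s hs => ?_
  have h1 : 1 ≤ (shape β r s).re := by
    rcases hs.1.eq_or_lt with h | h
    · rw [← h, shape_zero_right, Complex.one_re]
    · exact one_le_shape_re hβ hβ' hr h
  nlinarith [wt_nonneg s]

lemma sideLen_le {β r : ℝ} (hr : 0 < r) : sideLen β r ≤ totalWt * Real.sqrt (1 + r) := by
  rw [totalWt, ← intervalIntegral.integral_mul_const]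
  refine intervalIntegral.norm_integral_le_of_norm_le zero_le_one ?_
    ((continuous_wt.mul continuous_const).intervalIntegrable 0 1)
  refine Eventually.of_forall fun s hs => ?_
  rw [norm_mul, Complex.norm_real, Real.norm_of_nonneg (wt_nonneg s), shape, norm_sq]
  refine mul_le_mul_of_nonneg_left (Real.sqrt_le_sqrt ?_) (wt_nonneg s)
  refine (norm_add_le _ _).trans ?_
  rw [norm_one, norm_mul, norm_cis, Complex.norm_real,
    Real.norm_of_nonneg (mul_nonneg hs.1.le hr.le), mul_one]
  nlinarith [hs.2]

/-- The integral G has argument in (0, β/2). The increment of the root is a positive multiple of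
e^{iβ} divided by a sum of two roots, so G' − G has argument in (β/2, β). The two meet at an acute
angle, which makes the norm grow. -/
lemma sideLen_lt {β r r' : ℝ} (hβ : 0 < β) (hβ' : β < Real.pi / 2) (hr : 0 < r) (hrr : r < r') :
    sideLen β r < sideLen β r' := by
  have hpi := Real.pi_pos
  have hr' := hr.trans hrr
  have c1 := continuousOn_shape hβ hβ' hr
  have c2 := continuousOn_shape hβ hβ' hr'
  set G := wint (shape β r) with hG
  set G' := wint (shape β r') with hG'
  have mG : G ∈ sector 0 (β / 2) :=
    wint_mem_sector (by linarith) (by linarith) c1 fun s hs => shape_mem_sector hβ hβ' hr hs.1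
  have mD : G' - G ∈ sector (β / 2) β := by
    rw [hG, hG', ← wint_sub c2 c1]
    refine wint_mem_sector (by linarith) (by linarith) (c2.sub c1) fun s hs => ?_
    have m1 := sector_add_mem (by linarith) (shape_mem_sector hβ hβ' hr' hs.1)
      (shape_mem_sector hβ hβ' hr hs.1)
    have hne := ne_zero_of_mem_sector m1
    have e : shape β r' s - shape β r s =
        ((s * (r' - r) : ℝ) : ℂ) * cis β * (shape β r' s + shape β r s)⁻¹ := by
      rw [eq_mul_inv_iff_mul_eq₀ hne]
      have e1 : shape β r' s ^ 2 = 1 + (s * r' : ℝ) * cis β := sq_sq _ _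
      have e2 : shape β r s ^ 2 = 1 + (s * r : ℝ) * cis β := sq_sq _ _
      push_cast at e1 e2 ⊢
      linear_combination e1 - e2
    rw [e]
    have := polar_mul_mem_sector (θ := β) (mul_pos hs.1 (sub_pos.2 hrr)) (inv_mem_sector m1)
    exact sector_mono (by linarith) (by linarith) this
  have mP := re_pos_of_mem_sector (κ := 0) (by linarith) (by linarith)
    (mul_mem_sector mD (conj_mem_sector mG))
  rw [neg_zero, cis_zero, mul_one, sub_mul, Complex.sub_re, Complex.mul_conj, Complex.ofReal_re,
    Complex.normSq_eq_norm_sq] at mP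
  have h1 : (G' * starRingEnd ℂ G).re ≤ ‖G'‖ * ‖G‖ := by
    refine (Complex.re_le_norm _).trans ?_
    rw [norm_mul, Complex.norm_conj]
  have h2 : 0 < ‖G‖ := norm_pos_iff.2 (ne_zero_of_mem_sector mG)
  change ‖G‖ < ‖G'‖
  nlinarith

/-- After division by √(ab) the prefactors are a^{3/2} and b^{3/2}, and `sideLen` increases. -/
lemma length_lt {β a b : ℝ} (hβ : 0 < β) (hβ' : β < Real.pi / 2) (ha : 0 < a) (hab : a < b) :
    a ^ 2 * Real.sqrt b * sideLen β (a / b) < b ^ 2 * Real.sqrt a * sideLen β (b / a) := by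
  have hb := ha.trans hab
  have h1 : a / b < b / a := by
    rw [div_lt_div_iff₀ hb ha]; nlinarith
  have h2 := sideLen_lt hβ hβ' (div_pos ha hb) h1
  have h3 := totalWt_pos.trans_le (totalWt_le_sideLen hβ hβ' (div_pos ha hb))
  have sa := Real.sqrt_pos.2 ha
  have sb := Real.sqrt_pos.2 hb
  have h4 : Real.sqrt a < Real.sqrt b := Real.sqrt_lt_sqrt ha.le hab
  have ea := Real.mul_self_sqrt ha.le
  have eb := Real.mul_self_sqrt hb.le
  have h5 : a ^ 2 * Real.sqrt b < b ^ 2 * Real.sqrt a := by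
    have e1 : a ^ 2 * Real.sqrt b = (a * Real.sqrt a) * (Real.sqrt a * Real.sqrt b) := by
      rw [pow_two]; nth_rewrite 2 [← ea]; ring
    have e2 : b ^ 2 * Real.sqrt a = (b * Real.sqrt b) * (Real.sqrt a * Real.sqrt b) := by
      rw [pow_two]; nth_rewrite 2 [← eb]; ring
    rw [e1, e2]
    exact mul_lt_mul_of_pos_right (mul_lt_mul'' hab h4 ha.le sa.le) (mul_pos sa sb)
  exact mul_lt_mul'' h5 h2 (by positivity) h3.le

/-- Insert `sideLen` ≥ `totalWt` in the numerator and `sideLen` ≤ `totalWt` √(1 + b/a) in the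
denominator; then √a √(1 + b/a) = √(a + b) ≤ 2√b produces the factor 2. -/
lemma sq_ratio_le {β a b : ℝ} (hβ : 0 < β) (hβ' : β < Real.pi / 2) (ha : 0 < a) (hab : a ≤ b) :
    (a / b) ^ 2 ≤ 2 * ((a ^ 2 * Real.sqrt b * sideLen β (a / b)) /
      (b ^ 2 * Real.sqrt a * sideLen β (b / a))) := by
  have hb := ha.trans_le hab
  have h1 := totalWt_le_sideLen hβ hβ' (div_pos ha hb)
  have h2 := sideLen_le (β := β) (div_pos hb ha)
  have h3 := totalWt_pos
  have h4 := h3.trans_le (totalWt_le_sideLen hβ hβ' (div_pos hb ha))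
  have sa := Real.sqrt_pos.2 ha
  have sb := Real.sqrt_pos.2 hb
  have h5 : Real.sqrt a * Real.sqrt (1 + b / a) ≤ 2 * Real.sqrt b := by
    rw [← Real.sqrt_mul ha.le, show a * (1 + b / a) = a + b by field_simp]
    rw [Real.sqrt_le_left (by positivity), mul_pow, Real.sq_sqrt hb.le]
    linarith
  rw [div_pow, ← mul_div_assoc, div_le_div_iff₀ (by positivity) (by positivity)]
  calc a ^ 2 * (b ^ 2 * Real.sqrt a * sideLen β (b / a))
      ≤ a ^ 2 * (b ^ 2 * Real.sqrt a * (totalWt * Real.sqrt (1 + b / a))) := by gcongr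
    _ = a ^ 2 * b ^ 2 * totalWt * (Real.sqrt a * Real.sqrt (1 + b / a)) := by ring
    _ ≤ a ^ 2 * b ^ 2 * totalWt * (2 * Real.sqrt b) := by gcongr
    _ ≤ a ^ 2 * b ^ 2 * sideLen β (a / b) * (2 * Real.sqrt b) := by gcongr
    _ = 2 * (a ^ 2 * Real.sqrt b * sideLen β (a / b)) * b ^ 2 := by ring

/-! ### The argument of the central zero in the normal form -/

lemma sq_zero_re_pos {z : ℂ} (hz : z ∈ Complex.slitPlane) : 0 < (sq 0 z).re := by
  have hz' : z ∈ sector (-Real.pi) Real.pi := by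
    refine ⟨‖z‖, Complex.arg z, norm_pos_iff.2 (Complex.slitPlane_ne_zero hz),
      Complex.neg_pi_lt_arg z, ?_, (norm_mul_cis_arg z).symm⟩
    exact lt_of_le_of_ne (Complex.arg_le_pi z) (Complex.mem_slitPlane_iff_arg.1 hz).1
  have h := sq_mem_sector (κ := 0) (by simp) (by simp) hz'
  have h2 := re_pos_of_mem_sector (κ := 0) (by linarith) (by linarith) h
  simpa [cis_zero] using h2

lemma sq_zero_re_sq (z : ℂ) : 2 * (sq 0 z).re ^ 2 = ‖z‖ + z.re := by
  have h1 := sq_sq 0 z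
  have h2 := congrArg Complex.re h1
  have h3 : ‖sq 0 z‖ ^ 2 = ‖z‖ := by rw [← norm_pow, h1]
  rw [← Complex.normSq_eq_norm_sq, Complex.normSq_apply] at h3
  rw [pow_two, Complex.mul_re] at h2
  rw [← h3, ← h2]
  ring

lemma sq_zero_im_mul (z : ℂ) : 2 * (sq 0 z).re * (sq 0 z).im = z.im := by
  have h2 := congrArg Complex.im (sq_sq 0 z)
  rw [pow_two, Complex.mul_im] at h2
  linarith

/-- The two points have opposite imaginary parts, and Im √z = Im z / (2 Re √z). The upper point has
the larger |z| + Re z = 2 (Re √z)², hence the root with the smaller imaginary part in absolute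
value. -/
lemma im_pair_nonpos_aux {h t ψ : ℝ} (hh : 0 < h) (ht : 0 < t) (hψ : 0 < ψ) (hψ' : ψ ≤ Real.pi / 2) :
    (sq 0 (h + t * cis ψ)).im + (sq 0 (h + ((-t : ℝ) : ℂ) * cis ψ)).im ≤ 0 := by
  have hsin : 0 < Real.sin ψ := Real.sin_pos_of_pos_of_lt_pi hψ (by linarith [Real.pi_pos])
  have hcos : 0 ≤ Real.cos ψ := Real.cos_nonneg_of_mem_Icc ⟨by linarith, hψ'⟩
  set z := (h + t * cis ψ : ℂ) with hz
  set y := (h + ((-t : ℝ) : ℂ) * cis ψ : ℂ) with hy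
  have zre : z.re = h + t * Real.cos ψ := by
    rw [hz, Complex.add_re, Complex.re_ofReal_mul, cis_re, Complex.ofReal_re]
  have zim : z.im = t * Real.sin ψ := by
    rw [hz, Complex.add_im, Complex.im_ofReal_mul, cis_im, Complex.ofReal_im, zero_add]
  have yre : y.re = h - t * Real.cos ψ := by
    rw [hy, Complex.add_re, Complex.re_ofReal_mul, cis_re, Complex.ofReal_re]; ring
  have yim : y.im = -(t * Real.sin ψ) := by
    rw [hy, Complex.add_im, Complex.im_ofReal_mul, cis_im, Complex.ofReal_im]; ring
  have hts := mul_pos ht hsin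
  have htc := mul_nonneg ht.le hcos
  have hzs : 0 < (sq 0 z).re := sq_zero_re_pos (Or.inr (by rw [zim]; exact hts.ne'))
  have hys : 0 < (sq 0 y).re := sq_zero_re_pos (Or.inr (by rw [yim]; exact neg_ne_zero.2 hts.ne'))
  have hn : ‖y‖ ≤ ‖z‖ := by
    refine (sq_le_sq₀ (norm_nonneg _) (norm_nonneg _)).1 ?_
    rw [← Complex.normSq_eq_norm_sq, ← Complex.normSq_eq_norm_sq, Complex.normSq_apply,
      Complex.normSq_apply, zre, zim, yre, yim]
    nlinarith
  have e1 := sq_zero_re_sq z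
  have e2 := sq_zero_re_sq y
  have hle : (sq 0 y).re ≤ (sq 0 z).re :=
    (sq_le_sq₀ hys.le hzs.le).1 (by rw [zre] at e1; rw [yre] at e2; linarith)
  have i1 := sq_zero_im_mul z
  have i2 := sq_zero_im_mul y
  rw [zim] at i1
  rw [yim] at i2
  have e3 : (sq 0 z).im = t * Real.sin ψ / (2 * (sq 0 z).re) := by field_simp; linarith
  have e4 : (sq 0 y).im = -(t * Real.sin ψ / (2 * (sq 0 y).re)) := by field_simp; linarith
  rw [e3, e4, ← sub_eq_add_neg, sub_nonpos]
  exact div_le_div_of_nonneg_left hts.le (by linarith) (by linarith)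

/-- The square roots of two points that are symmetric with respect to `h > 0`. -/
lemma im_pair_nonpos {h ψ : ℝ} (t : ℝ) (hh : 0 < h) (hψ : 0 < ψ) (hψ' : ψ ≤ Real.pi / 2) :
    (sq 0 (h + t * cis ψ)).im + (sq 0 (h + ((-t : ℝ) : ℂ) * cis ψ)).im ≤ 0 := by
  rcases lt_trichotomy t 0 with ht | rfl | ht
  · have := im_pair_nonpos_aux hh (neg_pos.2 ht) hψ hψ'
    rw [neg_neg] at this
    linarith
  · have h1 : (sq 0 (h : ℂ)).im = 0 := by
      have := sq_polar (κ := 0) (ρ := h) (θ := 0) hh.le (by linarith [Real.pi_pos])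
        (by linarith [Real.pi_pos])
      rw [zero_div, cis_zero, mul_one, mul_one] at this
      rw [this, Complex.ofReal_im]
    simp [h1]
  · exact im_pair_nonpos_aux hh ht hψ hψ'

section

variable {x₁ x₂ x₃ : ℂ} {w v u : ℝ}

lemma norm_polar {ρ θ : ℝ} (hρ : 0 < ρ) : ‖(ρ * cis θ : ℂ)‖ = ρ := by
  rw [norm_mul, norm_cis, Complex.norm_real, Real.norm_of_nonneg hρ.le, mul_one]

lemma Tri.exists_polar_center (T : Tri x₁ x₂ x₃ w v u) (hsum : x₁ + x₂ + x₃ = 0) :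
    ∃ ρ φ : ℝ, 0 < ρ ∧ u - Real.pi < φ ∧ φ < w ∧ x₂ = ρ * cis φ := by
  obtain ⟨b, hb, eb⟩ := T.side₁₂
  obtain ⟨a, ha, ea⟩ := T.side₂₃
  have h := add_mem_sector (a := u - Real.pi) (b := w) (P := a) (Q := b) (by linarith [T.uw])
    (by linarith [T.wv, T.vu]) ha hb
  obtain ⟨ρ, φ, hρ, h1, h2, e⟩ := h
  refine ⟨ρ / 3, φ, by positivity, h1, h2, ?_⟩
  rw [cis_sub_pi] at e
  push_cast
  linear_combination (1 / 3) * e + (1 / 3) * hsum + (1 / 3) * eb - (1 / 3) * ea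

/-- The real half period along the side `x₁ x₃` forces the central zero to be on the side of the
shorter trajectory. -/
lemma Central.center_nonneg (H : Central x₁ x₂ x₃ w v u) (hsum : x₁ + x₂ + x₃ = 0)
    (hle : ‖x₃ - x₂‖ ≤ ‖x₂ - x₁‖) {ρ φ : ℝ} (hρ : 0 < ρ) (h1 : u - Real.pi < φ) (h2 : φ < w)
    (hx : x₂ = ρ * cis φ) : 0 ≤ φ := by
  have hpi := Real.pi_pos
  have T := H.tri
  have A := H.ang
  have b1 := A.w_lt T.wv
  have b2 := A.lt_u T.vu
  have b3 := A.lt_v T.wv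
  have b4 := A.v_lt T.vu
  obtain ⟨c, hc, ec⟩ := T.side₁₃
  set ψ := v - φ with hψ
  have hψ0 : 0 < ψ := by linarith [T.wv]
  have hψpi : ψ < Real.pi := by linarith [T.vu]
  have hsin : 0 < Real.sin ψ := Real.sin_pos_of_pos_of_lt_pi hψ0 hψpi
  -- The midpoint of x₁x₃ is −x₂/2, so x₂ minus this midpoint is (3/2) x₂. In the frame rotated by φ
  -- the vectors from the side to x₂ are symmetric about h.
  set h := 3 * ρ / 2 with hh
  have hh0 : 0 < h := by positivity
  have ev : cis φ * cis ψ = cis v := by rw [← cis_add]; congr 1; ring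
  have e21 : x₂ - x₁ = cis φ * (h + (c / 2 : ℝ) * cis ψ) := by
    have : cis φ * (h + (c / 2 : ℝ) * cis ψ) = h * cis φ + (c / 2 : ℝ) * (cis φ * cis ψ) := by ring
    rw [this, ev, hh]
    push_cast
    linear_combination (3 / 2) * hx + (1 / 2) * ec - (1 / 2) * hsum
  have e23 : x₂ - x₃ = cis φ * (h + (-(c / 2) : ℝ) * cis ψ) := by
    have : cis φ * (h + (-(c / 2) : ℝ) * cis ψ) = h * cis φ + (-(c / 2) : ℝ) * (cis φ * cis ψ) := by
      ring
    rw [this, ev, hh]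
    push_cast
    linear_combination (3 / 2) * hx - (1 / 2) * ec - (1 / 2) * hsum
  -- The difference |x₂ − x₁|² − |x₂ − x₃|² equals 2hc cos ψ, so the hypothesis on the sides forbids
  -- cos ψ < 0.
  have hψ2 : ψ ≤ Real.pi / 2 := by
    by_contra hcon
    have hcos : Real.cos ψ < 0 :=
      Real.cos_neg_of_pi_div_two_lt_of_lt (not_le.1 hcon) (by linarith)
    rw [norm_sub_rev x₃ x₂, e21, e23, norm_mul, norm_mul, norm_cis, one_mul, one_mul] at hle
    have hle2 := (sq_le_sq₀ (norm_nonneg _) (norm_nonneg _)).2 hle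
    rw [← Complex.normSq_eq_norm_sq, ← Complex.normSq_eq_norm_sq, Complex.normSq_apply,
      Complex.normSq_apply] at hle2
    simp only [Complex.add_re, Complex.add_im, Complex.re_ofReal_mul, Complex.im_ofReal_mul,
      cis_re, cis_im, Complex.ofReal_re, Complex.ofReal_im] at hle2
    nlinarith [mul_pos hh0 hc]
  set σ : ℝ → ℂ := fun s => sq 0 (h + ((s - 1 / 2) * c : ℝ) * cis ψ) with hσ
  have hslit : ∀ s : ℝ, (h + ((s - 1 / 2) * c : ℝ) * cis ψ : ℂ) ∈ Complex.slitPlane := by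
    intro s
    by_cases hs : (s - 1 / 2) * c = 0
    · rw [hs]
      simpa using hh0
    · refine Or.inr ?_
      rw [Complex.add_im, Complex.im_ofReal_mul, cis_im, Complex.ofReal_im, zero_add]
      exact mul_ne_zero hs hsin.ne'
  have hσc : Continuous σ := by
    refine continuous_iff_continuousAt.2 fun s => ?_
    have h1 : ContinuousAt (sq 0) (h + ((s - 1 / 2) * c : ℝ) * cis ψ : ℂ) :=
      (hasDerivAt_sq (κ := 0) (by rw [neg_zero, cis_zero, mul_one]; exact hslit s)).continuousAt
    exact ContinuousAt.comp (f := fun s : ℝ => (h + ((s - 1 / 2) * c : ℝ) * cis ψ : ℂ)) h1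
      (by fun_prop)
  have hreal := im_halfPeriod H.real (a := x₃) (b := x₁) (z := x₂)
    (σ := fun s => cis (φ / 2) * σ s) (fun x => by rw [cubic]; ring)
    (continuousOn_const.mul hσc.continuousOn) (fun s _ => by
      have hp : cis (φ / 2) ^ 2 = cis φ := by rw [cis_pow]; congr 1; push_cast; ring
      have e : x₂ - (x₃ + s * (x₁ - x₃)) = (1 - s) * (x₂ - x₃) + s * (x₂ - x₁) := by ring
      rw [mul_pow, hσ, sq_sq, hp, e, e21, e23]
      push_cast
      ring)
  rw [wint_const_mul] at hreal
  have hJre : 0 < (wint σ).re := by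
    rw [wint_re hσc.continuousOn]
    exact integral_wt_mul_pos (Complex.continuous_re.comp hσc).continuousOn
      fun s _ => sq_zero_re_pos (hslit s)
  -- The weight is symmetric under s ↦ 1 − s, so the integrand may be paired with its reflection.
  have hJim : (wint σ).im ≤ 0 := by
    have hσr : Continuous fun s => σ (1 - s) := hσc.comp (by fun_prop)
    have h2J : 2 * (wint σ).im = (wint fun s => σ s + σ (1 - s)).im := by
      rw [wint_add hσc.continuousOn hσr.continuousOn, wint_comp_one_sub, Complex.add_im]
      ring
    have hle0 : (wint fun s => σ s + σ (1 - s)).im ≤ 0 := by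
      have hcs : Continuous fun s => σ s + σ (1 - s) := hσc.add hσr
      rw [wint_im hcs.continuousOn]
      rw [← neg_nonneg, ← intervalIntegral.integral_neg]
      refine intervalIntegral.integral_nonneg zero_le_one fun s _ => ?_
      rw [neg_nonneg]
      refine mul_nonpos_of_nonneg_of_nonpos (wt_nonneg s) ?_
      have e : σ (1 - s) = sq 0 (h + ((-((s - 1 / 2) * c) : ℝ) : ℂ) * cis ψ) := by
        simp only [hσ]
        congr 3
        push_cast
        ring
      rw [e, Complex.add_im]
      exact im_pair_nonpos _ hh0 hψ0 hψ2
    linarith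
  have hJ0 : wint σ ≠ 0 := by
    intro h
    rw [h] at hJre
    simp at hJre
  set θ := Complex.arg (wint σ) with hθ
  have hθ1 : -(Real.pi / 2) < θ := by
    have := Complex.abs_arg_lt_pi_div_two_iff.2 (Or.inl hJre)
    exact (abs_lt.1 this).1
  have hθ2 : θ ≤ 0 := by
    rcases hJim.eq_or_lt with h | h
    · exact (Complex.arg_eq_zero_iff.2 ⟨hJre.le, h⟩).le
    · exact (Complex.arg_neg_iff.2 h).le
  have hpol : (x₁ - x₃) ^ 2 * (cis (φ / 2) * wint σ) =
      ((c ^ 2 * ‖wint σ‖ : ℝ) : ℂ) * cis (2 * v + φ / 2 + θ) := by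
    have e1 : (x₁ - x₃) ^ 2 = c ^ 2 * cis (2 * v) := by
      have : (x₁ - x₃) ^ 2 = (x₃ - x₁) ^ 2 := by ring
      rw [this, ec, mul_pow, cis_pow]
      push_cast
      ring
    rw [cis_add, cis_add, e1]
    nth_rewrite 1 [← norm_mul_cis_arg (wint σ)]
    rw [← hθ]
    push_cast
    ring
  rw [hpol, Complex.im_ofReal_mul, cis_im] at hreal
  have hsin0 := (mul_eq_zero.1 hreal).resolve_left
    (mul_pos (pow_pos hc 2) (norm_pos_iff.2 hJ0)).ne'
  obtain ⟨k, hk⟩ := Real.sin_eq_zero_iff.1 hsin0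
  -- The bounds on v, φ and θ put the argument 2v + φ/2 + θ strictly between 0 and 2π, so it equals
  -- π. With θ ≤ 0 and v ≤ φ + π/2 this gives π ≤ 5φ/2 + π, that is, φ ≥ 0.
  have hk1 : k < 2 := int_lt_of_mul_pi_lt (by push_cast; linarith)
  have hk0 : 0 < k := int_lt_of_mul_pi_lt (by push_cast; linarith)
  have hk' : k = 1 := by omega
  rw [hk'] at hk
  push_cast at hk
  linarith

lemma Central.center (H : Central x₁ x₂ x₃ w v u) (hsum : x₁ + x₂ + x₃ = 0) :
    x₂ ≠ 0 ∧ (‖x₃ - x₂‖ ≤ ‖x₂ - x₁‖ → 0 ≤ Complex.arg x₂ ∧ Complex.arg x₂ < 2 * Real.pi / 5) ∧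
      (‖x₂ - x₁‖ ≤ ‖x₃ - x₂‖ → -(2 * Real.pi / 5) < Complex.arg x₂ ∧ Complex.arg x₂ ≤ 0) := by
  have hpi := Real.pi_pos
  have b1 := H.ang.w_lt H.tri.wv
  have b2 := H.ang.lt_u H.tri.vu
  obtain ⟨ρ, φ, hρ, h1, h2, e⟩ := H.tri.exists_polar_center hsum
  have harg : Complex.arg x₂ = φ := by rw [e]; exact arg_mul_cis hρ (by linarith) (by linarith)
  refine ⟨?_, fun hle => ?_, fun hle => ?_⟩
  · rw [e]; exact mul_ne_zero (by exact_mod_cast hρ.ne') (cis_ne_zero _)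
  · rw [harg]
    exact ⟨H.center_nonneg hsum hle hρ h1 h2 e, by linarith⟩
  · rw [harg]
    refine ⟨by linarith, ?_⟩
    have hsum' : starRingEnd ℂ x₃ + starRingEnd ℂ x₂ + starRingEnd ℂ x₁ = 0 := by
      rw [← map_add, ← map_add, show x₃ + x₂ + x₁ = 0 by rw [← hsum]; ring, map_zero]
    have hle' : ‖starRingEnd ℂ x₁ - starRingEnd ℂ x₂‖ ≤ ‖starRingEnd ℂ x₂ - starRingEnd ℂ x₃‖ := by
      rw [← map_sub, ← map_sub, Complex.norm_conj, Complex.norm_conj, norm_sub_rev x₁,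
        norm_sub_rev x₂ x₃]
      exact hle
    have := H.conj.center_nonneg hsum' hle' (φ := -φ) hρ (by linarith) (by linarith)
      (by rw [e, map_mul, conj_cis, Complex.conj_ofReal])
    linarith

end

/-! ### Control of the angles by A/B, and uniqueness of the rotation -/

section

variable {x₁ x₂ x₃ : ℂ} {w v u : ℝ}

lemma Tri.norm_pos (T : Tri x₁ x₂ x₃ w v u) : 0 < ‖x₂ - x₁‖ ∧ 0 < ‖x₃ - x₂‖ := by
  obtain ⟨b, hb, eb⟩ := T.side₁₂
  obtain ⟨a, ha, ea⟩ := T.side₂₃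
  rw [eb, ea, norm_polar hb, norm_polar ha]
  exact ⟨hb, ha⟩

lemma Central.angle (H : Central x₁ x₂ x₃ w v u) : 0 < u - w ∧ u - w < Real.pi / 2 := by
  obtain ⟨h1, h2⟩ := angle_bounds H.tri H.ang
  constructor <;> linarith [Real.pi_pos]

lemma Central.lt_of_norm_lt (H : Central x₁ x₂ x₃ w v u) {A B : ℝ}
    (hA : HorizontalTrajectory (cubic x₁ x₂ x₃) x₂ x₃ A)
    (hB : HorizontalTrajectory (cubic x₁ x₂ x₃) x₂ x₁ B) (h : ‖x₃ - x₂‖ < ‖x₂ - x₁‖) : A < B := by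
  rw [H.length_third hA, H.length_first hB]
  exact length_lt H.angle.1 H.angle.2 H.tri.norm_pos.2 h

lemma Central.lt_of_norm_lt' (H : Central x₁ x₂ x₃ w v u) {A B : ℝ}
    (hA : HorizontalTrajectory (cubic x₁ x₂ x₃) x₂ x₃ A)
    (hB : HorizontalTrajectory (cubic x₁ x₂ x₃) x₂ x₁ B) (h : ‖x₂ - x₁‖ < ‖x₃ - x₂‖) : B < A := by
  rw [H.length_third hA, H.length_first hB]
  exact length_lt H.angle.1 H.angle.2 H.tri.norm_pos.1 h

lemma Tri.sine_law (T : Tri x₁ x₂ x₃ w v u) :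
    ‖x₂ - x₁‖ * Real.sin (v - w) = ‖x₃ - x₂‖ * Real.sin (u - v) := by
  obtain ⟨b, hb, eb⟩ := T.side₁₂
  obtain ⟨c, hc, ec⟩ := T.side₁₃
  obtain ⟨a, ha, ea⟩ := T.side₂₃
  rw [eb, ea, norm_polar hb, norm_polar ha]
  have h : a * cis u * cis (-v) = c * cis v * cis (-v) - b * cis w * cis (-v) := by
    rw [← ea, ← eb, ← ec]; ring
  have h2 := congrArg Complex.im h
  rw [Complex.sub_im, im_mul_cis_mul_cis, im_mul_cis_mul_cis, im_mul_cis_mul_cis, add_neg_cancel,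
    Real.sin_zero, mul_zero, zero_sub, ← mul_neg, ← Real.sin_neg] at h2
  rw [← sub_eq_add_neg, neg_add, neg_neg, neg_add_eq_sub] at h2
  exact h2.symm

/-- The angle at `x₁` is controlled by the ratio of the lengths of the trajectories. -/
lemma Central.angle_le (H : Central x₁ x₂ x₃ w v u) {A B : ℝ}
    (hA : HorizontalTrajectory (cubic x₁ x₂ x₃) x₂ x₃ A)
    (hB : HorizontalTrajectory (cubic x₁ x₂ x₃) x₂ x₁ B) (hAB : A ≤ B) :
    v - w ≤ Real.pi / 2 * Real.sqrt (2 * (A / B)) := by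
  have hpi := Real.pi_pos
  obtain ⟨hb, ha⟩ := H.tri.norm_pos
  have hle : ‖x₃ - x₂‖ ≤ ‖x₂ - x₁‖ :=
    not_lt.1 fun h => absurd (H.lt_of_norm_lt' hA hB h) (not_lt.2 hAB)
  have hr := sq_ratio_le H.angle.1 H.angle.2 ha hle
  rw [← H.length_third hA, ← H.length_first hB] at hr
  have hr' := Real.le_sqrt_of_sq_le hr
  have hwv := H.tri.wv
  have hvu := H.tri.vu
  have hs := H.tri.sine_law
  have h1 : Real.sin (v - w) ≤ ‖x₃ - x₂‖ / ‖x₂ - x₁‖ := by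
    rw [le_div_iff₀ hb, mul_comm, hs]
    exact mul_le_of_le_one_right ha.le (Real.sin_le_one _)
  -- Jordan's inequality, valid because v − w < u − w < π/2.
  have h2 := Real.mul_le_sin (x := v - w) (by linarith) (by linarith [H.angle.2])
  have h3 : 2 / Real.pi * (v - w) ≤ Real.sqrt (2 * (A / B)) := by linarith
  rw [div_mul_eq_mul_div, div_le_iff₀ hpi] at h3
  linarith

/-- The two arguments differ by an integer multiple of 2π/5, and the hypothesis leaves only the
multiple 0. -/
lemma eq_one_of_arg_close {z : ℂ} (hz : z ≠ 0) {n : ℤ}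
    (h : |Complex.arg (cis (2 * Real.pi * n / 5) * z) - Complex.arg z| < 2 * Real.pi / 5) :
    cis (2 * Real.pi * n / 5) = 1 := by
  have hpi := Real.pi_pos
  set ε := cis (2 * Real.pi * n / 5) with hε
  have hn : ‖ε * z‖ = ‖z‖ := by rw [norm_mul, norm_cis, one_mul]
  have hz0 : (‖z‖ : ℂ) ≠ 0 := by exact_mod_cast norm_ne_zero_iff.2 hz
  have e1 : (‖z‖ : ℂ) * cis (Complex.arg (ε * z)) =
      ‖z‖ * cis (2 * Real.pi * n / 5 + Complex.arg z) := by
    have := norm_mul_cis_arg (ε * z)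
    rw [hn] at this
    rw [this, cis_add, ← hε]
    nth_rewrite 1 [← norm_mul_cis_arg z]
    ring
  have e2 := mul_left_cancel₀ hz0 e1
  rw [cis, cis, Complex.exp_eq_exp_iff_exists_int] at e2
  obtain ⟨m, hm⟩ := e2
  have hm' := congrArg Complex.im hm
  simp only [Complex.add_im, Complex.mul_im, Complex.ofReal_re, Complex.ofReal_im, Complex.I_re,
    Complex.I_im, Complex.intCast_re, Complex.intCast_im, Complex.mul_re] at hm'
  norm_num at hm'
  have hd : Complex.arg (ε * z) - Complex.arg z = 2 * Real.pi / 5 * ((n + 5 * m : ℤ) : ℝ) := by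
    rw [hm']; push_cast; ring
  rw [hd, abs_mul, abs_of_pos (by positivity : (0 : ℝ) < 2 * Real.pi / 5)] at h
  have h1 : |((n + 5 * m : ℤ) : ℝ)| < 1 := by
    by_contra hcon
    nlinarith [not_lt.1 hcon]
  have h2 : n + 5 * m = 0 := by
    have h3 : |n + 5 * m| < 1 := by exact_mod_cast h1
    exact Int.abs_lt_one_iff.1 h3
  rw [hε, cis, Complex.exp_eq_one_iff]
  refine ⟨-m, ?_⟩
  have : (n : ℂ) = -5 * m := by exact_mod_cast (by linarith : n = -5 * m)
  push_cast
  rw [this]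
  ring

end

/-- The arguments of x₂ and of the rotated x₂ lie in the same half-open interval of length 2π/5, on
the side selected by comparing A with B, so the rotation into normal form is the identity. -/
lemma NormalizedCurve.exists_central (c : NormalizedCurve) :
    ∃ w v u : ℝ, Central c.x₁ c.x₂ c.x₃ w v u := by
  obtain ⟨w, v, u, T⟩ := c.toCurve.exists_tri
  obtain ⟨n, w', v', u', h⟩ :=
    exists_central_of_trajectories T c.realPeriods c.trajectory_A c.trajectory_B
  obtain ⟨H, hA, hB⟩ := h _ rfl
  set ε := cis (2 * Real.pi * n / 5) with hε
  have hsum : ε * c.x₁ + ε * c.x₂ + ε * c.x₃ = 0 := by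
    linear_combination ε * c.sum_eq_zero
  obtain ⟨h0, hpos, hneg⟩ := H.center hsum
  have hx0 : c.x₂ ≠ 0 := fun h => h0 (by rw [h, mul_zero])
  have hone : ε = 1 := by
    refine eq_one_of_arg_close hx0 ?_
    rw [← hε, abs_lt]
    rcases le_or_gt c.A c.B with hAB | hAB
    · obtain ⟨g1, g2⟩ := hpos
        (not_lt.1 fun h => absurd (H.lt_of_norm_lt' hA hB h) (not_lt.2 hAB))
      obtain ⟨g3, g4⟩ := c.normalized_of_le hAB
      constructor <;> linarith
    · obtain ⟨g1, g2⟩ := hneg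
        (not_lt.1 fun h => absurd (H.lt_of_norm_lt hA hB h) (not_lt.2 hAB.le))
      obtain ⟨g3, g4⟩ := c.normalized_of_lt hAB
      constructor <;> linarith
  rw [hone, one_mul, one_mul, one_mul] at H
  exact ⟨w', v', u', H⟩

lemma Central.arg_eq {x₁ x₂ x₃ : ℂ} {w v u : ℝ} (H : Central x₁ x₂ x₃ w v u) :
    Complex.arg (x₃ - x₂) = u ∧ Complex.arg (x₃ - x₁) = v ∧ Complex.arg (x₂ - x₁) = w := by
  have hpi := Real.pi_pos
  obtain ⟨b, hb, eb⟩ := H.tri.side₁₂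
  obtain ⟨c, hc, ec⟩ := H.tri.side₁₃
  obtain ⟨a, ha, ea⟩ := H.tri.side₂₃
  have h1 := H.ang.lt_w
  have h2 := H.ang.u_lt
  have h3 := H.tri.wv
  have h4 := H.tri.vu
  refine ⟨?_, ?_, ?_⟩
  · rw [ea]; exact arg_mul_cis ha (by linarith) (by linarith)
  · rw [ec]; exact arg_mul_cis hc (by linarith) (by linarith)
  · rw [eb]; exact arg_mul_cis hb (by linarith) (by linarith)

/-- The arguments of the differences of the zeros of a normalized curve. -/
lemma NormalizedCurve.central (c : NormalizedCurve) :
    Central c.x₁ c.x₂ c.x₃ (Complex.arg (c.x₂ - c.x₁)) (Complex.arg (c.x₃ - c.x₁))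
      (Complex.arg (c.x₃ - c.x₂)) := by
  obtain ⟨w, v, u, H⟩ := c.exists_central
  obtain ⟨h1, h2, h3⟩ := H.arg_eq
  rw [h1, h2, h3]
  exact H

/-! ### The branch of the argument of the discriminant, the limits and the symmetric case -/

lemma Curve.discr_eq (c : Curve) :
    c.discr = ‖c.discr‖ * Complex.exp (c.argDiscr * Complex.I) := by
  set a := ‖c.x₃ - c.x₂‖
  set b := ‖c.x₂ - c.x₁‖
  set d := ‖c.x₃ - c.x₁‖
  have h : c.discr = (((a * d * b) ^ 2 : ℝ) : ℂ) * cis c.argDiscr := by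
    have e : c.discr = ((c.x₃ - c.x₂) * (c.x₃ - c.x₁) * (c.x₂ - c.x₁)) ^ 2 := by
      rw [discr]; ring
    have e2 : cis c.argDiscr = (cis (Complex.arg (c.x₃ - c.x₂)) * cis (Complex.arg (c.x₃ - c.x₁)) *
        cis (Complex.arg (c.x₂ - c.x₁))) ^ 2 := by
      rw [← cis_add, ← cis_add, cis_pow, argDiscr]; push_cast; rfl
    have e3 : ((c.x₃ - c.x₂) * (c.x₃ - c.x₁) * (c.x₂ - c.x₁)) ^ 2 =
        ((a * cis (Complex.arg (c.x₃ - c.x₂))) * (d * cis (Complex.arg (c.x₃ - c.x₁))) *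
          (b * cis (Complex.arg (c.x₂ - c.x₁)))) ^ 2 := by
      rw [norm_mul_cis_arg, norm_mul_cis_arg, norm_mul_cis_arg]
    rw [e, e2, e3]
    push_cast
    ring
  have hn : ‖c.discr‖ = (a * d * b) ^ 2 := by
    rw [h, norm_mul, norm_cis, Complex.norm_real, Real.norm_of_nonneg (by positivity), mul_one]
  rw [hn]
  exact h

/-- Arguments strictly between 0 and π keep the values of f off the cut of `Complex.arg`. -/
lemma NormalizedCurve.continuous_arg {f : ℂ × ℂ × ℂ → ℂ} (hf : Continuous f)
    (h : ∀ c : NormalizedCurve, 0 < Complex.arg (f (c.x₁, c.x₂, c.x₃)) ∧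
      Complex.arg (f (c.x₁, c.x₂, c.x₃)) < Real.pi) :
    Continuous fun c : NormalizedCurve => Complex.arg (f (c.x₁, c.x₂, c.x₃)) := by
  have hind : Continuous fun c : NormalizedCurve => (c.x₁, c.x₂, c.x₃) := continuous_induced_dom
  have hc : Continuous fun c : NormalizedCurve => f (c.x₁, c.x₂, c.x₃) := hf.comp hind
  refine continuous_iff_continuousAt.2 fun c => ?_
  refine ContinuousAt.comp (f := fun c : NormalizedCurve => f (c.x₁, c.x₂, c.x₃))
    (Complex.continuousAt_arg ?_) hc.continuousAt
  refine Complex.mem_slitPlane_iff_arg.2 ⟨(h c).2.ne, fun h0 => ?_⟩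
  have := (h c).1
  rw [h0, Complex.arg_zero] at this
  exact lt_irrefl _ this

lemma NormalizedCurve.continuous_argDiscr :
    Continuous fun c : NormalizedCurve => c.argDiscr := by
  have hpi := Real.pi_pos
  have b : ∀ c : NormalizedCurve, 0 < Complex.arg (c.x₂ - c.x₁) ∧
      Complex.arg (c.x₂ - c.x₁) < Complex.arg (c.x₃ - c.x₁) ∧
      Complex.arg (c.x₃ - c.x₁) < Complex.arg (c.x₃ - c.x₂) ∧
      Complex.arg (c.x₃ - c.x₂) < Real.pi := fun c =>
    ⟨by linarith [c.central.ang.lt_w], c.central.tri.wv, c.central.tri.vu,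
      by linarith [c.central.ang.u_lt]⟩
  have h1 := NormalizedCurve.continuous_arg (f := fun p => p.2.2 - p.2.1) (by fun_prop)
    fun c => ⟨by linarith [(b c).1, (b c).2.1, (b c).2.2.1], (b c).2.2.2⟩
  have h2 := NormalizedCurve.continuous_arg (f := fun p => p.2.2 - p.1) (by fun_prop)
    fun c => ⟨by linarith [(b c).1, (b c).2.1], by linarith [(b c).2.2.1, (b c).2.2.2]⟩
  have h3 := NormalizedCurve.continuous_arg (f := fun p => p.2.1 - p.1) (by fun_prop)
    fun c => ⟨(b c).1, by linarith [(b c).2.1, (b c).2.2.1, (b c).2.2.2]⟩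
  exact continuous_const.mul ((h1.add h2).add h3)

lemma tendsto_of_angle_bound {X : Type*} {l : Filter X} {f r : X → ℝ} {a : ℝ}
    (hr : Tendsto r l (𝓝 0))
    (h : ∀ᶠ x in l, |f x - a| ≤ Real.pi / 2 * Real.sqrt (2 * r x)) : Tendsto f l (𝓝 a) := by
  have hb : Tendsto (fun x => Real.pi / 2 * Real.sqrt (2 * r x)) l (𝓝 0) := by
    have hc : Continuous fun t : ℝ => Real.pi / 2 * Real.sqrt (2 * t) := by fun_prop
    have h0 := (hc.tendsto 0).comp hr
    rw [mul_zero, Real.sqrt_zero, mul_zero] at h0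
    exact h0
  rw [tendsto_iff_dist_tendsto_zero]
  exact squeeze_zero' (Eventually.of_forall fun _ => dist_nonneg)
    (h.mono fun x hx => by rwa [Real.dist_eq]) hb

lemma eventually_toBoundaryA :
    ∀ᶠ c in toBoundaryA, Complex.arg (c.x₃ - c.x₁) - Complex.arg (c.x₂ - c.x₁) ≤
      Real.pi / 2 * Real.sqrt (2 * (c.A / c.B)) := by
  have ht : Tendsto (fun c : NormalizedCurve => c.A / c.B) toBoundaryA (𝓝 0) := tendsto_comap
  filter_upwards [ht.eventually (gt_mem_nhds one_pos)] with c hc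
  have hB : 0 < c.B := c.trajectory_B.1
  rw [div_lt_one hB] at hc
  exact c.central.angle_le c.trajectory_A c.trajectory_B hc.le

lemma eventually_toBoundaryB :
    ∀ᶠ c in toBoundaryB, Complex.arg (c.x₃ - c.x₂) - Complex.arg (c.x₃ - c.x₁) ≤
      Real.pi / 2 * Real.sqrt (2 * (c.B / c.A)) := by
  have ht : Tendsto (fun c : NormalizedCurve => c.B / c.A) toBoundaryB (𝓝 0) := tendsto_comap
  filter_upwards [ht.eventually (gt_mem_nhds one_pos)] with c hc
  have hA : 0 < c.A := c.trajectory_A.1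
  rw [div_lt_one hA] at hc
  have := c.central.conj.angle_le (horizontalTrajectory_conj c.trajectory_B)
    (horizontalTrajectory_conj c.trajectory_A) hc.le
  linarith

lemma tendsto_toBoundaryA :
    Tendsto (fun c : NormalizedCurve => Complex.arg (c.x₃ - c.x₂)) toBoundaryA
        (𝓝 (13 * Real.pi / 20)) ∧
      Tendsto (fun c : NormalizedCurve => Complex.arg (c.x₃ - c.x₁)) toBoundaryA
        (𝓝 (2 * Real.pi / 5)) ∧
      Tendsto (fun c : NormalizedCurve => Complex.arg (c.x₂ - c.x₁)) toBoundaryA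
        (𝓝 (2 * Real.pi / 5)) := by
  have ht : Tendsto (fun c : NormalizedCurve => c.A / c.B) toBoundaryA (𝓝 0) := tendsto_comap
  refine ⟨tendsto_of_angle_bound ht ?_, tendsto_of_angle_bound ht ?_,
    tendsto_of_angle_bound ht ?_⟩
  all_goals
    filter_upwards [eventually_toBoundaryA] with c hc
    have T := c.central.tri
    have h := c.central.ang
    have h1 := h.w_lt T.wv
    have h2 := h.lt_v T.wv
    rw [abs_le]
    -- From w < 2π/5 < v both are within v − w of 2π/5, while 3π/4 − v/4 < u < 3π/4 − w/4 puts u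
    -- within (v − w)/4 of 13π/20.
    constructor <;> linarith [h.h₅, h.h₆, T.wv]

lemma tendsto_toBoundaryB :
    Tendsto (fun c : NormalizedCurve => Complex.arg (c.x₃ - c.x₂)) toBoundaryB
        (𝓝 (3 * Real.pi / 5)) ∧
      Tendsto (fun c : NormalizedCurve => Complex.arg (c.x₃ - c.x₁)) toBoundaryB
        (𝓝 (3 * Real.pi / 5)) ∧
      Tendsto (fun c : NormalizedCurve => Complex.arg (c.x₂ - c.x₁)) toBoundaryB
        (𝓝 (7 * Real.pi / 20)) := by
  have ht : Tendsto (fun c : NormalizedCurve => c.B / c.A) toBoundaryB (𝓝 0) := tendsto_comap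
  refine ⟨tendsto_of_angle_bound ht ?_, tendsto_of_angle_bound ht ?_,
    tendsto_of_angle_bound ht ?_⟩
  all_goals
    filter_upwards [eventually_toBoundaryB] with c hc
    have T := c.central.tri
    have h := c.central.ang
    have h1 := h.v_lt T.vu
    have h2 := h.lt_u T.vu
    rw [abs_le]
    -- From v < 3π/5 < u both are within u − v of 3π/5, while π/2 − u/4 < w < π/2 − v/4 puts w
    -- within (u − v)/4 of 7π/20.
    constructor <;> linarith [h.h₁, h.h₂, T.vu]

lemma NormalizedCurve.symmetric (c : NormalizedCurve) (hAB : c.A = c.B) :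
    Complex.arg (c.x₃ - c.x₂) = Real.pi - Complex.arg (c.x₂ - c.x₁) ∧
      Complex.arg (c.x₃ - c.x₁) = Real.pi / 2 := by
  have hpi := Real.pi_pos
  have H := c.central
  set w := Complex.arg (c.x₂ - c.x₁)
  set v := Complex.arg (c.x₃ - c.x₁)
  set u := Complex.arg (c.x₃ - c.x₂)
  have b1 := H.ang.w_lt H.tri.wv
  have b2 := H.ang.lt_u H.tri.vu
  have b3 := H.ang.lt_w
  have b4 := H.ang.u_lt
  have h1 := H.tri.wv
  have h2 := H.tri.vu
  obtain ⟨h0, hpos, hneg⟩ := H.center c.sum_eq_zero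
  have hle : ‖c.x₃ - c.x₂‖ ≤ ‖c.x₂ - c.x₁‖ := not_lt.1 fun h =>
    absurd (H.lt_of_norm_lt' c.trajectory_A c.trajectory_B h) (not_lt.2 hAB.le)
  have hge : ‖c.x₂ - c.x₁‖ ≤ ‖c.x₃ - c.x₂‖ := not_lt.1 fun h =>
    absurd (H.lt_of_norm_lt c.trajectory_A c.trajectory_B h) (not_lt.2 hAB.ge)
  have harg : Complex.arg c.x₂ = 0 := le_antisymm (hneg hge).2 (hpos hle).1
  have him : c.x₂.im = 0 := (Complex.arg_eq_zero_iff.1 harg).2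
  obtain ⟨b, hb, eb⟩ := H.tri.side₁₂
  obtain ⟨d, hd, ed⟩ := H.tri.side₁₃
  obtain ⟨a, ha, ea⟩ := H.tri.side₂₃
  rw [eb, ea, norm_polar hb, norm_polar ha] at hle hge
  have hab : a = b := le_antisymm hle hge
  -- Since the zeros sum to 0, (x₂ − x₁) − (x₃ − x₂) = 3x₂, which is real here. With a = b this
  -- gives sin w = sin u, and the bounds w < 2π/5 and 3π/5 < u select u = π − w.
  have e1 : (b * cis w - a * cis u).im = 0 := by
    have : (b * cis w - a * cis u : ℂ) = (3 : ℝ) * c.x₂ := by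
      rw [← ea, ← eb]; push_cast; linear_combination -c.sum_eq_zero
    rw [this, Complex.im_ofReal_mul, him, mul_zero]
  rw [Complex.sub_im, Complex.im_ofReal_mul, Complex.im_ofReal_mul, cis_im, cis_im, hab,
    ← mul_sub] at e1
  have e2 : Real.sin w = Real.sin (Real.pi - u) := by
    rw [Real.sin_pi_sub]
    linarith [(mul_eq_zero.1 e1).resolve_left hb.ne']
  have e3 : w = Real.pi - u :=
    Real.injOn_sin ⟨by linarith, by linarith⟩ ⟨by linarith, by linarith⟩ e2
  have hu : u = Real.pi - w := by linarith
  refine ⟨hu, ?_⟩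
  have e4 : (d * cis v : ℂ) = b * cis w + a * cis u := by
    rw [← ea, ← eb, ← ed]; ring
  have e5 := congrArg Complex.re e4
  rw [Complex.add_re, Complex.re_ofReal_mul, Complex.re_ofReal_mul, Complex.re_ofReal_mul, cis_re,
    cis_re, cis_re, hu, hab, Real.cos_pi_sub] at e5
  have e6 : Real.cos v = 0 :=
    (mul_eq_zero.1 (by linarith : d * Real.cos v = 0)).resolve_left hd.ne'
  exact Real.injOn_cos ⟨by linarith, by linarith⟩ ⟨by linarith, by linarith⟩
    (by rw [e6, Real.cos_pi_div_two])

end Boutroux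

end

theorem lemma5p7 :
    -- `argDiscr` is a continuous branch of the argument of the discriminant
    ((∀ c : Boutroux.NormalizedCurve,
        c.discr = ‖c.discr‖ * Complex.exp (c.argDiscr * Complex.I)) ∧
      Continuous (fun c : Boutroux.NormalizedCurve => c.argDiscr)) ∧
    -- `A → 0`
    (Tendsto (fun c : Boutroux.NormalizedCurve => Complex.arg (c.x₃ - c.x₂))
        Boutroux.toBoundaryA (𝓝 (13 * Real.pi / 20)) ∧
      Tendsto (fun c : Boutroux.NormalizedCurve => Complex.arg (c.x₃ - c.x₁))
        Boutroux.toBoundaryA (𝓝 (2 * Real.pi / 5)) ∧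
      Tendsto (fun c : Boutroux.NormalizedCurve => Complex.arg (c.x₂ - c.x₁))
        Boutroux.toBoundaryA (𝓝 (2 * Real.pi / 5)) ∧
      Tendsto (fun c : Boutroux.NormalizedCurve => c.argDiscr)
        Boutroux.toBoundaryA (𝓝 (29 * Real.pi / 10))) ∧
    -- `A = B`
    (∀ c : Boutroux.NormalizedCurve, c.A = c.B →
      ∃ α : ℝ, 0 < α ∧ α < Real.pi / 2 ∧
        Complex.arg (c.x₃ - c.x₂) = Real.pi - α ∧
        Complex.arg (c.x₃ - c.x₁) = Real.pi / 2 ∧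
        Complex.arg (c.x₂ - c.x₁) = α ∧
        c.argDiscr = 3 * Real.pi) ∧
    -- `B → 0`
    (Tendsto (fun c : Boutroux.NormalizedCurve => Complex.arg (c.x₃ - c.x₂))
        Boutroux.toBoundaryB (𝓝 (3 * Real.pi / 5)) ∧
      Tendsto (fun c : Boutroux.NormalizedCurve => Complex.arg (c.x₃ - c.x₁))
        Boutroux.toBoundaryB (𝓝 (3 * Real.pi / 5)) ∧
      Tendsto (fun c : Boutroux.NormalizedCurve => Complex.arg (c.x₂ - c.x₁))
        Boutroux.toBoundaryB (𝓝 (7 * Real.pi / 20)) ∧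
      Tendsto (fun c : Boutroux.NormalizedCurve => c.argDiscr)
        Boutroux.toBoundaryB (𝓝 (31 * Real.pi / 10))) := by
  refine ⟨⟨fun c => c.toCurve.discr_eq, Boutroux.NormalizedCurve.continuous_argDiscr⟩, ?_, ?_, ?_⟩
  · obtain ⟨h1, h2, h3⟩ := Boutroux.tendsto_toBoundaryA
    refine ⟨h1, h2, h3, ?_⟩
    have h := ((h1.add h2).add h3).const_mul 2
    rwa [show 2 * (13 * Real.pi / 20 + 2 * Real.pi / 5 + 2 * Real.pi / 5) = 29 * Real.pi / 10 by
      ring] at h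
  · intro c hAB
    obtain ⟨h1, h2⟩ := c.symmetric hAB
    have hpi := Real.pi_pos
    have b1 := c.central.ang.lt_w
    have b2 := c.central.ang.w_lt c.central.tri.wv
    refine ⟨Complex.arg (c.x₂ - c.x₁), by linarith, by linarith, h1, h2, rfl, ?_⟩
    rw [Boutroux.Curve.argDiscr, h1, h2]
    ring
  · obtain ⟨h1, h2, h3⟩ := Boutroux.tendsto_toBoundaryB
    refine ⟨h1, h2, h3, ?_⟩
    have h := ((h1.add h2).add h3).const_mul 2
    rwa [show 2 * (3 * Real.pi / 5 + 3 * Real.pi / 5 + 7 * Real.pi / 20) = 31 * Real.pi / 10 by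
      ring] at h
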